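/- **Conventions.** Hypergraphs are finite and simple, and hyperedges are nonempty. The arity of a hyperedge is its number of vertices, the rank of a hypergraph is its largest arity, and $n$, $m$ are the numbers of vertices and hyperedges. A homomorphism $H\to G$ is a map $\phi:V(H)\to V(G)$ with $\phi(e)\in E(G)$ for every $e\in E(H)$; $\mathrm{Hom}(G,H)$ is the number of homomorphisms from $H$ to $G$. For $l\in\{0,1,2,\dots\}\cup\{\infty\}$ and $S\subseteq V(G)$, the induced $l$-trimmed subhypergraph of $G$ on $S$ has vertex set $S$ and hyperedge set $\{e\cap S : e\in E(G),\ |e\setminus S|\le l,\ e\cap S\ne\emptyset\}$. The $l$-degeneracy $\kappa_l(G)$ is the least $\kappa$ such that every induced $l$-trimmed subhypergraph of $G$ on a nonempty set has a vertex contained in at most $\kappa$ of its hyperedges. A hypergraph $H'$ belongs to $\mathcal H_l$ (is an $l$-obstruction) if there is a set $C\subseteq V(H')$ with $|C|\ge 3$ such that, where $D$ ranges over the vertex sets of the connected components of the induced $\infty$-trimmed subhypergraph of $H'$ on $V(H')\setminus C$, and $E_D=\{e\in E(H') : e\subseteq C\cup D,\ |e|>1\}$: 1. the induced $l$-trimmed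 subhypergraph of $H'$ on $C$ has no hyperedge of arity greater than $1$; 2. no $D$ satisfies $C\subseteq\bigcup_{e\in E_D}e$; 3. for every $c\in C$ there is a $D$ with $C\setminus\{c\}\subseteq\bigcup_{e\in E_D}e$ and $c\notin\bigcup_{e\in E_D}e$. A $k$-simplex in $G$ is a set of $k+1$ vertices all of whose $k$-element subsets are hyperedges of $G$. Algorithms are deterministic and run on a unit-cost word RAM with words of $O(\log(n+m))$ bits; the input hypergraph is given as $n$, $m$ and a list of its hyperedges, each given as the list of its vertices. **Theorem.** Let $l\in\{0,1,2,\dots\}\cup\{\infty\}$ and let $H$ be a finite hypergraph such that the induced $\infty$-trimmed subhypergraph of $H$ on some $S\subseteq V(H)$ belongs to $\mathcal H_l$. Then there is an integer $k\ge 2$, depending only on $H$ and $l$, such that for every real $\gamma>1$ the following holds. Suppose that there are a function $f$ and an algorithm that computes $\mathrm{Hom}(G,H)$ for all hypergraphs $G$ in time $f(\kappa_l(G))\cdot O(n^{\gamma})$, where the constant in $O(\cdot)$ may depend on (a bound for) the rank of $G$. Then there is an algorithm that decides, for every hypergraph $G$ all of whose hyperedges have arity exactly $k$, whether $G$ contains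 a $k$-simplex, in time $\tilde O(m^{\gamma})$, i.e. $O(m^{\gamma}(\log m)^{b})$ for some constant $b$. -/

import Mathlib

/-! ## Hypergraphs

Hypergraphs are Mathlib's `Hypergraph α`: a vertex set together with a set of vertex subsets. -/

namespace Hypergraph

variable {α β : Type*}

/-- A finite hypergraph all of whose hyperedges are nonempty. -/
def IsFiniteProper (G : Hypergraph α) : Prop :=
  G.vertexSet.Finite ∧ ∅ ∉ G.edgeSet

/-- The induced `l`-trimmed subhypergraph `G⟨S⟩_l`: the nonempty intersections with `S` of those
hyperedges of `G` that have at most `l` vertices outside `S`. -/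
def trim (G : Hypergraph α) (S : Set α) (l : ℕ∞) : Hypergraph α where
  vertexSet := G.vertexSet ∩ S
  edgeSet := {f | f.Nonempty ∧ ∃ e ∈ G.edgeSet, (e \ S).encard ≤ l ∧ f = e ∩ S}
  subset_vertexSet_of_mem_edgeSet' := by
    rintro f ⟨-, e, he, -, rfl⟩
    exact Set.inter_subset_inter_left S (G.subset_vertexSet_of_mem_edgeSet' he)

/-- The degree of a vertex: the number of hyperedges containing it. -/
noncomputable def degree (G : Hypergraph α) (v : α) : ℕ :=
  {e | e ∈ G.edgeSet ∧ v ∈ e}.ncard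

/-- The `l`-degeneracy: the least `κ` such that every induced `l`-trimmed subhypergraph (on a
nonempty vertex set) has minimum degree at most `κ`. -/
noncomputable def degeneracy (l : ℕ∞) (G : Hypergraph α) : ℕ :=
  sInf {κ | ∀ S ⊆ G.vertexSet, S.Nonempty → ∃ v ∈ S, (G.trim S l).degree v ≤ κ}

/-- `D` is (the vertex set of) a connected component of `G`. -/
def IsComponent (G : Hypergraph α) (D : Set α) : Prop :=
  ∃ u ∈ G.vertexSet, D = {v | Relation.ReflTransGen G.Adj u v}

/-- The hyperedges of `H` with more than one vertex that are contained in `C ∪ D`. -/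
def connector (H : Hypergraph α) (C D : Set α) : Set (Set α) :=
  {e | e ∈ H.edgeSet ∧ e ⊆ C ∪ D ∧ 1 < e.encard}

/-- `C` is the core of an `l`-obstruction `H`. The sets `D` range over the connected components of
the induced `∞`-trimmed subhypergraph on `V(H) \ C`. -/
structure IsCore (l : ℕ∞) (H : Hypergraph α) (C : Set α) : Prop where
  subset : C ⊆ H.vertexSet
  three_le : 3 ≤ C.encard
  /-- the `l`-trimmed subhypergraph induced by the core has no hyperedge of arity above one -/
  empty_core : ∀ f ∈ (H.trim C l).edgeSet, f.encard ≤ 1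
  /-- no connector contains all of the core -/
  not_cover : ∀ D, (H.trim (H.vertexSet \ C) ⊤).IsComponent D → ¬ C ⊆ ⋃₀ H.connector C D
  /-- each `C \ {c}` is contained in some connector that does not contain `c` -/
  cover_erase : ∀ c ∈ C, ∃ D, (H.trim (H.vertexSet \ C) ⊤).IsComponent D ∧
    C \ {c} ⊆ ⋃₀ H.connector C D ∧ c ∉ ⋃₀ H.connector C D

/-- `H` is an `l`-obstruction, i.e. a member of `𝓗_l`. -/
def IsObstruction (l : ℕ∞) (H : Hypergraph α) : Prop :=
  ∃ C, IsCore l H C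

/-- `H` contains a member of `𝓗_l` as an induced `∞`-trimmed subhypergraph. -/
def ContainsObstruction (l : ℕ∞) (H : Hypergraph α) : Prop :=
  ∃ S ⊆ H.vertexSet, IsObstruction l (H.trim S ⊤)

/-- A vertex map is a homomorphism if the image of every hyperedge is a hyperedge. -/
def IsHom (H : Hypergraph α) (G : Hypergraph β) (φ : H.vertexSet → G.vertexSet) : Prop :=
  ∀ e ∈ H.edgeSet, {b | ∃ a : H.vertexSet, (a : α) ∈ e ∧ (φ a : β) = b} ∈ G.edgeSet

/-- The number of homomorphisms from `H` to `G`. -/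
noncomputable def homCount (H : Hypergraph α) (G : Hypergraph β) : ℕ :=
  Nat.card {φ : H.vertexSet → G.vertexSet // IsHom H G φ}

/-- `G` contains a `k`-simplex: `k + 1` vertices all of whose `k`-element subsets are hyperedges. -/
def ContainsSimplex (k : ℕ) (G : Hypergraph α) : Prop :=
  ∃ T ⊆ G.vertexSet, T.ncard = k + 1 ∧ ∀ e ⊆ T, e.ncard = k → e ∈ G.edgeSet

/-- Every hyperedge of `G` has arity exactly `k`. -/
def HasRegularArity (k : ℕ) (G : Hypergraph α) : Prop :=
  ∀ e ∈ G.edgeSet, e.encard = k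

/-- The list of numbers `x` is an encoding of the hypergraph `G` with vertex set `{0, …, n - 1}`:
`n`, the number `m` of hyperedges, and then the hyperedges one after another (without repetition,
in any order), each given by its arity followed by its vertices (without repetition, in any
order). -/
def Encodes (x : List ℕ) (G : Hypergraph ℕ) : Prop :=
  ∃ (n : ℕ) (L : List (List ℕ)),
    G.vertexSet = Set.Iio n ∧
    (∀ a ∈ L, a ≠ [] ∧ a.Nodup) ∧
    (L.map List.toFinset).Nodup ∧
    G.edgeSet = {e | ∃ a ∈ L, e = {v | v ∈ a}} ∧
    x = n :: L.length :: L.flatMap (fun a => a.length :: a)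

end Hypergraph

/-! ## The word RAM

A deterministic unit-cost random access machine. A program is a fixed list of instructions; it has
registers and a random access memory, all holding natural numbers. The restriction to machine words
of logarithmic length is imposed on runs, see `RAM.ComputesWithin`. -/

namespace RAM

/-- Arithmetic and bitwise operations on words (`sub` is truncated at `0`). -/
inductive Op where
  | add | sub | mul | div | mod | and | or | xor | shiftLeft | shiftRight

def Op.eval : Op → ℕ → ℕ → ℕ
  | .add, a, b => a + b
  | .sub, a, b => a - b
  | .mul, a, b => a * b
  | .div, a, b => a / b
  | .mod, a, b => a % b
  | .and, a, b => a &&& b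
  | .or, a, b => a ||| b
  | .xor, a, b => a ^^^ b
  | .shiftLeft, a, b => a <<< b
  | .shiftRight, a, b => a >>> b

inductive Instr where
  /-- `R[d] ← v` -/
  | const (d v : ℕ)
  /-- `R[d] ← R[a] o R[b]` -/
  | op (o : Op) (d a b : ℕ)
  /-- `R[d] ← M[R[a]]` -/
  | load (d a : ℕ)
  /-- `M[R[a]] ← R[b]` -/
  | store (a b : ℕ)
  /-- continue with instruction number `j` if `R[a] = 0` -/
  | jumpZero (a j : ℕ)

abbrev Program := List Instr

/-- A configuration: program counter, registers, memory. -/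
structure Config where
  pc : ℕ
  reg : ℕ → ℕ
  mem : ℕ → ℕ

def Instr.exec (s : Config) : Instr → Config
  | .const d v => ⟨s.pc + 1, Function.update s.reg d v, s.mem⟩
  | .op o d a b => ⟨s.pc + 1, Function.update s.reg d (o.eval (s.reg a) (s.reg b)), s.mem⟩
  | .load d a => ⟨s.pc + 1, Function.update s.reg d (s.mem (s.reg a)), s.mem⟩
  | .store a b => ⟨s.pc + 1, s.reg, Function.update s.mem (s.reg a) (s.reg b)⟩
  | .jumpZero a j => ⟨if s.reg a = 0 then j else s.pc + 1, s.reg, s.mem⟩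

/-- One step; the machine has halted once the program counter is outside the program. -/
def step (P : Program) (s : Config) : Config :=
  match P[s.pc]? with
  | some i => i.exec s
  | none => s

/-- Initially the input is stored in memory cells `0, 1, 2, …`, and all else is `0`. -/
def init (x : List ℕ) : Config :=
  ⟨0, fun _ => 0, fun i => x.getD i 0⟩

/-- The configuration after `t` steps on input `x`. -/
def run (P : Program) (x : List ℕ) (t : ℕ) : Config :=
  (step P)^[t] (init x)

/-- On input `x` the program `P` halts after at most `T` steps with output `y` (in register `0`),
and throughout the run every register and every memory cell holds a number less than `B`. -/
def ComputesWithin (P : Program) (x : List ℕ) (B : ℕ) (T : ℝ) (y : ℕ) : Prop :=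
  ∃ t : ℕ, (t : ℝ) ≤ T ∧ P.length ≤ (run P x t).pc ∧ (run P x t).reg 0 = y ∧
    ∀ i ≤ t, ∀ a, (run P x i).reg a < B ∧ (run P x i).mem a < B

end RAM

/-! ## The two computational problems

For an input with `n` vertices and `m` hyperedges, machine words hold the numbers below
`(n + m + 2) ^ c` for a constant `c` of the algorithm, that is, they have `O(log (n + m))` bits. -/

/-- There is an algorithm that computes the number of homomorphisms from `H` to `G`, for all
hypergraphs `G`, in time `f(κ_l(G)) · O(n ^ γ)` for some function `f`, where the constant hidden in
`O(·)` may depend on (a bound `r` for) the rank of `G`. -/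
def HomComputableInTime {α : Type*} (l : ℕ∞) (H : Hypergraph α) (γ : ℝ) : Prop :=
  ∃ (P : RAM.Program) (c : ℕ) (f : ℕ → ℝ), ∀ r : ℕ, ∃ K : ℝ,
    ∀ (G : Hypergraph ℕ) (x : List ℕ), Hypergraph.Encodes x G → (∀ e ∈ G.edgeSet, e.encard ≤ r) →
      RAM.ComputesWithin P x ((G.vertexSet.ncard + G.edgeSet.ncard + 2) ^ c)
        (f (Hypergraph.degeneracy l G) * (K * ((G.vertexSet.ncard : ℝ) + 1) ^ γ))
        (Hypergraph.homCount H G)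

open Classical in
/-- There is an algorithm that decides whether a hypergraph `G` of regular arity `k` contains a
`k`-simplex (output `1` for yes, `0` for no) in time `Õ(m ^ γ)`, that is,
`O(m ^ γ · (log m) ^ b)` for some constant `b`. -/
def SimplexDetectableInTime (k : ℕ) (γ : ℝ) : Prop :=
  ∃ (P : RAM.Program) (c b : ℕ) (K : ℝ),
    ∀ (G : Hypergraph ℕ) (x : List ℕ), Hypergraph.Encodes x G → Hypergraph.HasRegularArity k G →
      RAM.ComputesWithin P x ((G.vertexSet.ncard + G.edgeSet.ncard + 2) ^ c)
        (K * (((G.edgeSet.ncard : ℝ) + 1) ^ γ * Real.log ((G.edgeSet.ncard : ℝ) + 2) ^ b))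
        (if Hypergraph.ContainsSimplex k G then 1 else 0)

/-! Fix a core `C` of an obstruction inside `S` and put `k = |C| - 1`. The core vertices play the
vertices of a simplex, and a component whose connector covers exactly `C \ {c}` within `C` plays the
hyperedge of the simplex opposite to `c`.

From a `k`-uniform input build a target whose vertices are coloured by the vertices of the pattern
`H`. For every input hyperedge `j` and every assignment `s` of its `k` places to vertices of `H`, a
hyperedge `e` meeting `S \ C` gets a copy in which the vertices of `S \ C` remember the pair `(j,
s)`, the core vertices become the input vertices in the assigned places, and the vertices outside
`S` have a single copy. Only those `s` are used that are injective on `C \ {miss d}`, where `miss d`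
is a core vertex that the connector of the component of `d` avoids. Hyperedges that meet `S` only
inside `C` contain at most one core vertex, and their copies impose no restriction.

In a colour-preserving homomorphism the pair `(j, s)` is constant on each component, so for every
`c` the images of `C \ {c}` are the distinct vertices of one input hyperedge; this is a simplex
(`Valid.labelSimplex_of_places`). Conversely, a simplex gives such a homomorphism: each component
uses the hyperedge opposite to its missed core vertex (`Valid.exists_places`).

The target has `l`-degeneracy at most `2 ^ N`, where `N` is the number of vertices of `H`
(`Valid.degeneracy_target_le`). A vertex with colour in `S \ C` determines every hyperedge through
it up to the choice of colours; once these are gone, the first condition on the core leaves a vertex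
with core colour no other core neighbour.

Colours are removed by inclusion-exclusion over the sets `F` of hyperedges that are copied. The
alternating sum counts the homomorphisms that hit copies of all hyperedges, and such a map permutes
the colours, so it can be made colour-preserving (`Valid.labelSimplex_of_map`,
`Valid.sum_homCount_pos_iff`).

Naming each input vertex by one of its occurrences in a hyperedge keeps the target at `O(m)`
vertices, whatever `n` is. The program writes these labels, then writes one target per `F` and
simulates the counting algorithm on it, and finally compares the positive with the negative total
(`Params.computesWithin_reduction`). -/

/-! ## A program logic for the word RAM -/

namespace RAM

/-- All registers and memory cells hold numbers below `B`. -/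
def Bounded (B : ℕ) (r μ : ℕ → ℕ) : Prop := (∀ a, r a < B) ∧ ∀ a, μ a < B

/-- `P` leads from `s` to `s'` in `t` steps, all values staying below `B`. -/
def RunsTo (P : Program) (B : ℕ) (s : Config) (t : ℕ) (s' : Config) : Prop :=
  (step P)^[t] s = s' ∧ ∀ i ≤ t, Bounded B ((step P)^[i] s).reg ((step P)^[i] s).mem

theorem RunsTo.refl {P : Program} {B : ℕ} {s : Config} (h : Bounded B s.reg s.mem) :
    RunsTo P B s 0 s :=
  ⟨rfl, fun i hi => by obtain rfl : i = 0 := by omega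
                       exact h⟩

theorem RunsTo.trans {P : Program} {B t u : ℕ} {s s' s'' : Config} (h : RunsTo P B s t s')
    (h' : RunsTo P B s' u s'') : RunsTo P B s (t + u) s'' := by
  refine ⟨by rw [Nat.add_comm, Function.iterate_add_apply, h.1, h'.1], fun i hi => ?_⟩
  rcases le_total i t with hit | hit
  · exact h.2 i hit
  · obtain ⟨j, rfl⟩ := Nat.exists_eq_add_of_le hit
    rw [Nat.add_comm, Function.iterate_add_apply, h.1]
    exact h'.2 j (by omega)

theorem RunsTo.bounded {P : Program} {B t : ℕ} {s s' : Config} (h : RunsTo P B s t s') :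
    Bounded B s'.reg s'.mem := by
  have := h.2 t le_rfl
  rwa [h.1] at this

theorem RunsTo.single {P : Program} {B : ℕ} {s s' : Config} {i : Instr}
    (h : Bounded B s.reg s.mem) (hi : P[s.pc]? = some i) (hs : i.exec s = s')
    (h' : Bounded B s'.reg s'.mem) : RunsTo P B s 1 s' := by
  have h1 : step P s = s' := by simp [step, hi, hs]
  refine ⟨h1, fun j hj => ?_⟩
  interval_cases j
  · exact h
  · simpa [h1] using h'

theorem Bounded.update_reg {B : ℕ} {r μ : ℕ → ℕ} (h : Bounded B r μ) {v : ℕ} (hv : v < B) (d : ℕ) :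
    Bounded B (Function.update r d v) μ := by
  refine ⟨fun a => ?_, h.2⟩
  by_cases had : a = d
  · subst had; simpa using hv
  · simpa [Function.update_of_ne had] using h.1 a

theorem Bounded.update_mem {B : ℕ} {r μ : ℕ → ℕ} (h : Bounded B r μ) {v : ℕ} (hv : v < B) (d : ℕ) :
    Bounded B r (Function.update μ d v) := by
  refine ⟨h.1, fun a => ?_⟩
  by_cases had : a = d
  · subst had; simpa using hv
  · simpa [Function.update_of_ne had] using h.2 a

/-! ### Code blocks and Hoare triples -/

/-- Relocatable code: the instructions depend on the address at which they are placed. -/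
structure Code where
  len : ℕ
  gen : ℕ → List Instr
  length_gen : ∀ o, (gen o).length = len

/-- The instructions `c` stand in `P` at address `o`. -/
def CodeAt (P : Program) (o : ℕ) (is : List Instr) : Prop :=
  ∀ i < is.length, P[o + i]? = is[i]?

theorem CodeAt.left {P : Program} {o : ℕ} {c d : List Instr} (h : CodeAt P o (c ++ d)) :
    CodeAt P o c := fun i hi => by
  rw [h i (by simp; omega), List.getElem?_append_left hi]

theorem CodeAt.right {P : Program} {o : ℕ} {c d : List Instr} (h : CodeAt P o (c ++ d)) :
    CodeAt P (o + c.length) d := fun i hi => by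
  rw [Nat.add_assoc, h (c.length + i) (by simp; omega), List.getElem?_append_right (by omega)]
  simp

theorem CodeAt.head {P : Program} {o : ℕ} {i : Instr} {d : List Instr}
    (h : CodeAt P o (i :: d)) : P[o]? = some i := by
  simpa using h 0 (by simp)

theorem CodeAt.tail {P : Program} {o : ℕ} {i : Instr} {d : List Instr}
    (h : CodeAt P o (i :: d)) : CodeAt P (o + 1) d :=
  CodeAt.right (c := [i]) h

/-- Started in a state satisfying `Pre`, the code ends after at most `τ` steps in a state satisfying
`Post`, all values staying below `B`. -/
def Triple (B τ : ℕ) (c : Code) (Pre Post : (ℕ → ℕ) → (ℕ → ℕ) → Prop) : Prop :=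
  ∀ P o, CodeAt P o (c.gen o) → ∀ r μ, Bounded B r μ → Pre r μ →
    ∃ t ≤ τ, ∃ r' μ', Post r' μ' ∧ RunsTo P B ⟨o, r, μ⟩ t ⟨o + c.len, r', μ'⟩

theorem Triple.mono {B τ τ' : ℕ} {c : Code} {Pre Pre' Post Post' : (ℕ → ℕ) → (ℕ → ℕ) → Prop}
    (h : Triple B τ c Pre Post) (hτ : τ ≤ τ') (hpre : ∀ r μ, Pre' r μ → Pre r μ)
    (hpost : ∀ r μ, Post r μ → Post' r μ) : Triple B τ' c Pre' Post' := by
  intro P o hP r μ hb hr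
  obtain ⟨t, ht, r', μ', hq, hrun⟩ := h P o hP r μ hb (hpre r μ hr)
  exact ⟨t, ht.trans hτ, r', μ', hpost _ _ hq, hrun⟩

/-- Sequential composition. -/
def Code.seq (c d : Code) : Code where
  len := c.len + d.len
  gen o := c.gen o ++ d.gen (o + c.len)
  length_gen o := by simp [c.length_gen, d.length_gen]

theorem Triple.seq {B τ τ' : ℕ} {c d : Code} {Pre Mid Post : (ℕ → ℕ) → (ℕ → ℕ) → Prop}
    (h : Triple B τ c Pre Mid) (h' : Triple B τ' d Mid Post) :
    Triple B (τ + τ') (c.seq d) Pre Post := by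
  intro P o hP r μ hb hr
  obtain ⟨t, ht, r', μ', hq, hrun⟩ := h P o hP.left r μ hb hr
  have hP' : CodeAt P (o + c.len) (d.gen (o + c.len)) := by
    have := hP.right
    rwa [c.length_gen] at this
  obtain ⟨t', ht', r'', μ'', hq', hrun'⟩ := h' P (o + c.len) hP' r' μ' hrun.bounded hq
  refine ⟨t + t', by omega, r'', μ'', hq', ?_⟩
  have := hrun.trans hrun'
  rwa [Nat.add_assoc] at this

/-- Straight-line code. -/
def Code.block (is : List Instr) : Code := ⟨is.length, fun _ => is, fun _ => rfl⟩

/-- The weakest precondition of straight-line code. -/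
def wp (B : ℕ) : List Instr → ((ℕ → ℕ) → (ℕ → ℕ) → Prop) → (ℕ → ℕ) → (ℕ → ℕ) → Prop
  | [], Q, r, μ => Q r μ
  | .const d v :: is, Q, r, μ => v < B ∧ wp B is Q (Function.update r d v) μ
  | .op o d a b :: is, Q, r, μ =>
    o.eval (r a) (r b) < B ∧ wp B is Q (Function.update r d (o.eval (r a) (r b))) μ
  | .load d a :: is, Q, r, μ => wp B is Q (Function.update r d (μ (r a))) μ
  | .store a b :: is, Q, r, μ => wp B is Q r (Function.update μ (r a) (r b))
  | .jumpZero _ _ :: _, _, _, _ => False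

theorem exists_runsTo_of_wp {B : ℕ} {Q : (ℕ → ℕ) → (ℕ → ℕ) → Prop} {P : Program} :
    ∀ (is : List Instr) (o : ℕ) (r μ : ℕ → ℕ), CodeAt P o is → Bounded B r μ → wp B is Q r μ →
      ∃ r' μ', Q r' μ' ∧ RunsTo P B ⟨o, r, μ⟩ is.length ⟨o + is.length, r', μ'⟩
  | [], o, r, μ, _, hb, h => ⟨r, μ, h, RunsTo.refl hb⟩
  | i :: is, o, r, μ, hP, hb, h => by
    have key : ∃ r₁ μ₁, i.exec ⟨o, r, μ⟩ = ⟨o + 1, r₁, μ₁⟩ ∧ Bounded B r₁ μ₁ ∧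
        wp B is Q r₁ μ₁ := by
      cases i with
      | const d v => exact ⟨_, _, rfl, hb.update_reg h.1 d, h.2⟩
      | op o' d a b => exact ⟨_, _, rfl, hb.update_reg h.1 d, h.2⟩
      | load d a => exact ⟨_, _, rfl, hb.update_reg (hb.2 _) d, h⟩
      | store a b => exact ⟨_, _, rfl, hb.update_mem (hb.1 _) _, h⟩
      | jumpZero a j => exact h.elim
    obtain ⟨r₁, μ₁, he, hb₁, hw⟩ := key
    obtain ⟨r', μ', hQ, hrun⟩ := exists_runsTo_of_wp is (o + 1) r₁ μ₁ hP.tail hb₁ hw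
    refine ⟨r', μ', hQ, ?_⟩
    have := (RunsTo.single (P := P) (B := B) hb hP.head he hb₁).trans hrun
    simpa [Nat.add_comm, Nat.add_left_comm, Nat.add_assoc] using this

theorem triple_block {B : ℕ} {is : List Instr} {Pre Post : (ℕ → ℕ) → (ℕ → ℕ) → Prop}
    (h : ∀ r μ, Pre r μ → wp B is Post r μ) : Triple B is.length (Code.block is) Pre Post := by
  intro P o hP r μ hb hr
  obtain ⟨r', μ', hQ, hrun⟩ := exists_runsTo_of_wp is o r μ hP hb (h r μ hr)
  exact ⟨_, le_rfl, r', μ', hQ, hrun⟩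

/-- `while R[a] ≠ 0 do c`, where register `0` holds the number `0`. -/
def Code.loop (a : ℕ) (c : Code) : Code where
  len := c.len + 2
  gen o := .jumpZero a (o + (c.len + 2)) :: (c.gen (o + 1) ++ [.jumpZero 0 o])
  length_gen o := by simp [c.length_gen]

/-- The invariant is indexed by the number of completed passes and forces the counter to be `m - j`.
Since register `0` holds `0`, the closing jump is unconditional. The two jumps account for `τ + 2`
per pass, and the final test for the extra step. -/
theorem Triple.loop {B τ a m : ℕ} {c : Code} {I : ℕ → (ℕ → ℕ) → (ℕ → ℕ) → Prop}
    (h : ∀ j < m, Triple B τ c (I j) (I (j + 1)))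
    (hI : ∀ j ≤ m, ∀ r μ, I j r μ → r a = m - j ∧ r 0 = 0) :
    Triple B (m * (τ + 2) + 1) (c.loop a) (I 0) (I m) := by
  suffices H : ∀ d j, j + d = m → Triple B (d * (τ + 2) + 1) (c.loop a) (I j) (I m) from
    H m 0 (by omega)
  intro d
  induction d with
  | zero =>
    rintro j rfl P o hP r μ hb hr
    refine ⟨1, by simp, r, μ, hr, RunsTo.single hb hP.head ?_ hb⟩
    have := (hI _ le_rfl r μ hr).1
    simp [Instr.exec, this, Code.loop]
  | succ d ih =>
    intro j hj P o hP r μ hb hr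
    have h1 := (hI j (by omega) r μ hr).1
    have hs1 : RunsTo P B ⟨o, r, μ⟩ 1 ⟨o + 1, r, μ⟩ := by
      refine RunsTo.single hb hP.head ?_ hb
      have : r a ≠ 0 := by omega
      simp [Instr.exec, this]
    have hP1 := hP.tail
    obtain ⟨t, ht, r', μ', hq, hrun⟩ := h j (by omega) P (o + 1) hP1.left r μ hb hr
    have hs2 : RunsTo P B ⟨o + 1 + c.len, r', μ'⟩ 1 ⟨o, r', μ'⟩ := by
      have hP2 := hP1.right
      rw [c.length_gen] at hP2
      refine RunsTo.single hrun.bounded hP2.head ?_ hrun.bounded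
      simp [Instr.exec, (hI (j + 1) (by omega) r' μ' hq).2]
    obtain ⟨t', ht', r'', μ'', hq', hrun'⟩ := ih (j + 1) (by omega) P o hP r' μ' hs2.bounded hq
    refine ⟨1 + t + 1 + t', ?_, r'', μ'', hq', ((hs1.trans hrun).trans hs2).trans hrun'⟩
    rw [Nat.succ_mul]
    omega

/-! ### Running a program inside another one -/

/-- The code that simulates one instruction of a program. Its register `a` is kept in register
`ρ a`, and its memory cell `a` in the cell `R[2] + R[1] * a`. -/
def Instr.relocate (ρ : ℕ → ℕ) (o len : ℕ) : Instr → List Instr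
  | .const d v => [.const 3 0, .const 3 0, .const (ρ d) v]
  | .op f d a b => [.const 3 0, .const 3 0, .op f (ρ d) (ρ a) (ρ b)]
  | .load d a => [.op .mul 3 (ρ a) 1, .op .add 3 3 2, .load (ρ d) 3]
  | .store a b => [.op .mul 3 (ρ a) 1, .op .add 3 3 2, .store 3 (ρ b)]
  | .jumpZero a j => [.const 3 0, .const 3 0, .jumpZero (ρ a) (o + 3 * min j len)]

/-- All translations are padded to one length, so that instruction `p` stands at offset `3 * p` and
jump targets are found by multiplication. The `min` in the translated jump sends every target beyond
the program to the end of the block, so halting becomes falling out of the code. -/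
theorem Instr.length_relocate (ρ : ℕ → ℕ) (o len : ℕ) (i : Instr) :
    (i.relocate ρ o len).length = 3 := by
  cases i <;> rfl

theorem codeAt_of_flatMap {P : Program} {f : Instr → List Instr} (hf : ∀ i, (f i).length = 3) :
    ∀ (Q : Program) (o p : ℕ) (i : Instr), CodeAt P o (Q.flatMap f) → Q[p]? = some i →
      CodeAt P (o + 3 * p) (f i)
  | [], _, p, i, _, hi => by simp at hi
  | a :: Q, o, 0, i, h, hi => by
    obtain rfl : a = i := by simpa using hi
    rw [List.flatMap_cons] at h
    exact h.left
  | a :: Q, o, p + 1, i, h, hi => by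
    rw [List.flatMap_cons] at h
    have h1 := h.right
    rw [hf] at h1
    have := codeAt_of_flatMap hf Q (o + 3) p i h1 (by simpa using hi)
    rwa [show o + 3 * (p + 1) = o + 3 + 3 * p by ring]

def Code.simulate (ρ : ℕ → ℕ) (P : Program) : Code where
  len := 3 * P.length
  gen o := P.flatMap (Instr.relocate ρ o P.length)
  length_gen o := by
    simp [List.length_flatMap, Instr.length_relocate, Nat.mul_comm]

/-- The state `(r, μ)` represents the configuration `s` of a simulated program, and agrees with
`(r₀, μ₀)` elsewhere. -/
structure Represents (ρ : ℕ → ℕ) (r₀ μ₀ : ℕ → ℕ) (s : Config) (r μ : ℕ → ℕ) : Prop where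
  reg : ∀ a, r (ρ a) = s.reg a
  mem : ∀ a, μ (r₀ 2 + r₀ 1 * a) = s.mem a
  frame_reg : ∀ q, q ≠ 3 → (∀ a, q ≠ ρ a) → r q = r₀ q
  frame_mem : ∀ q, (∀ a, q ≠ r₀ 2 + r₀ 1 * a) → μ q = μ₀ q

section Simulation

variable {ρ : ℕ → ℕ} {r₀ μ₀ : ℕ → ℕ} {B B' : ℕ}

theorem Represents.update_scratch (hρ3 : ∀ a, 3 < ρ a) {s : Config} {r μ : ℕ → ℕ}
    (h : Represents ρ r₀ μ₀ s r μ) (v : ℕ) :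
    Represents ρ r₀ μ₀ s (Function.update r 3 v) μ where
  reg a := by rw [Function.update_of_ne (hρ3 a).ne', h.reg]
  mem := h.mem
  frame_reg q h3 hq := by rw [Function.update_of_ne h3, h.frame_reg q h3 hq]
  frame_mem := h.frame_mem

theorem Represents.update_reg (hinj : Function.Injective ρ) {s : Config}
    {r μ : ℕ → ℕ} (h : Represents ρ r₀ μ₀ s r μ) (d v p : ℕ) :
    Represents ρ r₀ μ₀ ⟨p, Function.update s.reg d v, s.mem⟩ (Function.update r (ρ d) v) μ where
  reg a := by
    by_cases had : a = d
    · subst had; simp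
    · simp [Function.update_of_ne (hinj.ne had), h.reg, Function.update_of_ne had]
  mem := h.mem
  frame_reg q h3 hq := by rw [Function.update_of_ne (hq d), h.frame_reg q h3 hq]
  frame_mem := h.frame_mem

theorem Represents.update_mem (hW : 0 < r₀ 1) {s : Config} {r μ : ℕ → ℕ}
    (h : Represents ρ r₀ μ₀ s r μ) (d v p : ℕ) :
    Represents ρ r₀ μ₀ ⟨p, s.reg, Function.update s.mem d v⟩ r
      (Function.update μ (r₀ 2 + r₀ 1 * d) v) where
  reg := h.reg
  mem a := by
    by_cases had : a = d
    · subst had; simp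
    · have : r₀ 2 + r₀ 1 * a ≠ r₀ 2 + r₀ 1 * d := by
        intro he
        exact had (Nat.eq_of_mul_eq_mul_left hW (by omega))
      simp [Function.update_of_ne this, h.mem, Function.update_of_ne had]
  frame_reg := h.frame_reg
  frame_mem q hq := by rw [Function.update_of_ne (hq d), h.frame_mem q hq]

/-- The hypothesis `r₀ 2 + r₀ 1 * B' ≤ B` is there because host addresses are computed in register
`3` and must themselves be words below `B`. -/
theorem simulate_step (hinj : Function.Injective ρ) (hρ3 : ∀ a, 3 < ρ a) (hW : 0 < r₀ 1)
    (hB : B' ≤ B) (hB2 : r₀ 2 + r₀ 1 * B' ≤ B) {P Q : Program} {o : ℕ}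
    (hQ : CodeAt Q o (P.flatMap (Instr.relocate ρ o P.length))) {s : Config}
    (hpc : s.pc < P.length) (hs : Bounded B' s.reg s.mem)
    (hs' : Bounded B' (step P s).reg (step P s).mem) {r μ : ℕ → ℕ} (hb : Bounded B r μ)
    (h : Represents ρ r₀ μ₀ s r μ) :
    ∃ r' μ', Represents ρ r₀ μ₀ (step P s) r' μ' ∧
      RunsTo Q B ⟨o + 3 * min s.pc P.length, r, μ⟩ 3
        ⟨o + 3 * min (step P s).pc P.length, r', μ'⟩ := by
  have hpos : 0 < B := (Nat.zero_le _).trans_lt (hb.1 0)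
  have hρ : ∀ q ≤ 2, ∀ a, q ≠ ρ a := fun q hq a => by have := hρ3 a; omega
  have e1 : r 1 = r₀ 1 := h.frame_reg 1 (by omega) (hρ 1 (by omega))
  have e2 : r 2 = r₀ 2 := h.frame_reg 2 (by omega) (hρ 2 (by omega))
  obtain ⟨i, hi⟩ : ∃ i, P[s.pc]? = some i := ⟨P[s.pc], by simp [hpc]⟩
  have hcode := codeAt_of_flatMap (Instr.length_relocate ρ o P.length) P o s.pc i hQ hi
  have hstep : step P s = i.exec s := by simp [step, hi]
  rw [hstep] at hs' ⊢
  rw [min_eq_left hpc.le]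
  have hadr : ∀ a, s.reg a * r₀ 1 + r₀ 2 < B := fun a => by
    have h1 : r₀ 1 * (s.reg a + 1) ≤ r₀ 1 * B' := Nat.mul_le_mul_left _ (hs.1 a)
    rw [Nat.mul_add, Nat.mul_comm] at h1
    omega
  have hpad : ∀ p, Bounded B (Function.update (Function.update r 3 0) 3 0) μ ∧
      (Q[p]? = some (.const 3 0) → Q[p + 1]? = some (.const 3 0) →
        RunsTo Q B ⟨p, r, μ⟩ 2 ⟨p + 2, Function.update (Function.update r 3 0) 3 0, μ⟩) :=
    fun p => ⟨(hb.update_reg hpos 3).update_reg hpos 3, fun h0 h1 =>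
      RunsTo.trans (t := 1) (u := 1) (s' := ⟨p + 1, Function.update r 3 0, μ⟩)
        (RunsTo.single hb h0 rfl (hb.update_reg hpos 3))
        (RunsTo.single (hb.update_reg hpos 3) h1 rfl
          ((hb.update_reg hpos 3).update_reg hpos 3))⟩
  have hrep := (h.update_scratch hρ3 0).update_scratch hρ3 0
  have haddr : ∀ a p, Q[p]? = some (.op .mul 3 (ρ a) 1) → Q[p + 1]? = some (.op .add 3 3 2) →
      ∃ r₂, Bounded B r₂ μ ∧ Represents ρ r₀ μ₀ s r₂ μ ∧ r₂ 3 = r₀ 2 + r₀ 1 * s.reg a ∧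
        RunsTo Q B ⟨p, r, μ⟩ 2 ⟨p + 2, r₂, μ⟩ := by
    intro a p h0 h1
    have hv : s.reg a * r₀ 1 < B := (Nat.le_add_right _ _).trans_lt (hadr a)
    refine ⟨Function.update (Function.update r 3 (s.reg a * r₀ 1)) 3 (s.reg a * r₀ 1 + r₀ 2),
      (hb.update_reg hv 3).update_reg (hadr a) 3,
      (h.update_scratch hρ3 _).update_scratch hρ3 _, by simp; ring, ?_⟩
    refine RunsTo.trans (t := 1) (u := 1)
      (s' := ⟨p + 1, Function.update r 3 (s.reg a * r₀ 1), μ⟩)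
      (RunsTo.single hb h0 ?_ (hb.update_reg hv 3))
      (RunsTo.single (hb.update_reg hv 3) h1 ?_ ((hb.update_reg hv 3).update_reg (hadr a) 3))
    · simp [Instr.exec, Op.eval, h.reg, e1]
    · simp [Instr.exec, Op.eval, e2]
  have hpc1 : min (s.pc + 1) P.length = s.pc + 1 := min_eq_left hpc
  cases i with
  | const d v =>
    have hv : v < B := by
      have := hs'.1 d
      simp only [Instr.exec, Function.update_self] at this
      omega
    have hrun := (hpad (o + 3 * s.pc)).2 hcode.head hcode.tail.head
    refine ⟨_, _, hrep.update_reg hinj d v (s.pc + 1), hrun.trans (u := 1)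
      (RunsTo.single hrun.bounded hcode.tail.tail.head ?_ (hrun.bounded.update_reg hv _))⟩
    simp only [Instr.exec, hpc1]
    congr 1
  | op f d a b =>
    have hv : f.eval (s.reg a) (s.reg b) < B := by
      have := hs'.1 d
      simp only [Instr.exec, Function.update_self] at this
      omega
    have hrun := (hpad (o + 3 * s.pc)).2 hcode.head hcode.tail.head
    refine ⟨_, _, hrep.update_reg hinj d _ (s.pc + 1), hrun.trans (u := 1)
      (RunsTo.single hrun.bounded hcode.tail.tail.head ?_ (hrun.bounded.update_reg hv _))⟩
    simp only [Instr.exec, hpc1, hrep.reg]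
    congr 1
  | load d a =>
    obtain ⟨r₂, hb₂, hr₂, h3, hrun⟩ := haddr a _ hcode.head hcode.tail.head
    have hv : s.mem (s.reg a) < B := (hs.2 _).trans_le hB
    refine ⟨_, _, hr₂.update_reg hinj d _ (s.pc + 1), hrun.trans (u := 1)
      (RunsTo.single hrun.bounded hcode.tail.tail.head ?_ (hrun.bounded.update_reg hv _))⟩
    simp only [Instr.exec, hpc1, h3, hr₂.mem]
    congr 1
  | store a b =>
    obtain ⟨r₂, hb₂, hr₂, h3, hrun⟩ := haddr a _ hcode.head hcode.tail.head
    have hv : s.reg b < B := (hs.1 _).trans_le hB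
    refine ⟨_, _, hr₂.update_mem hW (s.reg a) (s.reg b) (s.pc + 1), hrun.trans (u := 1)
      (RunsTo.single hrun.bounded hcode.tail.tail.head ?_ (hrun.bounded.update_mem hv _))⟩
    simp only [Instr.exec, hpc1, h3, hr₂.reg]
    congr 1
  | jumpZero a j =>
    have hrun := (hpad (o + 3 * s.pc)).2 hcode.head hcode.tail.head
    refine ⟨_, _, ⟨hrep.reg, hrep.mem, hrep.frame_reg, hrep.frame_mem⟩, hrun.trans (u := 1)
      (RunsTo.single hrun.bounded hcode.tail.tail.head ?_ hrun.bounded)⟩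
    simp only [Instr.exec, hrep.reg]
    split_ifs with h0
    · rfl
    · rw [hpc1]; congr 1

theorem simulate_run (hinj : Function.Injective ρ) (hρ3 : ∀ a, 3 < ρ a) (hW : 0 < r₀ 1)
    (hB : B' ≤ B) (hB2 : r₀ 2 + r₀ 1 * B' ≤ B) {P Q : Program} {o : ℕ}
    (hQ : CodeAt Q o (P.flatMap (Instr.relocate ρ o P.length))) :
    ∀ (t : ℕ) (s : Config), (∀ i ≤ t, Bounded B' ((step P)^[i] s).reg ((step P)^[i] s).mem) →
      P.length ≤ ((step P)^[t] s).pc → ∀ r μ, Bounded B r μ → Represents ρ r₀ μ₀ s r μ →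
      ∃ t' ≤ 3 * t, ∃ r' μ', Represents ρ r₀ μ₀ ((step P)^[t] s) r' μ' ∧
        RunsTo Q B ⟨o + 3 * min s.pc P.length, r, μ⟩ t' ⟨o + 3 * P.length, r', μ'⟩ := by
  intro t
  induction t with
  | zero =>
    intro s _ hpc r μ hb h
    simp only [Function.iterate_zero, id] at hpc ⊢
    rw [min_eq_right hpc]
    exact ⟨0, le_rfl, r, μ, h, RunsTo.refl hb⟩
  | succ t ih =>
    intro s hs hpc r μ hb h
    by_cases hlt : s.pc < P.length
    · obtain ⟨r₁, μ₁, h₁, hrun₁⟩ := simulate_step hinj hρ3 hW hB hB2 hQ hlt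
        (hs 0 (by omega)) (hs 1 (by omega)) hb h
      obtain ⟨t', ht', r', μ', h', hrun'⟩ := ih (step P s)
        (fun i hi => hs (i + 1) (by omega)) hpc r₁ μ₁ hrun₁.bounded h₁
      exact ⟨3 + t', by omega, r', μ', h', hrun₁.trans hrun'⟩
    -- A halted machine is a fixed point, so the remaining steps cost the host nothing.
    · have hfix : step P s = s := by simp [step, List.getElem?_eq_none (not_lt.mp hlt)]
      rw [Function.iterate_fixed hfix, min_eq_right (not_lt.mp hlt)]
      exact ⟨0, by omega, r, μ, h, RunsTo.refl hb⟩

/-- The simulation of a program that computes `y` on input `x`. -/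
theorem triple_simulate (hinj : Function.Injective ρ) (hρ3 : ∀ a, 3 < ρ a) {P : Program}
    {x : List ℕ} {T y : ℕ} (hP : ComputesWithin P x B' T y) (hB : B' ≤ B) {base W : ℕ}
    (hW : 0 < W) (hB2 : base + W * B' ≤ B) {J : (ℕ → ℕ) → (ℕ → ℕ) → Prop}
    (hJ : ∀ r μ r' μ', J r μ → r 1 = W → r 2 = base →
      (∀ q, q ≠ 3 → (∀ a, q ≠ ρ a) → r' q = r q) →
      (∀ q, (∀ a, q ≠ base + W * a) → μ' q = μ q) → J r' μ') :
    Triple B (3 * T) (Code.simulate ρ P)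
      (fun r μ => J r μ ∧ r 1 = W ∧ r 2 = base ∧ (∀ a, r (ρ a) = 0) ∧
        ∀ a, μ (base + W * a) = x.getD a 0)
      (fun r μ => J r μ ∧ r (ρ 0) = y) := by
  rintro Q o hQ r μ hb ⟨hJr, rfl, rfl, hr, hμ⟩
  obtain ⟨t, ht, hpc, hy, hbd⟩ := hP
  have hbd' : ∀ i ≤ t, Bounded B' ((step P)^[i] (init x)).reg ((step P)^[i] (init x)).mem :=
    fun i hi => ⟨fun a => (hbd i hi a).1, fun a => (hbd i hi a).2⟩
  obtain ⟨t', ht', r', μ', h', hrun⟩ := simulate_run (r₀ := r) (μ₀ := μ) hinj hρ3 hW hB hB2 hQ t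
    (init x) hbd' hpc r μ hb ⟨hr, hμ, fun _ _ _ => rfl, fun _ _ => rfl⟩
  have ht2 : t ≤ T := by exact_mod_cast ht
  refine ⟨t', by omega, r', μ', ⟨hJ r μ r' μ' hJr rfl rfl h'.frame_reg h'.frame_mem, ?_⟩, ?_⟩
  · rw [h'.reg 0]; exact hy
  · simpa [init, Code.simulate] using hrun

end Simulation

end RAM

/-! ## The program of the reduction -/

namespace RAM

theorem wp_append {B : ℕ} {Q : (ℕ → ℕ) → (ℕ → ℕ) → Prop} :
    ∀ (is js : List Instr) (r μ : ℕ → ℕ), wp B (is ++ js) Q r μ ↔ wp B is (wp B js Q) r μ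
  | [], _, _, _ => Iff.rfl
  | .const _ _ :: is, js, _, _ => and_congr_right fun _ => wp_append is js _ _
  | .op _ _ _ _ :: is, js, _, _ => and_congr_right fun _ => wp_append is js _ _
  | .load _ _ :: is, js, _, _ => wp_append is js _ _
  | .store _ _ :: is, js, _, _ => wp_append is js _ _
  | .jumpZero _ _ :: _, _, _, _ => Iff.rfl

theorem wp_mono {B : ℕ} {Q Q' : (ℕ → ℕ) → (ℕ → ℕ) → Prop} (h : ∀ r μ, Q r μ → Q' r μ) :
    ∀ (is : List Instr) (r μ : ℕ → ℕ), wp B is Q r μ → wp B is Q' r μ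
  | [], r, μ => h r μ
  | .const _ _ :: is, _, _ => And.imp_right (wp_mono h is _ _)
  | .op _ _ _ _ :: is, _, _ => And.imp_right (wp_mono h is _ _)
  | .load _ _ :: is, _, _ => wp_mono h is _ _
  | .store _ _ :: is, _, _ => wp_mono h is _ _
  | .jumpZero _ _ :: _, _, _ => id

/-- An affine expression in the number of the current hyperedge (`lin`), or in the label of the
vertex in a given place of the current hyperedge (`lab`). -/
inductive Term where
  | lin (a b : ℕ)
  | lab (i a b : ℕ)

def Term.eval (j : ℕ) (f : ℕ → ℕ) : Term → ℕ
  | .lin a b => a * j + b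
  | .lab i a b => a * f i + b

/-- The coefficients of a term are at most `A`, and the place is less than `k`. -/
def Term.Small (A k : ℕ) : Term → Prop
  | .lin a b => a ≤ A ∧ b ≤ A
  | .lab i a b => i < k ∧ a ≤ A ∧ b ≤ A

/-- The parameters of the reduction: the input has `n` vertices and `m` hyperedges of arity `k` with
vertices `vtx j i`; there are `R` simulated runs, in each of which the values are below `B'`. -/
structure Params where
  (n m k Q R A B B' L : ℕ)
  vtx : ℕ → ℕ → ℕ

namespace Params

/-- The number of interleaved memory regions. -/
def W (e : Params) : ℕ := e.R + 1

/-- The length of the input. -/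
def Z (e : Params) : ℕ := e.m * (e.k + 1) + 2

/-- The bound `B` is large enough. -/
structure Fits (e : Params) : Prop where
  vtx_lt : ∀ j < e.m, ∀ i < e.k, e.vtx j i < e.n
  k_le : e.k + 1 ≤ e.A
  k_le_Q : e.k ≤ e.Q
  Q_le : e.Q ≤ e.A
  W_le : e.W ≤ e.A
  three_le : 3 ≤ e.A
  mem_le : e.Z + e.W * (e.n + e.B' + e.L + 2) ≤ e.B
  val_lt : e.A * (e.m * e.Q + e.m + 2) < e.B

variable {e : Params}

theorem pos_W : 0 < e.W := Nat.succ_pos _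

/-- Two leading cells hold `n` and `m`, and each hyperedge takes `k + 1` cells, the first for its
arity; hence the offset `3` of a vertex entry. -/
theorem cell_lt_Z {j i : ℕ} (hj : j < e.m) (hi : i < e.k) : 3 + j * (e.k + 1) + i < e.Z := by
  have : (j + 1) * (e.k + 1) ≤ e.m * (e.k + 1) := Nat.mul_le_mul_right _ hj
  rw [Nat.add_mul] at this
  unfold Z
  omega

/-- Regions are interleaved: the residue modulo `W` is the region and the quotient is the cell in
it. Thus every region is unbounded and no region size has to be known in advance. -/
theorem cell_inj {a b c d : ℕ} (hb : b < e.W) (hd : d < e.W)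
    (h : e.Z + e.W * a + b = e.Z + e.W * c + d) : a = c ∧ b = d := by
  have h' : e.W * a + b = e.W * c + d := by omega
  have h1 := congrArg (· % e.W) h'
  simp only [Nat.mul_add_mod, Nat.mod_eq_of_lt hb, Nat.mod_eq_of_lt hd] at h1
  subst h1
  exact ⟨Nat.eq_of_mul_eq_mul_left (pos_W (e := e)) (by omega), rfl⟩

/-- The registers that may change freely. -/
def scratch : Finset ℕ := {2, 3, 5, 6, 7, 8, 9, 13}

/-- The part of the state that persists: constants, the accumulators, the input, and the fact that
the registers of the runs from `ir` on and the memory regions of the runs from `im` on are blank. -/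
structure Base (e : Params) (ir im pos neg : ℕ) (r μ : ℕ → ℕ) : Prop where
  r0 : r 0 = 0
  r1 : r 1 = e.W
  r4 : r 4 = e.m
  r10 : r 10 = pos
  r11 : r 11 = neg
  r12 : r 12 = e.Z
  input : ∀ j < e.m, ∀ i < e.k, μ (3 + j * (e.k + 1) + i) = e.vtx j i
  blank_reg : ∀ i < e.R, ir ≤ i → ∀ a, r (16 + e.W * a + i) = 0
  blank_mem : ∀ i < e.R, im ≤ i → ∀ a, μ (e.Z + e.W * a + (i + 1)) = 0

theorem Base.congr_of_blank {ir im ir' im' pos neg : ℕ} {r μ r' μ' : ℕ → ℕ}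
    (h : e.Base ir im pos neg r μ) (hr : ∀ q < 16, q ∉ scratch → r' q = r q)
    (hμ : ∀ q < e.Z, μ' q = μ q)
    (hr' : ∀ i < e.R, ir' ≤ i → ∀ a, r' (16 + e.W * a + i) = 0)
    (hμ' : ∀ i < e.R, im' ≤ i → ∀ a, μ' (e.Z + e.W * a + (i + 1)) = 0) :
    e.Base ir' im' pos neg r' μ' where
  r0 := by rw [hr 0 (by decide) (by decide), h.r0]
  r1 := by rw [hr 1 (by decide) (by decide), h.r1]
  r4 := by rw [hr 4 (by decide) (by decide), h.r4]
  r10 := by rw [hr 10 (by decide) (by decide), h.r10]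
  r11 := by rw [hr 11 (by decide) (by decide), h.r11]
  r12 := by rw [hr 12 (by decide) (by decide), h.r12]
  input j hj i hi := by rw [hμ _ (cell_lt_Z hj hi), h.input j hj i hi]
  blank_reg := hr'
  blank_mem := hμ'

theorem Base.congr {ir im pos neg : ℕ} {r μ r' μ' : ℕ → ℕ} (h : e.Base ir im pos neg r μ)
    (hr : ∀ q ∉ scratch, r' q = r q) (hμ : ∀ q < e.Z, μ' q = μ q)
    (hμ' : ∀ i < e.R, im ≤ i → ∀ a,
      μ' (e.Z + e.W * a + (i + 1)) = μ (e.Z + e.W * a + (i + 1))) :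
    e.Base ir im pos neg r' μ' :=
  h.congr_of_blank (fun q _ => hr q) hμ
    (fun i hi hir a => by
      rw [hr _ (by simp only [scratch, Finset.mem_insert, Finset.mem_singleton]; omega),
        h.blank_reg i hi hir a])
    fun i hi him a => by rw [hμ' i hi him a, h.blank_mem i hi him a]

theorem Base.congr_reg {ir im pos neg : ℕ} {r μ r' : ℕ → ℕ} (h : e.Base ir im pos neg r μ)
    (hr : ∀ q ∉ scratch, r' q = r q) : e.Base ir im pos neg r' μ :=
  h.congr hr (fun _ _ => rfl) fun _ _ _ _ => rfl

/-- The loop registers while the hyperedge number `j` is processed. -/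
structure Cursor (e : Params) (j : ℕ) (r : ℕ → ℕ) : Prop where
  r5 : r 5 = e.m - j
  r6 : r 6 = j
  r7 : r 7 = 3 + j * (e.k + 1)

theorem Cursor.congr {j : ℕ} {r r' : ℕ → ℕ} (h : e.Cursor j r) (h5 : r' 5 = r 5)
    (h6 : r' 6 = r 6) (h7 : r' 7 = r 7) : e.Cursor j r' :=
  ⟨h5.trans h.r5, h6.trans h.r6, h7.trans h.r7⟩

def cursorInit : List Instr := [.op .add 5 4 0, .const 6 0, .const 7 3]

def cursorStep (k : ℕ) : List Instr :=
  [.const 3 (k + 1), .op .add 7 7 3, .const 3 1, .op .add 6 6 3, .op .sub 5 5 3]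

theorem Fits.lt_B (hf : e.Fits) {v : ℕ} (hv : v ≤ e.A) : v < e.B := by
  have h1 := hf.val_lt
  have : e.A * 1 ≤ e.A * (e.m * e.Q + e.m + 2) := Nat.mul_le_mul_left _ (by omega)
  omega

theorem Fits.m_lt_B (hf : e.Fits) : e.m + 1 < e.B := by
  have h1 := hf.val_lt
  have h2 := hf.three_le
  have : 1 * (e.m + 2) ≤ e.A * (e.m * e.Q + e.m + 2) := Nat.mul_le_mul (by omega) (by omega)
  omega

theorem Fits.Z_lt_B (hf : e.Fits) : e.Z + e.W + 1 < e.B := by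
  have h1 := hf.mem_le
  have h2 := pos_W (e := e)
  have : e.W * 2 ≤ e.W * (e.n + e.B' + e.L + 2) := Nat.mul_le_mul_left _ (by omega)
  -- For `W ≥ 2` the memory bound has room for `2 * W`. For `W = 1` it is tight, and the bound on
  -- values is used instead.
  rcases Nat.lt_or_ge 1 e.W with h3 | h3
  · omega
  · have hW : e.W = 1 := by omega
    have h4 := hf.val_lt
    have h5 := hf.k_le
    have h6 := hf.three_le
    have h7 : (e.k + 1) * e.m ≤ e.A * e.m := Nat.mul_le_mul_right _ h5
    have h8 : e.A * (e.m * e.Q + e.m + 2) = e.A * (e.m * e.Q) + e.A * e.m + e.A * 2 := by ring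
    have h9 : e.Z = (e.k + 1) * e.m + 2 := by unfold Z; ring
    omega

theorem wp_cursorInit (hf : e.Fits) {r μ : ℕ → ℕ} {Post : (ℕ → ℕ) → (ℕ → ℕ) → Prop}
    (h0 : r 0 = 0) (h4 : r 4 = e.m)
    (h : ∀ r', e.Cursor 0 r' → (∀ q, q ≠ 5 → q ≠ 6 → q ≠ 7 → r' q = r q) → Post r' μ) :
    wp e.B cursorInit Post r μ := by
  have := hf.m_lt_B
  refine ⟨by simp [Op.eval, h0, h4]; omega, hf.lt_B (by omega), hf.lt_B hf.three_le, h _ ?_ ?_⟩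
  · constructor <;> simp [Op.eval, h0, h4]
  · intro q h5 h6 h7
    simp [h5, h6, h7]

theorem wp_cursorStep (hf : e.Fits) {j : ℕ} (hj : j < e.m) {r μ : ℕ → ℕ}
    {Post : (ℕ → ℕ) → (ℕ → ℕ) → Prop} (hc : e.Cursor j r)
    (h : ∀ r', e.Cursor (j + 1) r' → (∀ q, q ≠ 3 → q ≠ 5 → q ≠ 6 → q ≠ 7 → r' q = r q) →
      Post r' μ) :
    wp e.B (cursorStep e.k) Post r μ := by
  have h1 := hf.m_lt_B
  have h2 := hf.Z_lt_B
  have h3 : (j + 1) * (e.k + 1) ≤ e.m * (e.k + 1) := Nat.mul_le_mul_right _ hj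
  have h4 : e.Z = e.m * (e.k + 1) + 2 := rfl
  have h5 := pos_W (e := e)
  rw [Nat.add_mul, Nat.one_mul] at h3
  refine ⟨hf.lt_B hf.k_le, ?_, hf.lt_B (by have := hf.three_le; omega), ?_, ?_, h _ ?_ ?_⟩
  · simp [Op.eval, hc.r7]; omega
  · simp [Op.eval, hc.r6]; omega
  · simp [Op.eval, hc.r5]; omega
  · constructor
    · simp [Op.eval, hc.r5]; omega
    · simp [Op.eval, hc.r6]
    · simp [Op.eval, hc.r7]; ring
  · intro q h3 h5 h6 h7
    simp [h3, h5, h6, h7]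

/-! ### Labelling the vertices -/

/-- Gives the vertex in place `i` of the current hyperedge a label. -/
def labelSlot (Q i : ℕ) : List Instr :=
  [.const 3 i, .op .add 3 3 7, .load 9 3, .op .mul 9 9 1, .op .add 9 9 12, .const 13 Q,
    .op .mul 13 13 6, .const 3 i, .op .add 13 13 3, .store 9 13]

/-- All vertices `v` with `S v` are labelled by one of their occurrences. -/
def Labelled (e : Params) (S : ℕ → Prop) (μ : ℕ → ℕ) : Prop :=
  ∀ v, S v → ∃ j < e.m, ∃ i < e.k, e.vtx j i = v ∧ μ (e.Z + e.W * v) = j * e.Q + i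

theorem Fits.table_lt (hf : e.Fits) {j i : ℕ} (hj : j < e.m) (hi : i < e.k) :
    e.vtx j i * e.W + e.Z < e.B := by
  have hv := hf.vtx_lt j hj i hi
  have h1 := hf.mem_le
  have : e.W * (e.vtx j i + 1) ≤ e.W * (e.n + e.B' + e.L + 2) := Nat.mul_le_mul_left _ (by omega)
  have h2 := pos_W (e := e)
  rw [Nat.mul_add, Nat.mul_comm] at this
  omega

/-- The write is unconditional: a vertex that occurs again has its label replaced by the new
occurrence, which serves equally well. The table is therefore neither initialised nor searched, and
the cost depends on `m` but not on `n`. -/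
theorem wp_labelSlot (hf : e.Fits) {i j : ℕ} (hi : i < e.k) (hj : j < e.m) {r μ : ℕ → ℕ}
    {S : ℕ → Prop} (hb : e.Base 0 0 0 0 r μ) (hc : e.Cursor j r) (hl : e.Labelled S μ) :
    wp e.B (labelSlot e.Q i) (fun r' μ' => e.Base 0 0 0 0 r' μ' ∧ e.Cursor j r' ∧
      e.Labelled (fun v => S v ∨ v = e.vtx j i) μ') r μ := by
  have hZ := cell_lt_Z hj hi
  have hZB := hf.Z_lt_B
  have hvB := hf.table_lt hj hi
  have hQ : e.Q * j + i < e.B := by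
    have h1 := hf.val_lt
    have h2 := hf.k_le_Q
    have h3 := hf.three_le
    have h4 : 1 * (e.m * e.Q) ≤ e.A * (e.m * e.Q + e.m + 2) :=
      Nat.mul_le_mul (by omega) (by omega)
    have h5 : (j + 1) * e.Q ≤ e.m * e.Q := Nat.mul_le_mul_right _ hj
    rw [Nat.add_mul, Nat.mul_comm] at h5
    omega
  have hiA : i < e.B := hf.lt_B (by have := hf.k_le; omega)
  have hin : μ (i + (3 + j * (e.k + 1))) = e.vtx j i := by
    rw [← hb.input j hj i hi]; congr 1; omega
  have hadr : e.vtx j i * e.W + e.Z = e.Z + e.W * e.vtx j i := by ring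
  refine ⟨hiA, ?_, ?_, ?_, hf.lt_B hf.Q_le, ?_, hiA, ?_, ?_⟩
  · simp [Op.eval, hc.r7]; omega
  · simp [Op.eval, hc.r7, hin, hb.r1]; omega
  · simp [Op.eval, hc.r7, hin, hb.r1, hb.r12]; omega
  · simp [Op.eval, hc.r6]; omega
  · simp [Op.eval, hc.r6]; omega
  simp [wp, Op.eval, hc.r7, hc.r6, hin, hb.r1, hb.r12, hadr]
  refine ⟨hb.congr ?_ ?_ ?_, hc.congr (by simp) (by simp) (by simp), ?_⟩
  · intro q hq
    simp only [scratch, Finset.mem_insert, Finset.mem_singleton, not_or] at hq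
    simp [hq]
  · intro q hq
    rw [Function.update_of_ne (by omega)]
  · intro i' hi' _ a
    rw [Function.update_of_ne]
    intro h
    have := (cell_inj (e := e) (by unfold W; omega) pos_W
      (h.trans (Nat.add_zero _).symm)).2
    omega
  · intro v hv'
    by_cases hveq : v = e.vtx j i
    · subst hveq
      exact ⟨j, hj, i, hi, rfl, by simp; ring⟩
    · obtain ⟨j', hj', i', hi', h1, h2⟩ := hl v (hv'.resolve_right hveq)
      refine ⟨j', hj', i', hi', h1, ?_⟩
      rw [Function.update_of_ne, h2]
      intro h
      exact hveq (Nat.eq_of_mul_eq_mul_left (pos_W (e := e)) (by omega))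

def labelAll (Q : ℕ) : ℕ → List Instr
  | 0 => []
  | i + 1 => labelAll Q i ++ labelSlot Q i

theorem wp_labelAll (hf : e.Fits) {j : ℕ} (hj : j < e.m) {S : ℕ → Prop} :
    ∀ i ≤ e.k, ∀ r μ, e.Base 0 0 0 0 r μ → e.Cursor j r → e.Labelled S μ →
      wp e.B (labelAll e.Q i) (fun r' μ' => e.Base 0 0 0 0 r' μ' ∧ e.Cursor j r' ∧
        e.Labelled (fun v => S v ∨ ∃ i' < i, v = e.vtx j i') μ') r μ
  | 0, _, r, μ, hb, hc, hl => ⟨hb, hc, fun v hv => hl v (by simpa using hv)⟩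
  | i + 1, hi, r, μ, hb, hc, hl => by
    rw [labelAll, wp_append]
    refine wp_mono ?_ _ _ _ (wp_labelAll hf hj i (by omega) r μ hb hc hl)
    rintro r₁ μ₁ ⟨hb₁, hc₁, hl₁⟩
    refine wp_mono ?_ _ _ _ (wp_labelSlot hf (by omega) hj hb₁ hc₁ hl₁)
    rintro r₂ μ₂ ⟨hb₂, hc₂, hl₂⟩
    refine ⟨hb₂, hc₂, fun v hv => hl₂ v ?_⟩
    rcases hv with hv | ⟨i', hi', rfl⟩
    · exact Or.inl (Or.inl hv)
    · rcases Nat.lt_succ_iff_lt_or_eq.mp hi' with h | rfl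
      · exact Or.inl (Or.inr ⟨i', h, rfl⟩)
      · exact Or.inr rfl

/-- Cell `1` holds `m`, and register `12` receives `m * (k + 1) + 2`, the first address behind the
input. -/
def setup (k W : ℕ) : List Instr :=
  [.const 1 W, .const 3 1, .load 4 3, .const 3 (k + 1), .op .mul 12 4 3, .const 3 2,
    .op .add 12 12 3]

/-- The input is stored in the memory. -/
structure Loaded (e : Params) (r μ : ℕ → ℕ) : Prop where
  reg : ∀ a, r a = 0
  one : μ 1 = e.m
  input : ∀ j < e.m, ∀ i < e.k, μ (3 + j * (e.k + 1) + i) = e.vtx j i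
  blank : ∀ a, e.Z ≤ a → μ a = 0

theorem wp_setup (hf : e.Fits) {r μ : ℕ → ℕ} (h : e.Loaded r μ) :
    wp e.B (setup e.k e.W ++ cursorInit) (fun r' μ' => e.Base 0 0 0 0 r' μ' ∧ e.Cursor 0 r' ∧
      e.Labelled (fun _ => False) μ') r μ := by
  have hZ := hf.Z_lt_B
  have hZe : e.Z = e.m * (e.k + 1) + 2 := rfl
  have h3 := hf.three_le
  have hB : ∀ r' : ℕ → ℕ, (∀ q, q ≠ 1 → q ≠ 3 → q ≠ 4 → q ≠ 12 → r' q = 0) → r' 1 = e.W →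
      r' 4 = e.m → r' 12 = e.Z → e.Base 0 0 0 0 r' μ := fun r' hr' h1 h4 h12 =>
    { r0 := hr' 0 (by omega) (by omega) (by omega) (by omega)
      r1 := h1
      r4 := h4
      r10 := hr' 10 (by omega) (by omega) (by omega) (by omega)
      r11 := hr' 11 (by omega) (by omega) (by omega) (by omega)
      r12 := h12
      input := h.input
      blank_reg := fun i _ _ a => hr' _ (by omega) (by omega) (by omega) (by omega)
      blank_mem := fun i _ _ a => h.blank _ (by omega) }
  rw [wp_append]
  refine ⟨hf.lt_B hf.W_le, hf.lt_B (by omega), hf.lt_B hf.k_le, ?_, hf.lt_B (by omega), ?_, ?_⟩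
  · simp [Op.eval, h.one]; omega
  · simp [Op.eval, h.one]; omega
  · have hb := hB (Function.update (Function.update (Function.update (Function.update
      (Function.update (Function.update (Function.update r 1 e.W) 3 1) 4 e.m) 3 (e.k + 1)) 12
      (e.m * (e.k + 1))) 3 2) 12 e.Z) ?_ ?_ ?_ ?_
    · simp only [wp, Op.eval]
      have : ∀ {Q r₁ r₂}, r₁ = r₂ → wp e.B cursorInit Q r₁ μ → wp e.B cursorInit Q r₂ μ := by
        rintro Q r₁ r₂ rfl h; exact h
      refine this ?_ (wp_cursorInit hf hb.r0 hb.r4 fun r' hc hr' =>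
        ⟨hb.congr_reg ?_, hc, fun v hv => hv.elim⟩)
      · simp [h.one, hZe]
      · intro q hq
        simp only [scratch, Finset.mem_insert, Finset.mem_singleton, not_or] at hq
        exact hr' q (by tauto) (by tauto) (by tauto)
    · intro q h1 h3 h4 h12
      simp [h1, h3, h4, h12, h.reg]
    · simp
    · simp
    · simp

def labelLoop (Q k : ℕ) : Code := (Code.block (labelAll Q k ++ cursorStep k)).loop 5

theorem triple_labelLoop (hf : e.Fits) :
    Triple e.B (e.m * ((labelAll e.Q e.k ++ cursorStep e.k).length + 2) + 1) (labelLoop e.Q e.k)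
      (fun r μ => e.Base 0 0 0 0 r μ ∧ e.Cursor 0 r ∧ e.Labelled (fun _ => False) μ)
      (fun r μ => e.Base 0 0 0 0 r μ ∧
        e.Labelled (fun v => ∃ j < e.m, ∃ i < e.k, v = e.vtx j i) μ) := by
  refine (Triple.loop (I := fun j r μ => e.Base 0 0 0 0 r μ ∧ e.Cursor j r ∧
    e.Labelled (fun v => ∃ j' < j, ∃ i < e.k, v = e.vtx j' i) μ) (fun j hj => triple_block ?_)
    ?_).mono le_rfl ?_ ?_
  · rintro r μ ⟨hb, hc, hl⟩
    rw [wp_append]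
    refine wp_mono ?_ _ _ _ (wp_labelAll hf hj e.k le_rfl r μ hb hc hl)
    rintro r₁ μ₁ ⟨hb₁, hc₁, hl₁⟩
    refine wp_cursorStep hf hj hc₁ fun r₂ hc₂ hr₂ => ⟨hb₁.congr_reg ?_, hc₂, ?_⟩
    · intro q hq
      simp only [scratch, Finset.mem_insert, Finset.mem_singleton, not_or] at hq
      exact hr₂ q (by tauto) (by tauto) (by tauto) (by tauto)
    · rintro v ⟨j', hj', i, hi, rfl⟩
      refine hl₁ _ ?_
      rcases Nat.lt_succ_iff_lt_or_eq.mp hj' with h | rfl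
      · exact Or.inl ⟨j', h, i, hi, rfl⟩
      · exact Or.inr ⟨i, hi, rfl⟩
  · rintro j hj r μ ⟨hb, hc, -⟩
    exact ⟨hc.r5, hb.r0⟩
  · rintro r μ ⟨hb, hc, hl⟩
    exact ⟨hb, hc, fun v ⟨j, hj, _⟩ => absurd hj (Nat.not_lt_zero j)⟩
  · rintro r μ ⟨hb, -, hl⟩
    exact ⟨hb, hl⟩

end Params

end RAM

/-! ### Writing the inputs of the runs, simulating them, and adding the outputs -/

namespace RAM

/-- One run of the simulated program: the sign with which its output is counted, and the input on
which it is run. That input consists of affine expressions in the number of hyperedges, and of one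
copy of `body` for every hyperedge. -/
structure Run where
  positive : Bool
  pre : List (ℕ × ℕ)
  body : List Term

def Run.input (u : Run) (m : ℕ) (f : ℕ → ℕ → ℕ) : List ℕ :=
  u.pre.map (fun p => p.1 * m + p.2) ++
    (List.range m).flatMap fun j => u.body.map (Term.eval j (f j))

/-- Register `q` is `4` for an expression in `m` and `6` for one in the current `j`. The output
pointer in register `8` advances by `W`, which keeps it in its region. -/
def emitAffine (q a b : ℕ) : List Instr :=
  [.const 9 a, .op .mul 9 9 q, .const 3 b, .op .add 9 9 3, .store 8 9, .op .add 8 8 1]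

def Term.emit : Term → List Instr
  | .lin a b => emitAffine 6 a b
  | .lab i a b => [.const 3 i, .op .add 3 3 7, .load 9 3, .op .mul 9 9 1, .op .add 9 9 12,
      .load 9 9, .const 3 a, .op .mul 9 9 3, .const 3 b, .op .add 9 9 3, .store 8 9,
      .op .add 8 8 1]

/-- The register of the host that holds register `a` of the simulated program in run `i`. -/
def hostReg (W i a : ℕ) : ℕ := 16 + W * a + i

/-- Run `i` owns memory region `i + 1`; region `0` is the table of labels. -/
def phaseInit (i : ℕ) : List Instr := [.const 3 (i + 1), .op .add 2 12 3, .op .add 8 2 0]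

/-- The two signs are summed in separate registers since words are natural numbers and subtraction
is truncated. -/
def accumulator (u : Run) : ℕ := if u.positive then 10 else 11

def phase (P : Program) (k W i : ℕ) (u : Run) : Code :=
  (Code.block (phaseInit i ++ (u.pre.flatMap (fun p => emitAffine 4 p.1 p.2) ++
    Params.cursorInit))).seq
  (((Code.block (u.body.flatMap Term.emit ++ Params.cursorStep k)).loop 5).seq
  ((Code.simulate (hostReg W i) P).seq
  (Code.block [.op .add (accumulator u) (accumulator u) (hostReg W i 0)])))

def phases (P : Program) (k W : ℕ) : ℕ → List Run → Code
  | _, [] => Code.block []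
  | i, u :: us => (phase P k W i u).seq (phases P k W (i + 1) us)

/-- With truncated subtraction, `1 - (1 - x)` is `0` for `x = 0` and `1` otherwise; it is applied to
`x = pos - neg`. -/
def decideSign : List Instr :=
  [.op .sub 9 10 11, .const 3 1, .op .sub 9 3 9, .op .sub 0 3 9]

/-- The program that labels the vertices of its input, performs the given runs of `P`, and decides
whether the signed sum of their outputs is positive. -/
def reduction (P : Program) (k Q : ℕ) (us : List Run) : Code :=
  (Code.block (Params.setup k (us.length + 1) ++ Params.cursorInit)).seq
  ((Params.labelLoop Q k).seq
  ((phases P k (us.length + 1) 0 us).seq (Code.block decideSign)))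

theorem ComputesWithin.lt {P : Program} {x : List ℕ} {B y : ℕ} {T : ℝ}
    (h : ComputesWithin P x B T y) : y < B := by
  obtain ⟨t, -, -, rfl, hb⟩ := h
  exact (hb t le_rfl 0).1

namespace Params

variable {e : Params}

/-- The vertices of the input have the labels `lab`. -/
def Table (e : Params) (lab : ℕ → ℕ) (μ : ℕ → ℕ) : Prop :=
  ∀ j < e.m, ∀ i < e.k, μ (e.Z + e.W * e.vtx j i) = lab (e.vtx j i)

/-- The state while the input of run `i` is being written; `ys` is the part written so far. -/
structure Emitting (e : Params) (lab : ℕ → ℕ) (i pos neg : ℕ) (ys : List ℕ) (r μ : ℕ → ℕ) :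
    Prop where
  base : e.Base i (i + 1) pos neg r μ
  table : e.Table lab μ
  out : ∀ p, μ (e.Z + e.W * p + (i + 1)) = ys.getD p 0
  r2 : r 2 = e.Z + (i + 1)
  r8 : r 8 = e.Z + e.W * ys.length + (i + 1)

section Emit

variable {lab : ℕ → ℕ} {i pos neg : ℕ} {ys : List ℕ} {r μ : ℕ → ℕ}

theorem Emitting.congr_reg (h : e.Emitting lab i pos neg ys r μ) {r' : ℕ → ℕ}
    (hr : ∀ q, q ≠ 3 → q ≠ 5 → q ≠ 6 → q ≠ 7 → r' q = r q) :
    e.Emitting lab i pos neg ys r' μ where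
  base := h.base.congr_reg fun q hq => by
    simp only [scratch, Finset.mem_insert, Finset.mem_singleton, not_or] at hq
    exact hr q (by tauto) (by tauto) (by tauto) (by tauto)
  table := h.table
  out := h.out
  r2 := by rw [hr 2 (by omega) (by omega) (by omega) (by omega), h.r2]
  r8 := by rw [hr 8 (by omega) (by omega) (by omega) (by omega), h.r8]

theorem Emitting.store (hi : i < e.R) (h : e.Emitting lab i pos neg ys r μ) {r' : ℕ → ℕ} (y : ℕ)
    (hr : ∀ q, q ≠ 3 → q ≠ 8 → q ≠ 9 → r' q = r q)
    (h8 : r' 8 = e.Z + e.W * ys.length + (i + 1) + e.W) :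
    e.Emitting lab i pos neg (ys ++ [y]) r'
      (Function.update μ (e.Z + e.W * ys.length + (i + 1)) y) where
  base := by
    refine h.base.congr (fun q hq => ?_) (fun q hq => ?_) fun i' hi' him a => ?_
    · simp only [scratch, Finset.mem_insert, Finset.mem_singleton, not_or] at hq
      exact hr q (by tauto) (by tauto) (by tauto)
    · rw [Function.update_of_ne (by omega)]
    · rw [Function.update_of_ne]
      intro hh
      have := (cell_inj (e := e) (by unfold W; omega) (by unfold W; omega) hh).2
      omega
  table := fun j hj i' hi' => by
    rw [Function.update_of_ne, h.table j hj i' hi']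
    intro hh
    have := (cell_inj (e := e) (b := 0) pos_W (by unfold W; omega) hh).2
    omega
  out p := by
    by_cases hp : p = ys.length
    · subst hp; simp
    · rw [Function.update_of_ne, h.out p]
      · rcases Nat.lt_or_gt_of_ne hp with hp | hp
        · rw [List.getD_append _ _ _ _ hp]
        · rw [List.getD_eq_default _ _ hp.le, List.getD_eq_default _ _ (by simp; omega)]
      · intro hh
        exact hp (cell_inj (e := e) (by unfold W; omega) (by unfold W; omega) hh).1
  r2 := by rw [hr 2 (by omega) (by omega) (by omega), h.r2]
  r8 := by rw [h8, List.length_append, List.length_singleton]; ring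

theorem Fits.ptr_lt (hf : e.Fits) (hi : i < e.R) (hys : ys.length < e.L) :
    e.Z + e.W * ys.length + (i + 1) + e.W < e.B := by
  have h1 := hf.mem_le
  have h2 : e.W * (ys.length + 3) ≤ e.W * (e.n + e.B' + e.L + 2) :=
    Nat.mul_le_mul_left _ (by omega)
  have h3 := pos_W (e := e)
  have h4 : i + 1 < e.W := by unfold W; omega
  rw [Nat.mul_add] at h2
  omega

theorem wp_emitAffine (hf : e.Fits) (hi : i < e.R) (h : e.Emitting lab i pos neg ys r μ)
    (hys : ys.length < e.L) {q a b : ℕ} (hq9 : q ≠ 9) (hq : r q ≤ e.m)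
    (ha : a ≤ e.A) (hb : b ≤ e.A) :
    wp e.B (emitAffine q a b) (fun r' μ' =>
      e.Emitting lab i pos neg (ys ++ [a * r q + b]) r' μ' ∧
        ∀ q', q' ≠ 3 → q' ≠ 8 → q' ≠ 9 → r' q' = r q') r μ := by
  have hptr := hf.ptr_lt hi hys
  have hval : a * r q + b < e.B := by
    have h1 := hf.val_lt
    have h2 : a * r q ≤ e.A * e.m := Nat.mul_le_mul ha hq
    have h3 : e.A * (e.m * e.Q + e.m + 2) = e.A * (e.m * e.Q) + e.A * e.m + e.A * 2 := by ring
    omega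
  refine ⟨hf.lt_B ha, ?_, hf.lt_B hb, ?_, ?_, ?_⟩
  · simp [Op.eval, hq9]; omega
  · simpa [Op.eval, hq9] using hval
  · simpa [Op.eval, h.r8, h.base.r1] using hptr
  · have key : ∀ q', q' ≠ 3 → q' ≠ 8 → q' ≠ 9 →
        (Function.update (Function.update (Function.update (Function.update (Function.update r 9 a)
          9 (a * r q)) 3 b) 9 (a * r q + b)) 8 (e.Z + e.W * ys.length + (i + 1) + e.W)) q' =
          r q' := fun q' h3 h8 h9 => by simp [h3, h8, h9]
    have := h.store hi (a * r q + b) key (by simp)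
    simp only [Op.eval, wp]
    simp only [Function.update_of_ne hq9, Function.update_of_ne, Function.update_self, ne_eq,
      Nat.reduceEqDiff, not_false_eq_true, h.r8, h.base.r1]
    exact ⟨this, key⟩

theorem wp_emit (hf : e.Fits) (hi : i < e.R) (h : e.Emitting lab i pos neg ys r μ)
    (hys : ys.length < e.L) {j : ℕ} (hj : j < e.m) (hc : e.Cursor j r)
    (hlab : ∀ i' < e.k, lab (e.vtx j i') < e.m * e.Q) {t : Term} (ht : t.Small e.A e.k) :
    wp e.B t.emit (fun r' μ' =>
      e.Emitting lab i pos neg (ys ++ [t.eval j fun i' => lab (e.vtx j i')]) r' μ' ∧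
        e.Cursor j r') r μ := by
  cases t with
  | lin a b =>
    refine wp_mono ?_ _ _ _ (wp_emitAffine hf hi h hys (q := 6) (by omega)
      (by rw [hc.r6]; omega) ht.1 ht.2)
    rintro r' μ' ⟨h', hr'⟩
    rw [hc.r6] at h'
    exact ⟨h', hc.congr (hr' 5 (by omega) (by omega) (by omega))
      (hr' 6 (by omega) (by omega) (by omega)) (hr' 7 (by omega) (by omega) (by omega))⟩
  | lab i' a b =>
    obtain ⟨hi', ha, hb⟩ := ht
    have hptr := hf.ptr_lt hi hys
    have hZ := cell_lt_Z hj hi'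
    have hZB := hf.Z_lt_B
    have hvB := hf.table_lt hj hi'
    have hl := hlab i' hi'
    have hval : lab (e.vtx j i') * a + b < e.B := by
      have h1 := hf.val_lt
      have h2 : a * lab (e.vtx j i') ≤ e.A * (e.m * e.Q) := Nat.mul_le_mul ha hl.le
      have h3 : e.A * (e.m * e.Q + e.m + 2) = e.A * (e.m * e.Q) + e.A * e.m + e.A * 2 := by ring
      rw [Nat.mul_comm]
      omega
    have hin : μ (i' + (3 + j * (e.k + 1))) = e.vtx j i' := by
      rw [← h.base.input j hj i' hi']; congr 1; omega
    have htab : μ (e.vtx j i' * e.W + e.Z) = lab (e.vtx j i') := by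
      rw [← h.table j hj i' hi']; congr 1; ring
    have hsimp := And.intro hc.r7 (And.intro hin (And.intro h.base.r1 (And.intro h.base.r12
      (And.intro htab h.r8))))
    refine ⟨hf.lt_B (by have := hf.k_le; omega), ?_, ?_, ?_, hf.lt_B ha, ?_, hf.lt_B hb, ?_, ?_, ?_⟩
    · simp [Op.eval, hsimp]; omega
    · simp [Op.eval, hsimp]; omega
    · simp [Op.eval, hsimp]; omega
    · simp [Op.eval, hsimp]; omega
    · simp [Op.eval, hsimp]; omega
    · simp [Op.eval, hsimp]; omega
    · have key : ∀ r' : ℕ → ℕ, (∀ q, q ≠ 3 → q ≠ 8 → q ≠ 9 → r' q = r q) →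
          r' 8 = e.Z + e.W * ys.length + (i + 1) + e.W →
          e.Emitting lab i pos neg (ys ++ [(Term.lab i' a b).eval j fun i' => lab (e.vtx j i')]) r'
            (Function.update μ (e.Z + e.W * ys.length + (i + 1)) (lab (e.vtx j i') * a + b)) ∧
          e.Cursor j r' := fun r' hr' h8 => by
        have := h.store hi (lab (e.vtx j i') * a + b) hr' h8
        refine ⟨?_, hc.congr (hr' 5 (by omega) (by omega) (by omega))
          (hr' 6 (by omega) (by omega) (by omega)) (hr' 7 (by omega) (by omega) (by omega))⟩
        simpa [Term.eval, Nat.mul_comm a] using this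
      simp only [Op.eval, wp]
      simp only [Function.update_of_ne, Function.update_self, ne_eq, Nat.reduceEqDiff,
        not_false_eq_true, hsimp]
      refine key _ (fun q h3 h8 h9 => ?_) ?_
      · simp [h3, h8, h9]
      · simp

theorem wp_emit_pre (hf : e.Fits) (hi : i < e.R) :
    ∀ (ps : List (ℕ × ℕ)) (ys : List ℕ) (r μ : ℕ → ℕ), (∀ p ∈ ps, p.1 ≤ e.A ∧ p.2 ≤ e.A) →
      ys.length + ps.length ≤ e.L → e.Emitting lab i pos neg ys r μ →
      wp e.B (ps.flatMap fun p => emitAffine 4 p.1 p.2)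
        (e.Emitting lab i pos neg (ys ++ ps.map fun p => p.1 * e.m + p.2)) r μ
  | [], ys, r, μ, _, _, h => by simpa [wp] using h
  | p :: ps, ys, r, μ, hp, hys, h => by
    rw [List.flatMap_cons, wp_append]
    have hp1 := hp p (by simp)
    rw [List.length_cons] at hys
    refine wp_mono ?_ _ _ _ (wp_emitAffine hf hi h (by omega) (q := 4) (by omega)
      h.base.r4.le hp1.1 hp1.2)
    rintro r' μ' ⟨h', -⟩
    have := wp_emit_pre hf hi ps _ r' μ' (fun q hq => hp q (by simp [hq]))
      (by rw [List.length_append, List.length_singleton]; omega) h'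
    simpa [h.base.r4] using this

theorem wp_emit_body (hf : e.Fits) (hi : i < e.R) {j : ℕ} (hj : j < e.m)
    (hlab : ∀ i' < e.k, lab (e.vtx j i') < e.m * e.Q) :
    ∀ (ts : List Term) (ys : List ℕ) (r μ : ℕ → ℕ), (∀ t ∈ ts, t.Small e.A e.k) →
      ys.length + ts.length ≤ e.L → e.Emitting lab i pos neg ys r μ → e.Cursor j r →
      wp e.B (ts.flatMap Term.emit) (fun r' μ' =>
        e.Emitting lab i pos neg (ys ++ ts.map (Term.eval j fun i' => lab (e.vtx j i'))) r' μ' ∧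
          e.Cursor j r') r μ
  | [], ys, r, μ, _, _, h, hc => by simpa [wp] using And.intro h hc
  | t :: ts, ys, r, μ, ht, hys, h, hc => by
    rw [List.flatMap_cons, wp_append]
    rw [List.length_cons] at hys
    refine wp_mono ?_ _ _ _ (wp_emit hf hi h (by omega) hj hc hlab (ht t (by simp)))
    rintro r' μ' ⟨h', hc'⟩
    have := wp_emit_body hf hi hj hlab ts _ r' μ' (fun q hq => ht q (by simp [hq]))
      (by rw [List.length_append, List.length_singleton]; omega) h' hc'
    simpa using this

end Emit

/-- The coefficients in a run are at most `A`, and its input has length at most `L`. -/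
structure Suits (e : Params) (u : Run) : Prop where
  pre : ∀ p ∈ u.pre, p.1 ≤ e.A ∧ p.2 ≤ e.A
  body : ∀ t ∈ u.body, t.Small e.A e.k
  length : u.pre.length + e.m * u.body.length ≤ e.L

/-- The number of steps of a phase per hyperedge, apart from the simulation. -/
def phaseCost (k : ℕ) (u : Run) : ℕ :=
  (phaseInit 0 ++ (u.pre.flatMap (fun p => emitAffine 4 p.1 p.2) ++ cursorInit)).length +
    (u.body.flatMap Term.emit ++ cursorStep k).length + 4

theorem wp_phaseInit (hf : e.Fits) {i : ℕ} (hi : i < e.R) {lab : ℕ → ℕ} {pos neg : ℕ}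
    {r μ : ℕ → ℕ} (h : e.Base i i pos neg r μ) (ht : e.Table lab μ) :
    wp e.B (phaseInit i) (e.Emitting lab i pos neg []) r μ := by
  have h1 := hf.Z_lt_B
  have h2 : i + 1 < e.W := by unfold W; omega
  refine ⟨hf.lt_B (by have := hf.W_le; omega), ?_, ?_, ?_⟩
  · simp [Op.eval, h.r12]; omega
  · simp [Op.eval, h.r12, h.r0]; omega
  · refine ⟨⟨?_, ?_, ?_, ?_, ?_, ?_, h.input, ?_, fun i' hi' hh => h.blank_mem i' hi' (by omega)⟩,
      ht, ?_, ?_, ?_⟩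
    · simp [h.r0]
    · simp [h.r1]
    · simp [h.r4]
    · simp [h.r10]
    · simp [h.r11]
    · simp [h.r12]
    · intro i' hi' hh a
      rw [Function.update_of_ne (by omega), Function.update_of_ne (by omega),
        Function.update_of_ne (by omega), h.blank_reg i' hi' hh a]
    · intro p
      rw [h.blank_mem i hi le_rfl p]
      simp
    · simp [Op.eval, h.r12]
    · simp [Op.eval, h.r12, h.r0]

theorem hostReg_inj {i i' a a' : ℕ} (hi : i < e.W) (hi' : i' < e.W)
    (h : hostReg e.W i a = hostReg e.W i' a') : a = a' ∧ i = i' := by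
  unfold hostReg at h
  exact cell_inj (e := e) hi hi' (by omega)

/-- Each run has its own registers and its own memory region, blank until then, so nothing has to be
cleared between runs and a simulation cannot disturb the input, the table or later runs. Outputs are
below `B'`, so the bounds `i * B'` on the accumulators keep them below `B`. -/
theorem triple_phase (hf : e.Fits) {i : ℕ} (hi : i < e.R) {lab : ℕ → ℕ} {pos neg : ℕ}
    (hlab : ∀ j < e.m, ∀ i' < e.k, lab (e.vtx j i') < e.m * e.Q) {u : Run} (hu : e.Suits u)
    (hpos : pos ≤ i * e.B') (hneg : neg ≤ i * e.B') {P : Program} {T y : ℕ}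
    (hP : ComputesWithin P (u.input e.m fun j i' => lab (e.vtx j i')) e.B' T y) :
    Triple e.B (phaseCost e.k u * (e.m + 1) + 3 * T) (phase P e.k e.W i u)
      (fun r μ => e.Base i i pos neg r μ ∧ e.Table lab μ)
      (fun r μ => e.Base (i + 1) (i + 1) (if u.positive then pos + y else pos)
        (if u.positive then neg else neg + y) r μ ∧ e.Table lab μ) := by
  have hiW : i < e.W := by unfold W; omega
  have hiW' : i + 1 < e.W := by unfold W; omega
  have hL := hu.length
  set pre := u.pre.map fun p => p.1 * e.m + p.2 with hpre
  set bod : ℕ → List ℕ := fun j => u.body.map (Term.eval j fun i' => lab (e.vtx j i')) with hbod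
  have hlen : ∀ j, (pre ++ (List.range j).flatMap bod).length =
      u.pre.length + j * u.body.length := fun j => by
    simp [hpre, hbod, List.length_flatMap]
  -- writing the first part of the input
  have h1 : Triple e.B
      (phaseInit i ++ (u.pre.flatMap (fun p => emitAffine 4 p.1 p.2) ++ cursorInit)).length
      (Code.block (phaseInit i ++ (u.pre.flatMap (fun p => emitAffine 4 p.1 p.2) ++ cursorInit)))
      (fun r μ => e.Base i i pos neg r μ ∧ e.Table lab μ)
      (fun r μ => e.Emitting lab i pos neg (pre ++ (List.range 0).flatMap bod) r μ ∧
        e.Cursor 0 r) := by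
    refine triple_block ?_
    rintro r μ ⟨hb, ht⟩
    rw [wp_append]
    refine wp_mono ?_ _ _ _ (wp_phaseInit hf hi hb ht)
    intro r₁ μ₁ h₁
    rw [wp_append]
    refine wp_mono ?_ _ _ _ (wp_emit_pre hf hi u.pre [] r₁ μ₁ hu.pre
      (by rw [List.length_nil]; omega) h₁)
    intro r₂ μ₂ h₂
    refine wp_cursorInit hf h₂.base.r0 h₂.base.r4 fun r₃ hc hr₃ => ⟨?_, hc⟩
    have := h₂.congr_reg (fun q _ h5 h6 h7 => hr₃ q h5 h6 h7)
    simpa using this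
  -- writing the copies of the body
  have h2 : Triple e.B (e.m * ((u.body.flatMap Term.emit ++ cursorStep e.k).length + 2) + 1)
      ((Code.block (u.body.flatMap Term.emit ++ cursorStep e.k)).loop 5)
      (fun r μ => e.Emitting lab i pos neg (pre ++ (List.range 0).flatMap bod) r μ ∧ e.Cursor 0 r)
      (fun r μ => e.Emitting lab i pos neg (pre ++ (List.range e.m).flatMap bod) r μ ∧
        e.Cursor e.m r) := by
    refine Triple.loop (I := fun j r μ =>
      e.Emitting lab i pos neg (pre ++ (List.range j).flatMap bod) r μ ∧ e.Cursor j r)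
      (fun j hj => triple_block ?_) ?_
    · rintro r μ ⟨h, hc⟩
      rw [wp_append]
      have hle : u.pre.length + (j + 1) * u.body.length ≤ e.L :=
        (Nat.add_le_add_left (Nat.mul_le_mul_right _ hj) _).trans hL
      refine wp_mono ?_ _ _ _ (wp_emit_body hf hi hj (hlab j hj) u.body _ r μ hu.body ?_ h hc)
      · rintro r₁ μ₁ ⟨h₁, hc₁⟩
        refine wp_cursorStep hf hj hc₁ fun r₂ hc₂ hr₂ => ⟨?_, hc₂⟩
        have := h₁.congr_reg hr₂
        simpa [List.range_succ, hbod] using this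
      · rw [hlen]
        rw [Nat.add_mul] at hle
        omega
    · rintro j hj r μ ⟨h, hc⟩
      exact ⟨hc.r5, h.base.r0⟩
  -- the simulation
  have h3 : Triple e.B (3 * T) (Code.simulate (hostReg e.W i) P)
      (fun r μ => e.Emitting lab i pos neg (pre ++ (List.range e.m).flatMap bod) r μ ∧
        e.Cursor e.m r)
      (fun r μ => (e.Base (i + 1) (i + 1) pos neg r μ ∧ e.Table lab μ) ∧
        r (hostReg e.W i 0) = y) := by
    refine (triple_simulate (base := e.Z + (i + 1)) (W := e.W)
      (J := fun r μ => e.Base (i + 1) (i + 1) pos neg r μ ∧ e.Table lab μ)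
      (fun a a' h => (hostReg_inj hiW hiW h).1) (fun a => by unfold hostReg; omega) hP ?_ pos_W ?_
      ?_).mono le_rfl ?_ fun _ _ h => h
    · have h1 := hf.mem_le
      have : 1 * e.B' ≤ e.W * (e.n + e.B' + e.L + 2) := Nat.mul_le_mul pos_W (by omega)
      omega
    · have h1 := hf.mem_le
      have : e.W * (e.B' + 1) ≤ e.W * (e.n + e.B' + e.L + 2) :=
        Nat.mul_le_mul_left _ (by omega)
      rw [Nat.mul_add] at this
      omega
    · rintro r μ r' μ' ⟨hb, ht⟩ - - hr hμ
      refine ⟨hb.congr_of_blank (fun q hq hqs => ?_) (fun q hq => ?_) (fun i' hi' hh a => ?_)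
        fun i' hi' hh a => ?_, fun j hj i' hi' => ?_⟩
      · simp only [scratch, Finset.mem_insert, Finset.mem_singleton, not_or] at hqs
        exact hr q (by tauto) fun a => by unfold hostReg; omega
      · exact hμ q fun a => by omega
      · rw [hr _ (by omega) fun a' => ?_, hb.blank_reg i' hi' hh a]
        intro hh'
        have := (hostReg_inj (e := e) (i := i') (a := a) (by unfold W; omega) hiW hh').2
        omega
      · rw [hμ _ fun a' => ?_, hb.blank_mem i' hi' hh a]
        intro hh'
        have := (cell_inj (e := e) (d := i + 1) (c := a') (by unfold W; omega) hiW'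
          (hh'.trans (by ring))).2
        omega
      · rw [hμ _ fun a' => ?_, ht j hj i' hi']
        intro hh'
        have := (cell_inj (e := e) (b := 0) (d := i + 1) (c := a') pos_W hiW'
          (hh'.trans (by ring))).2
        omega
    · rintro r μ ⟨h, -⟩
      refine ⟨⟨?_, h.table⟩, h.base.r1, h.r2, h.base.blank_reg i hi le_rfl, fun a => ?_⟩
      · exact h.base.congr_of_blank (fun _ _ _ => rfl) (fun _ _ => rfl)
          (fun i' hi' hh => h.base.blank_reg i' hi' (by omega)) h.base.blank_mem
      · rw [show e.Z + (i + 1) + e.W * a = e.Z + e.W * a + (i + 1) by ring, h.out a]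
        rfl
  -- the accumulation
  have h4 : Triple e.B 1
      (Code.block [.op .add (accumulator u) (accumulator u) (hostReg e.W i 0)])
      (fun r μ => (e.Base (i + 1) (i + 1) pos neg r μ ∧ e.Table lab μ) ∧
        r (hostReg e.W i 0) = y)
      (fun r μ => e.Base (i + 1) (i + 1) (if u.positive then pos + y else pos)
        (if u.positive then neg else neg + y) r μ ∧ e.Table lab μ) := by
    refine triple_block ?_
    rintro r μ ⟨⟨hb, ht⟩, rfl⟩
    have hy := hP.lt
    have hB : (i + 1) * e.B' < e.B := by
      have h1 := hf.mem_le
      have h2 : (i + 1) * (e.B' + 1) ≤ e.W * (e.n + e.B' + e.L + 2) :=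
        Nat.mul_le_mul hiW'.le (by omega)
      rw [Nat.mul_add] at h2
      omega
    rw [Nat.add_mul] at hB
    have hu2 : accumulator u = if u.positive then 10 else 11 := rfl
    cases hup : u.positive with
    | true =>
      simp only [hup, if_true] at hu2
      refine ⟨by simp only [Op.eval, hu2, hb.r10]; omega, ⟨?_, ?_, ?_, ?_, ?_, ?_, hb.input, ?_,
        hb.blank_mem⟩, ht⟩
      · simp [hu2, hb.r0]
      · simp [hu2, hb.r1]
      · simp [hu2, hb.r4]
      · simp [hu2, hb.r10, Op.eval]
      · simp [hu2, hb.r11]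
      · simp [hu2, hb.r12]
      · intro i' hi' hh a
        rw [hu2, Function.update_of_ne (by omega), hb.blank_reg i' hi' hh a]
    | false =>
      simp only [hup, Bool.false_eq_true, if_false] at hu2
      refine ⟨by simp only [Op.eval, hu2, hb.r11]; omega, ⟨?_, ?_, ?_, ?_, ?_, ?_, hb.input, ?_,
        hb.blank_mem⟩, ht⟩
      · simp [hu2, hb.r0]
      · simp [hu2, hb.r1]
      · simp [hu2, hb.r4]
      · simp [hu2, hb.r10]
      · simp [hu2, hb.r11, Op.eval]
      · simp [hu2, hb.r12]
      · intro i' hi' hh a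
        rw [hu2, Function.update_of_ne (by omega), hb.blank_reg i' hi' hh a]
  refine (h1.seq (h2.seq (h3.seq h4))).mono ?_ (fun _ _ h => h) fun _ _ h => h
  have hpi : (phaseInit i).length = (phaseInit 0).length := rfl
  simp only [phaseCost, List.length_append, hpi]
  ring_nf
  nlinarith [Nat.zero_le e.m]

/-- The sums of the outputs of the positive and of the negative runs. -/
def signedSum (b : Bool) (y : Run → ℕ) (us : List Run) : ℕ :=
  ((us.filter (·.positive == b)).map y).sum

theorem triple_phases (hf : e.Fits) {lab : ℕ → ℕ}
    (hlab : ∀ j < e.m, ∀ i' < e.k, lab (e.vtx j i') < e.m * e.Q) {P : Program} {T : ℕ}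
    {y : Run → ℕ} :
    ∀ (us : List Run) (i pos neg : ℕ), i + us.length = e.R → (∀ u ∈ us, e.Suits u) →
      (∀ u ∈ us, ComputesWithin P (u.input e.m fun j i' => lab (e.vtx j i')) e.B' T (y u)) →
      pos ≤ i * e.B' → neg ≤ i * e.B' →
      Triple e.B ((us.map (phaseCost e.k)).sum * (e.m + 1) + 3 * T * us.length)
        (phases P e.k e.W i us)
        (fun r μ => e.Base i i pos neg r μ ∧ e.Table lab μ)
        (fun r μ => e.Base e.R e.R (pos + signedSum true y us) (neg + signedSum false y us) r μ ∧
          e.Table lab μ)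
  | [], i, pos, neg, hi, _, _, _, _ => by
    obtain rfl : i = e.R := by simpa using hi
    exact (triple_block (is := []) fun r μ h => by simpa [wp, signedSum] using h).mono (by simp)
      (fun _ _ h => h) fun _ _ h => h
  | u :: us, i, pos, neg, hi, hu, hP, hpos, hneg => by
    rw [List.length_cons] at hi
    have hPu := hP u (by simp)
    have hy := hPu.lt
    have h1 := triple_phase hf (by omega) hlab (hu u (by simp)) hpos hneg hPu
    have h2 := triple_phases hf hlab us (i + 1) (if u.positive then pos + y u else pos)
      (if u.positive then neg else neg + y u) (by omega) (fun v hv => hu v (by simp [hv]))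
      (fun v hv => hP v (by simp [hv])) (by rw [Nat.add_mul]; split_ifs <;> omega)
      (by rw [Nat.add_mul]; split_ifs <;> omega)
    refine (h1.seq h2).mono ?_ (fun _ _ h => h) ?_
    · rw [List.map_cons, List.sum_cons, List.length_cons]
      exact le_of_eq (by ring)
    · rintro r μ ⟨hb, ht⟩
      refine ⟨?_, ht⟩
      cases hup : u.positive <;>
        simpa [signedSum, hup, Nat.add_assoc] using hb

theorem triple_decideSign (hf : e.Fits) {pos neg : ℕ} :
    Triple e.B 4 (Code.block decideSign) (e.Base e.R e.R pos neg)
      (fun r _ => r 0 = if neg < pos then 1 else 0) := by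
  intro P o hP r μ hb h
  have h1 : 1 < e.B := hf.lt_B (by have := hf.three_le; omega)
  have h10 := hb.1 10
  rw [h.r10] at h10
  obtain ⟨r', μ', hQ, hrun⟩ := exists_runsTo_of_wp
    (Q := fun r _ => r 0 = if neg < pos then 1 else 0) decideSign o r μ hP hb (by
      refine ⟨?_, h1, ?_, ?_, ?_⟩
      · simp [Op.eval, h.r10, h.r11]; omega
      · simp [Op.eval, h.r10, h.r11]; omega
      · simp [Op.eval, h.r10, h.r11]; omega
      · simp [Op.eval, h.r10, h.r11, wp]
        split_ifs <;> omega)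
  exact ⟨4, le_rfl, r', μ', hQ, hrun⟩

/-- A labelling of the vertices by their occurrences. -/
def IsLabelling (e : Params) (lab : ℕ → ℕ) : Prop :=
  ∀ j < e.m, ∀ i < e.k, ∃ j' < e.m, ∃ i' < e.k,
    e.vtx j' i' = e.vtx j i ∧ lab (e.vtx j i) = j' * e.Q + i'

theorem IsLabelling.lt (hf : e.Fits) {lab : ℕ → ℕ} (h : e.IsLabelling lab) {j i : ℕ}
    (hj : j < e.m) (hi : i < e.k) : lab (e.vtx j i) < e.m * e.Q := by
  obtain ⟨j', hj', i', hi', -, h'⟩ := h j hj i hi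
  have h1 : (j' + 1) * e.Q ≤ e.m * e.Q := Nat.mul_le_mul_right _ hj'
  have h2 := hf.k_le_Q
  rw [Nat.add_mul] at h1
  omega

/-- The number of steps of the reduction per hyperedge, apart from the simulation. -/
def cost (k Q : ℕ) (us : List Run) : ℕ :=
  (setup k (us.length + 1) ++ cursorInit).length + (labelAll Q k ++ cursorStep k).length +
    (us.map (phaseCost k)).sum + 7

/-- The labelling is produced by the program itself and is known only to exist. Hence the hypothesis
on the simulated runs is required for every labelling, and the outputs `y` may depend on it. -/
theorem computesWithin_reduction (hf : e.Fits) {us : List Run} (hR : e.R = us.length)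
    {x : List ℕ} (hx : e.Loaded (init x).reg (init x).mem) (hxB : ∀ v ∈ x, v < e.B)
    (hu : ∀ u ∈ us, e.Suits u) {P : Program} {T : ℕ} {y : (ℕ → ℕ) → Run → ℕ}
    (hP : ∀ lab, e.IsLabelling lab → ∀ u ∈ us,
      ComputesWithin P (u.input e.m fun j i => lab (e.vtx j i)) e.B' T (y lab u)) :
    ∃ lab, e.IsLabelling lab ∧ ComputesWithin ((reduction P e.k e.Q us).gen 0) x e.B
      (cost e.k e.Q us * (e.m + 1) + 3 * T * us.length : ℕ)
      (if signedSum false (y lab) us < signedSum true (y lab) us then 1 else 0) := by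
  have hW : us.length + 1 = e.W := by rw [Params.W, hR]
  have hpos : 0 < e.B := hf.lt_B (Nat.zero_le _)
  have h1 := triple_block (B := e.B) (is := setup e.k e.W ++ cursorInit) fun r μ =>
    wp_setup (e := e) hf (r := r) (μ := μ)
  have h2 := triple_labelLoop hf
  have h3 : Triple e.B ((us.map (phaseCost e.k)).sum * (e.m + 1) + 3 * T * us.length + 4)
      ((phases P e.k e.W 0 us).seq (Code.block decideSign))
      (fun r μ => e.Base 0 0 0 0 r μ ∧
        e.Labelled (fun v => ∃ j < e.m, ∃ i < e.k, v = e.vtx j i) μ)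
      (fun r _ => ∃ lab, e.IsLabelling lab ∧
        r 0 = if signedSum false (y lab) us < signedSum true (y lab) us then 1 else 0) := by
    intro Q o hQ r μ hb ⟨hbase, hl⟩
    -- The labelling is read off the table in memory once the labelling loop has ended.
    have hlab : e.IsLabelling fun v => μ (e.Z + e.W * v) := fun j hj i hi =>
      hl (e.vtx j i) ⟨j, hj, i, hi, rfl⟩
    have h4 := (triple_phases hf (fun j hj i hi => hlab.lt hf hj hi) us 0 0 0 (by omega) hu
      (hP _ hlab) (by simp) (by simp)).seq ((triple_decideSign hf).mono le_rfl
        (fun _ _ h => h.1) fun _ _ h => h)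
    exact ((h4.mono le_rfl (fun _ _ h => h) fun r _ h => ⟨_, hlab, by simpa using h⟩) :
      Triple _ _ _ _ _) Q o hQ r μ hb ⟨hbase, fun _ _ _ _ => rfl⟩
  have h4 := h1.seq (h2.seq h3)
  have hb : Bounded e.B (init x).reg (init x).mem := by
    refine ⟨fun _ => hpos, fun a => ?_⟩
    change x.getD a 0 < e.B
    by_cases ha : a < x.length
    · rw [List.getD_eq_getElem _ _ ha]; exact hxB _ (List.getElem_mem ha)
    · rwa [List.getD_eq_default _ _ (not_lt.mp ha)]
  rw [reduction, hW]
  obtain ⟨t, ht, r', μ', ⟨lab, hlab, h0⟩, hrun⟩ :=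
    h4 _ 0 (fun i _ => by rw [Nat.zero_add]) _ _ hb hx
  refine ⟨lab, hlab, t, ?_, ?_, ?_, fun i hi a => ?_⟩
  · refine Nat.cast_le.mpr (ht.trans ?_)
    simp only [cost, hW]
    ring_nf
    nlinarith [Nat.zero_le e.m]
  · rw [Code.length_gen]
    change _ ≤ ((step _)^[t] (init x)).pc
    erw [hrun.1]
    simp [Code.seq, Code.block, labelLoop]
  · rw [← h0]
    change ((step _)^[t] (init x)).reg 0 = _
    erw [hrun.1]
  · exact ⟨(hrun.2 i hi).1 a, (hrun.2 i hi).2 a⟩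

end Params

end RAM

/-! ## The hypergraphs of the reduction -/

/-- The number with base-`k` digit `τ a` in place `a < N`. -/
theorem Nat.exists_lt_pow_digit {k N : ℕ} {τ : ℕ → ℕ} (hτ : ∀ a < N, τ a < k) :
    ∃ s < k ^ N, ∀ a < N, s / k ^ a % k = τ a := by
  refine ⟨finFunctionFinEquiv fun a : Fin N => ⟨τ a, hτ a a.2⟩, Fin.is_lt _, fun a ha => ?_⟩
  have h := congrFun (finFunctionFinEquiv.symm_apply_apply fun a : Fin N =>
    (⟨τ a, hτ a a.2⟩ : Fin k)) ⟨a, ha⟩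
  exact congrArg Fin.val h

/-- Inclusion-exclusion: after exchanging the sums, `x` contributes the alternating sum over all `F`
between `J x` and `E`, which vanishes unless `J x = E`. Passing to complements in `E` turns it into
a sum over a full powerset. -/
theorem Finset.sum_neg_one_pow_mul_card_filter_subset {ι κ : Type*} [DecidableEq κ]
    (X : Finset ι) (E : Finset κ) (J : ι → Finset κ) (hJ : ∀ x ∈ X, J x ⊆ E) :
    ∑ F ∈ E.powerset, (-1 : ℤ) ^ (E \ F).card * ((X.filter fun x => J x ⊆ F).card : ℤ) =
      ((X.filter fun x => J x = E).card : ℤ) := by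
  simp only [Finset.card_filter, Nat.cast_sum, Finset.mul_sum]
  rw [Finset.sum_comm]
  refine Finset.sum_congr rfl fun x hx => ?_
  have h1 : ∑ F ∈ E.powerset, (-1 : ℤ) ^ (E \ F).card * ((if J x ⊆ F then 1 else 0 : ℕ) : ℤ) =
      ∑ F ∈ (E \ J x).powerset, (-1 : ℤ) ^ F.card := by
    simp only [Nat.cast_ite, Nat.cast_one, Nat.cast_zero, mul_ite, mul_one, mul_zero]
    rw [← Finset.sum_filter]
    refine Finset.sum_nbij' (fun F => E \ F) (fun F => E \ F) ?_ ?_ ?_ ?_ ?_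
    · intro F hF
      rw [Finset.mem_filter] at hF
      exact Finset.mem_powerset.mpr (Finset.sdiff_subset_sdiff le_rfl hF.2)
    · intro F hF
      have hF := Finset.mem_powerset.mp hF
      refine Finset.mem_filter.mpr ⟨Finset.mem_powerset.mpr Finset.sdiff_subset, fun a ha => ?_⟩
      exact Finset.mem_sdiff.mpr ⟨hJ x hx ha, fun h => (Finset.mem_sdiff.mp (hF h)).2 ha⟩
    · intro F hF
      exact Finset.sdiff_sdiff_eq_self (Finset.mem_powerset.mp (Finset.mem_filter.mp hF).1)
    · intro F hF
      exact Finset.sdiff_sdiff_eq_self ((Finset.mem_powerset.mp hF).trans Finset.sdiff_subset)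
    · intro F _
      rfl
  rw [h1, Finset.sum_powerset_neg_one_pow_card]
  by_cases h : J x = E
  · simp [h]
  · have : ¬ E \ J x = ∅ := fun h' =>
      h (Finset.Subset.antisymm (hJ x hx) (Finset.sdiff_eq_empty_iff_subset.mp h'))
    simp [h, this]

namespace Hypergraph

variable {α : Type*}

/-- The data of the reduction that depend on the pattern only: the core `C` of an obstruction inside
`S`, the number `N` of vertices, a numbering `idx` of them, the arity `k`, and for every vertex `v`
of `S` outside the core a vertex `miss v` of the core that is not adjacent to the component of
`v`. -/
structure Gadget (α : Type*) where
  (S C : Set α)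
  (N k : ℕ)
  (idx : α → ℕ)
  (miss : α → α)

namespace Gadget

/-- The number of copies of a component for one hyperedge of the input. -/
def Q (D : Gadget α) : ℕ := D.k ^ D.N

/-- The assignment of places in a hyperedge to vertices that is coded by `s`. -/
def slot (D : Gadget α) (s : ℕ) (v : α) : ℕ := s / D.k ^ D.idx v % D.k

/-- The gadget fits the pattern `H`. -/
structure Valid (D : Gadget α) (l : ℕ∞) (H : Hypergraph α) : Prop where
  idx_inj : Set.InjOn D.idx H.vertexSet
  idx_lt : ∀ v ∈ H.vertexSet, D.idx v < D.N
  core_subset : D.C ⊆ D.S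
  subset : D.S ⊆ H.vertexSet
  two_le : 2 ≤ D.k
  card_core : D.C.ncard = D.k + 1
  core_small : ∀ e ∈ H.edgeSet, ((e ∩ D.S) \ D.C).encard ≤ l → ((e ∩ D.S) ∩ D.C).encard ≤ 1
  miss_mem : ∀ d ∈ D.S \ D.C, D.miss d ∈ D.C
  miss_notMem : ∀ e ∈ H.edgeSet, ∀ d ∈ e ∩ (D.S \ D.C), D.miss d ∉ e
  miss_eq : ∀ e ∈ H.edgeSet, ∀ d ∈ e ∩ (D.S \ D.C), ∀ d' ∈ e ∩ (D.S \ D.C), D.miss d = D.miss d'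
  exists_component : ∀ c ∈ D.C, ∃ K ⊆ D.S \ D.C, (∀ d ∈ K, D.miss d = c) ∧
    (∀ p : α → ℕ, (∀ e ∈ H.edgeSet, ∀ d ∈ e ∩ (D.S \ D.C), ∀ d' ∈ e ∩ (D.S \ D.C), p d = p d') →
      ∀ d ∈ K, ∀ d' ∈ K, p d = p d') ∧
    ∀ c' ∈ D.C \ {c}, ∃ e ∈ H.edgeSet, c' ∈ e ∧ (e ∩ K).Nonempty

open Classical in
/-- The place of the copy of the vertex `v` in the copy of the hyperedge `e` with parameters `s` and
`j`. Here `lb j i` is the label of the `i`-th vertex of the hyperedge number `j`. -/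
noncomputable def place (D : Gadget α) (lb : ℕ → ℕ → ℕ) (e : Set α) (s j : ℕ) (v : α) : ℕ :=
  if v ∈ D.S then if v ∈ D.C ∧ ¬ e ∩ D.S ⊆ D.C then lb j (D.slot s v) else j * D.Q + s else 0

/-- The copy of the hyperedge `e` with parameters `s` and `j`. -/
noncomputable def copy (D : Gadget α) (lb : ℕ → ℕ → ℕ) (e : Set α) (s j : ℕ) : Set ℕ :=
  (fun v => D.N * D.place lb e s j v + D.idx v) '' e

/-- The hyperedge `e` has copies with parameter `s`. -/
def Allowed (D : Gadget α) (e : Set α) (s : ℕ) : Prop :=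
  (e ∩ D.S).Nonempty ∧ ∀ d ∈ e ∩ (D.S \ D.C), Set.InjOn (D.slot s) (D.C \ {D.miss d})

/-- `f` is one of the copies of the hyperedge `e`. -/
def IsCopy (D : Gadget α) (m : ℕ) (lb : ℕ → ℕ → ℕ) (e : Set α) (f : Set ℕ) : Prop :=
  (e ∩ D.S = ∅ ∧ f = D.copy lb e 0 0) ∨
    ∃ j < m, ∃ s < D.Q, D.Allowed e s ∧ f = D.copy lb e s j

/-- The hypergraph formed by the copies of the hyperedges in `F`. -/
def target (D : Gadget α) (m : ℕ) (lb : ℕ → ℕ → ℕ) (F : Set (Set α)) : Hypergraph ℕ where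
  vertexSet := Set.Iio (D.N * (m * D.Q + 1))
  edgeSet := {f | (∃ e ∈ F, D.IsCopy m lb e f) ∧ f ⊆ Set.Iio (D.N * (m * D.Q + 1))}
  subset_vertexSet_of_mem_edgeSet' _ h := h.2

/-- The labels are bounded, and different for different vertices of a hyperedge. -/
structure GoodLabels (D : Gadget α) (m : ℕ) (lb : ℕ → ℕ → ℕ) : Prop where
  lt : ∀ j < m, ∀ i < D.k, lb j i < m * D.Q
  inj : ∀ j < m, Set.InjOn (lb j) (Set.Iio D.k)

section

variable {D : Gadget α} {l : ℕ∞} {H : Hypergraph α} {m : ℕ} {lb : ℕ → ℕ → ℕ}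

theorem Valid.finite (hD : D.Valid l H) : H.vertexSet.Finite :=
  Set.Finite.of_finite_image ((Set.finite_Iio D.N).subset
    (by rintro _ ⟨v, hv, rfl⟩; exact hD.idx_lt v hv)) hD.idx_inj

theorem Valid.mem_vertexSet (_hD : D.Valid l H) {e : Set α} (he : e ∈ H.edgeSet) {v : α}
    (hv : v ∈ e) : v ∈ H.vertexSet := H.subset_vertexSet_of_mem_edgeSet' he hv

theorem Valid.idx_eq (hD : D.Valid l H) {e e' : Set α} (he : e ∈ H.edgeSet)
    (he' : e' ∈ H.edgeSet) {v w : α} (hv : v ∈ e) (hw : w ∈ e') (h : D.idx v = D.idx w) : v = w :=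
  hD.idx_inj (hD.mem_vertexSet he hv) (hD.mem_vertexSet he' hw) h

theorem Valid.mod_eq (hD : D.Valid l H) {v : α} (hv : v ∈ H.vertexSet) (p : ℕ) :
    (D.N * p + D.idx v) % D.N = D.idx v := by
  rw [Nat.mul_add_mod, Nat.mod_eq_of_lt (hD.idx_lt v hv)]

theorem Valid.div_eq (hD : D.Valid l H) {v : α} (hv : v ∈ H.vertexSet) (p : ℕ) :
    (D.N * p + D.idx v) / D.N = p := by
  have := hD.idx_lt v hv
  rw [Nat.mul_add_div (by omega), Nat.div_eq_of_lt this, Nat.add_zero]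

theorem Valid.slot_lt (hD : D.Valid l H) (s : ℕ) (v : α) : D.slot s v < D.k :=
  Nat.mod_lt _ (by have := hD.two_le; omega)

theorem Valid.Q_pos (hD : D.Valid l H) : 0 < D.Q :=
  Nat.pow_pos (by have := hD.two_le; omega)

theorem Valid.finite_core (hD : D.Valid l H) : D.C.Finite :=
  hD.finite.subset (hD.core_subset.trans hD.subset)

theorem index_lt {Q j s : ℕ} (hj : j < m) (hs : s < Q) : j * Q + s < m * Q := by
  have : (j + 1) * Q ≤ m * Q := Nat.mul_le_mul_right _ hj
  rw [Nat.add_mul] at this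
  omega

theorem index_inj {Q j j' s s' : ℕ} (hs : s < Q) (hs' : s' < Q)
    (h : j * Q + s = j' * Q + s') : j = j' ∧ s = s' := by
  have hQ : 0 < Q := by omega
  have h1 : (Q * j + s) % Q = (Q * j' + s') % Q := by rw [Nat.mul_comm Q, h, Nat.mul_comm]
  rw [Nat.mul_add_mod, Nat.mul_add_mod, Nat.mod_eq_of_lt hs, Nat.mod_eq_of_lt hs'] at h1
  subst h1
  exact ⟨Nat.eq_of_mul_eq_mul_right hQ (by omega), rfl⟩

theorem IsCopy.eq_copy {e : Set α} {f : Set ℕ} (h : D.IsCopy m lb e f) :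
    ∃ s j, f = D.copy lb e s j := by
  rcases h with ⟨-, rfl⟩ | ⟨j, -, s, -, -, rfl⟩
  · exact ⟨_, _, rfl⟩
  · exact ⟨_, _, rfl⟩

/-- The residue of a target vertex modulo `N` is its colour, the index of a vertex of `H`. A copy
carries exactly the colours of its hyperedge, so it is a copy of no other hyperedge. -/
theorem Valid.color_image (hD : D.Valid l H) {e : Set α} (he : e ∈ H.edgeSet) {f : Set ℕ}
    (h : D.IsCopy m lb e f) : (· % D.N) '' f = D.idx '' e := by
  obtain ⟨s, j, rfl⟩ := h.eq_copy
  rw [copy, Set.image_image]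
  exact Set.image_congr fun v hv => hD.mod_eq (hD.mem_vertexSet he hv) _

theorem Valid.isCopy_unique (hD : D.Valid l H) {e e' : Set α} (he : e ∈ H.edgeSet)
    (he' : e' ∈ H.edgeSet) {f : Set ℕ} (h : D.IsCopy m lb e f) (h' : D.IsCopy m lb e' f) :
    e = e' := by
  have := (hD.color_image he h).symm.trans (hD.color_image he' h')
  exact (hD.idx_inj.image_eq_image_iff (H.subset_vertexSet_of_mem_edgeSet' he)
    (H.subset_vertexSet_of_mem_edgeSet' he')).mp this

theorem place_of_notMem {e : Set α} {s j : ℕ} {v : α} (hv : v ∉ D.S) : D.place lb e s j v = 0 := by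
  simp [place, hv]

theorem place_of_notMem_core {e : Set α} {s j : ℕ} {v : α} (hv : v ∈ D.S \ D.C) :
    D.place lb e s j v = j * D.Q + s := by
  simp [place, hv.1, hv.2]

theorem place_of_subset {e : Set α} {s j : ℕ} {v : α} (hv : v ∈ D.S) (he : e ∩ D.S ⊆ D.C) :
    D.place lb e s j v = j * D.Q + s := by
  simp [place, hv, he]

theorem Valid.place_of_mem_core (hD : D.Valid l H) {e : Set α} {s j : ℕ} {v d : α} (hv : v ∈ D.C)
    (hd : d ∈ e ∩ (D.S \ D.C)) : D.place lb e s j v = lb j (D.slot s v) := by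
  have : ¬ e ∩ D.S ⊆ D.C := fun h => hd.2.2 (h ⟨hd.1, hd.2.1⟩)
  simp [place, hv, hD.core_subset hv, this]

theorem Valid.place_le (hD : D.Valid l H) (hl : D.GoodLabels m lb) {e : Set α} {s j : ℕ}
    (hj : j < m) (hs : s < D.Q) (v : α) : D.place lb e s j v < m * D.Q + 1 := by
  unfold place
  split_ifs with h1 h2
  · exact (hl.lt j hj _ (hD.slot_lt s v)).trans (Nat.lt_succ_self _)
  · exact (index_lt hj hs).trans (Nat.lt_succ_self _)
  · omega

theorem vertex_lt {N p i M : ℕ} (hi : i < N) (hp : p < M) : N * p + i < N * M := by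
  have : N * (p + 1) ≤ N * M := Nat.mul_le_mul_left _ hp
  rw [Nat.mul_add] at this
  omega

theorem Valid.copy_subset (hD : D.Valid l H) (hl : D.GoodLabels m lb) {e : Set α}
    (he : e ∈ H.edgeSet) {f : Set ℕ} (h : D.IsCopy m lb e f) :
    f ⊆ Set.Iio (D.N * (m * D.Q + 1)) := by
  rcases h with ⟨h0, rfl⟩ | ⟨j, hj, s, hs, -, rfl⟩
  · rintro _ ⟨v, hv, rfl⟩
    refine vertex_lt (hD.idx_lt v (hD.mem_vertexSet he hv)) ?_
    have : v ∉ D.S := fun h => (h0 ▸ (⟨hv, h⟩ : v ∈ e ∩ D.S) : v ∈ (∅ : Set α))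
    rw [place_of_notMem this]
    omega
  · rintro _ ⟨v, hv, rfl⟩
    exact vertex_lt (hD.idx_lt v (hD.mem_vertexSet he hv)) (hD.place_le hl hj hs v)

theorem Valid.mem_target (hD : D.Valid l H) (hl : D.GoodLabels m lb) {F : Set (Set α)}
    (hF : F ⊆ H.edgeSet) {f : Set ℕ} :
    f ∈ (D.target m lb F).edgeSet ↔ ∃ e ∈ F, D.IsCopy m lb e f :=
  ⟨fun h => h.1, fun ⟨e, he, h⟩ => ⟨⟨e, he, h⟩, hD.copy_subset hl (hF he) h⟩⟩

/-! ### Degeneracy -/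

/-- The hyperedges through `v` are subsets of a union that contains each residue modulo `N` at most
once, hence has at most `N` elements. -/
theorem _root_.Hypergraph.degree_le_two_pow {G : Hypergraph ℕ} {N v : ℕ} (hN : 0 < N)
    (h : ∀ f₁ ∈ G.edgeSet, v ∈ f₁ → ∀ f₂ ∈ G.edgeSet, v ∈ f₂ → ∀ u₁ ∈ f₁, ∀ u₂ ∈ f₂,
      u₁ % N = u₂ % N → u₁ = u₂) : G.degree v ≤ 2 ^ N := by
  set 𝓕 := {e | e ∈ G.edgeSet ∧ v ∈ e} with h𝓕
  have hinj : Set.InjOn (· % N) (⋃₀ 𝓕) := by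
    rintro u₁ ⟨f₁, hf₁, hu₁⟩ u₂ ⟨f₂, hf₂, hu₂⟩ hu
    exact h f₁ hf₁.1 hf₁.2 f₂ hf₂.1 hf₂.2 u₁ hu₁ u₂ hu₂ hu
  have hmaps : ∀ u ∈ ⋃₀ 𝓕, u % N ∈ Set.Iio N := fun u _ => Nat.mod_lt u hN
  have hfin : (⋃₀ 𝓕).Finite :=
    Set.Finite.of_finite_image ((Set.finite_Iio N).subset (Set.image_subset_iff.mpr hmaps)) hinj
  have hcard : (⋃₀ 𝓕).ncard ≤ N := by
    have := Set.ncard_le_ncard_of_injOn (· % N) hmaps hinj (Set.finite_Iio N)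
    simpa [Set.ncard_eq_toFinset_card'] using this
  calc G.degree v = 𝓕.ncard := rfl
    _ ≤ (𝒫 ⋃₀ 𝓕).ncard :=
        Set.ncard_le_ncard (fun f hf => Set.subset_sUnion_of_mem hf) hfin.powerset
    _ = 2 ^ (⋃₀ 𝓕).ncard := Set.ncard_powerset _ hfin
    _ ≤ 2 ^ N := Nat.pow_le_pow_right (by omega) hcard

theorem Valid.N_pos (hD : D.Valid l H) : 0 < D.N := by
  obtain ⟨c, hc⟩ : D.C.Nonempty := by
    rw [← Set.ncard_pos hD.finite_core, hD.card_core]; omega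
  exact (Nat.zero_le _).trans_lt (hD.idx_lt c (hD.subset (hD.core_subset hc)))

theorem Valid.mem_copy (hD : D.Valid l H) {e : Set α} (he : e ∈ H.edgeSet) {s j u : ℕ} {v : α}
    (hv : v ∈ H.vertexSet) (hu : u ∈ D.copy lb e s j) (hc : u % D.N = D.idx v) :
    v ∈ e ∧ u = D.N * D.place lb e s j v + D.idx v := by
  obtain ⟨w, hw, rfl⟩ := hu
  simp only at hc ⊢
  rw [hD.mod_eq (hD.mem_vertexSet he hw)] at hc
  have := hD.idx_inj (hD.mem_vertexSet he hw) hv hc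
  subst this
  exact ⟨hw, rfl⟩

/-- In every nonempty `T` a vertex is found whose surviving neighbours are determined by their
colours. A vertex with colour in `S \ C` is preferred, then one with colour in `C`, then any vertex.
-/
theorem Valid.degeneracy_target_le (hD : D.Valid l H) (F : Set (Set α)) (hF : F ⊆ H.edgeSet) :
    degeneracy l (D.target m lb F) ≤ 2 ^ D.N := by
  refine Nat.sInf_le fun T _ hT => ?_
  -- A vertex with colour in `S \ C` has place `j * Q + s`, which fixes `j` and `s` and with them
  -- the place of every vertex in a copy through it.
  by_cases h1 : ∃ u ∈ T, ∃ d ∈ D.S \ D.C, u % D.N = D.idx d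
  · obtain ⟨u, hu, d, hd, hud⟩ := h1
    have hdV := hD.subset hd.1
    refine ⟨u, hu, degree_le_two_pow hD.N_pos ?_⟩
    have key : ∀ f ∈ ((D.target m lb F).trim T l).edgeSet, u ∈ f → ∃ e ∈ H.edgeSet, d ∈ e ∧
        ∃ j s, s < D.Q ∧ j * D.Q + s = u / D.N ∧ f ⊆ D.copy lb e s j := by
      rintro _ ⟨-, e', ⟨⟨e, he, hcop⟩, -⟩, -, rfl⟩ hue
      refine ⟨e, hF he, ?_⟩
      rcases hcop with ⟨h0, rfl⟩ | ⟨j, hj, s, hs, -, rfl⟩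
      · have := (hD.mem_copy (hF he) hdV hue.1 hud).1
        exact absurd (show d ∈ e ∩ D.S from ⟨this, hd.1⟩) (by simp [h0])
      · obtain ⟨hde, hu'⟩ := hD.mem_copy (hF he) hdV hue.1 hud
        refine ⟨hde, j, s, hs, ?_, Set.inter_subset_left⟩
        rw [hu', hD.div_eq hdV, place_of_notMem_core hd]
    intro f₁ hf₁ hu₁ f₂ hf₂ hu₂ u₁ h₁ u₂ h₂ h12
    obtain ⟨e₁, he₁, hd₁, j₁, s₁, hs₁, hj₁, hsub₁⟩ := key f₁ hf₁ hu₁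
    obtain ⟨e₂, he₂, hd₂, j₂, s₂, hs₂, hj₂, hsub₂⟩ := key f₂ hf₂ hu₂
    obtain ⟨rfl, rfl⟩ := index_inj hs₁ hs₂ (hj₁.trans hj₂.symm)
    obtain ⟨v, hv, rfl⟩ := hsub₁ h₁
    have hvV := hD.mem_vertexSet he₁ hv
    simp only at h12 ⊢
    rw [hD.mod_eq hvV] at h12
    rw [(hD.mem_copy he₂ hvV (hsub₂ h₂) h12.symm).2]
    by_cases hvS : v ∈ D.S
    · by_cases hvC : v ∈ D.C
      · rw [hD.place_of_mem_core hvC ⟨hd₁, hd⟩, hD.place_of_mem_core hvC ⟨hd₂, hd⟩]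
      · rw [place_of_notMem_core ⟨hvS, hvC⟩, place_of_notMem_core ⟨hvS, hvC⟩]
    · rw [place_of_notMem hvS, place_of_notMem hvS]
  -- No vertex of `T` has a colour in `S \ C` any more. It will turn out that a surviving hyperedge
  -- has at most one vertex with core colour; its other vertices in `T` lie outside `S` and have
  -- place `0`.
  by_cases h2 : ∃ u ∈ T, ∃ c ∈ D.C, u % D.N = D.idx c
  · obtain ⟨u, hu, c, hc, huc⟩ := h2
    have hcV := hD.subset (hD.core_subset hc)
    refine ⟨u, hu, degree_le_two_pow hD.N_pos ?_⟩
    have key : ∀ f ∈ ((D.target m lb F).trim T l).edgeSet, u ∈ f → ∀ u₁ ∈ f,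
        u₁ = if u₁ % D.N = D.idx c then u else u₁ % D.N := by
      rintro _ ⟨-, e', ⟨⟨e, he, hcop⟩, -⟩, hle, rfl⟩ hue u₁ hu₁
      obtain ⟨s, j, hcopy⟩ := hcop.eq_copy
      have huM := hue.1
      have hu₁M := hu₁.1
      rw [hcopy] at huM hu₁M
      obtain ⟨hce, hu'⟩ := hD.mem_copy (hF he) hcV huM huc
      split_ifs with hif
      · rw [(hD.mem_copy (hF he) hcV hu₁M hif).2, hu']
      obtain ⟨w, hw, rfl⟩ := hu₁M
      have hwV := hD.mem_vertexSet (hF he) hw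
      simp only at hif hu₁ ⊢
      rw [hD.mod_eq hwV] at hif ⊢
      have hwc : w ≠ c := fun h => hif (h ▸ rfl)
      by_cases hwS : w ∈ D.S
      · exfalso
        have hwC : w ∈ D.C := by
          by_contra hwC
          exact h1 ⟨_, hu₁.2, w, ⟨hwS, hwC⟩, hD.mod_eq hwV _⟩
        -- All vertices of the copy with colours in `S \ C` were trimmed away, so there are at most
        -- `l` of them. They have distinct colours, so `e` has at most `l` vertices in `S \ C`, and
        -- the condition on the core applies.
        have hsmall : ((e ∩ D.S) \ D.C).encard ≤ l := by
          refine le_trans ?_ hle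
          have hinj : Set.InjOn (fun v => D.N * D.place lb e s j v + D.idx v)
              ((e ∩ D.S) \ D.C) := fun v hv v' hv' h => by
            have h' := congrArg (· % D.N) h
            simp only at h'
            rw [hD.mod_eq (hD.mem_vertexSet (hF he) hv.1.1),
              hD.mod_eq (hD.mem_vertexSet (hF he) hv'.1.1)] at h'
            exact hD.idx_eq (hF he) (hF he) hv.1.1 hv'.1.1 h'
          rw [← hinj.encard_image]
          refine Set.encard_le_encard ?_
          rintro _ ⟨v, hv, rfl⟩
          refine ⟨hcopy ▸ ⟨v, hv.1.1, rfl⟩, fun hT' => h1 ⟨_, hT', v, ⟨hv.1.2, hv.2⟩, ?_⟩⟩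
          exact hD.mod_eq (hD.mem_vertexSet (hF he) hv.1.1) _
        exact hwc (Set.encard_le_one_iff.mp (hD.core_small e (hF he) hsmall) w c
          ⟨⟨hw, hwS⟩, hwC⟩ ⟨⟨hce, hD.core_subset hc⟩, hc⟩)
      · rw [place_of_notMem hwS, Nat.mul_zero, Nat.zero_add]
    intro f₁ hf₁ hu₁ f₂ hf₂ hu₂ u₁ h₁ u₂ h₂ h12
    rw [key f₁ hf₁ hu₁ u₁ h₁, key f₂ hf₂ hu₂ u₂ h₂, h12]
  · obtain ⟨u, hu⟩ := hT
    refine ⟨u, hu, degree_le_two_pow hD.N_pos ?_⟩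
    have key : ∀ f ∈ ((D.target m lb F).trim T l).edgeSet, ∀ u₁ ∈ f, u₁ = u₁ % D.N := by
      rintro _ ⟨-, e', ⟨⟨e, he, hcop⟩, -⟩, hle, rfl⟩ u₁ hu₁
      obtain ⟨s, j, rfl⟩ := hcop.eq_copy
      obtain ⟨⟨w, hw, rfl⟩, hwT⟩ := hu₁
      have hwV := hD.mem_vertexSet (hF he) hw
      simp only at hwT ⊢
      have hwS : w ∉ D.S := fun hwS => by
        by_cases hwC : w ∈ D.C
        · exact h2 ⟨_, hwT, w, hwC, hD.mod_eq hwV _⟩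
        · exact h1 ⟨_, hwT, w, ⟨hwS, hwC⟩, hD.mod_eq hwV _⟩
      rw [hD.mod_eq hwV, place_of_notMem hwS, Nat.mul_zero, Nat.zero_add]
    intro f₁ hf₁ _ f₂ hf₂ _ u₁ h₁ u₂ h₂ h12
    rw [key f₁ hf₁ u₁ h₁, key f₂ hf₂ u₂ h₂, h12]

/-! ### Homomorphisms that respect colors -/

/-- There are labels of `k + 1` vertices of which all `k`-element subsets are hyperedges. -/
def LabelSimplex (D : Gadget α) (m : ℕ) (lb : ℕ → ℕ → ℕ) : Prop :=
  ∃ p : α → ℕ, ∀ c ∈ D.C, ∃ j < m, ∃ σ : α → ℕ, Set.InjOn σ (D.C \ {c}) ∧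
    ∀ c' ∈ D.C \ {c}, σ c' < D.k ∧ p c' = lb j (σ c')

/-- For `c` take the component `K` whose connector covers `C \ {c}`. The places are constant on `K`,
so all hyperedges of `H` meeting `K` use the same pair `(j, s)`, and the vertices of `C \ {c}`
receive labels from the single input hyperedge `j`. Injectivity comes from `Allowed`, because `K`
misses `c`. -/
theorem Valid.labelSimplex_of_places (hD : D.Valid l H) {p : α → ℕ}
    (hp : ∀ e ∈ H.edgeSet, (e ∩ D.S).Nonempty → ∃ j < m, ∃ s < D.Q, D.Allowed e s ∧
      ∀ v ∈ e, p v = D.place lb e s j v) : D.LabelSimplex m lb := by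
  refine ⟨p, fun c hc => ?_⟩
  obtain ⟨K, hK, hmiss, hconn, hcov⟩ := hD.exists_component c hc
  have hconst := hconn p fun e he d hd d' hd' => by
    obtain ⟨j, -, s, -, -, h⟩ := hp e he ⟨d, hd.1, hd.2.1⟩
    rw [h d hd.1, h d' hd'.1, place_of_notMem_core hd.2, place_of_notMem_core hd'.2]
  have hcard : (D.C \ {c}).ncard = D.k := by
    rw [Set.ncard_sdiff_singleton_of_mem hc, hD.card_core, Nat.add_sub_cancel]
  obtain ⟨c₀, hc₀⟩ : (D.C \ {c}).Nonempty := by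
    rw [← Set.ncard_pos (hD.finite_core.subset Set.sdiff_subset), hcard]
    have := hD.two_le
    omega
  obtain ⟨e₀, he₀, -, d₀, hd₀⟩ := hcov c₀ hc₀
  obtain ⟨j, hj, s, hs, hall, h⟩ := hp e₀ he₀ ⟨d₀, hd₀.1, (hK hd₀.2).1⟩
  have hpd := h d₀ hd₀.1
  rw [place_of_notMem_core (hK hd₀.2)] at hpd
  refine ⟨j, hj, D.slot s, ?_, fun c' hc' => ⟨hD.slot_lt s c', ?_⟩⟩
  · have := hall.2 d₀ ⟨hd₀.1, hK hd₀.2⟩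
    rwa [hmiss d₀ hd₀.2] at this
  · obtain ⟨e, he, hce, d, hd⟩ := hcov c' hc'
    obtain ⟨j', hj', s', hs', -, h'⟩ := hp e he ⟨d, hd.1, (hK hd.2).1⟩
    have hpd' := h' d hd.1
    rw [place_of_notMem_core (hK hd.2), hconst d hd.2 d₀ hd₀.2, hpd] at hpd'
    -- Equal places on `K` force equal parameters, so the covering hyperedge of `c'` uses the same
    -- `j` and `s` as that of `c₀`.
    obtain ⟨rfl, rfl⟩ := index_inj hs hs' hpd'
    rw [h' c' hce, hD.place_of_mem_core hc'.1 ⟨hd.1, hK hd.2⟩]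

/-- Core vertices go to their labels, and a vertex `d` of `S \ C` goes to the parameters of the
input hyperedge opposite to `miss d`. This is consistent on a hyperedge `e` through `d`: its
vertices in `S \ C` share the missed vertex, and its core vertices differ from `miss d`. -/
theorem Valid.exists_places (hD : D.Valid l H) (hl : D.GoodLabels m lb)
    (h : D.LabelSimplex m lb) :
    ∃ p : α → ℕ, (∀ v, p v < m * D.Q + 1) ∧ ∀ e ∈ H.edgeSet,
      D.IsCopy m lb e ((fun v => D.N * p v + D.idx v) '' e) := by
  classical
  obtain ⟨p, hp⟩ := h
  have hk := hD.two_le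
  have hp' : ∀ c ∈ D.C, ∃ j < m, ∃ s < D.Q, Set.InjOn (D.slot s) (D.C \ {c}) ∧
      ∀ c' ∈ D.C \ {c}, p c' = lb j (D.slot s c') := by
    intro c hc
    obtain ⟨j, hj, σ, hσ, h⟩ := hp c hc
    -- The assignment `σ` is coded in the digits of `s`; digits not belonging to `C \ {c}` are set
    -- to `0`.
    obtain ⟨s, hs, hs'⟩ := Nat.exists_lt_pow_digit (k := D.k) (N := D.N)
      (τ := fun a => if h : ∃ c' ∈ D.C \ {c}, D.idx c' = a then σ h.choose else 0) (by
        intro a _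
        split_ifs with h'
        · exact (h _ h'.choose_spec.1).1
        · omega)
    have hslot : ∀ c' ∈ D.C \ {c}, D.slot s c' = σ c' := fun c' hc' => by
      have hV : ∀ c' ∈ D.C \ {c}, c' ∈ H.vertexSet := fun c' hc' =>
        hD.subset (hD.core_subset hc'.1)
      have hex : ∃ c'' ∈ D.C \ {c}, D.idx c'' = D.idx c' := ⟨c', hc', rfl⟩
      rw [slot, hs' _ (hD.idx_lt c' (hV c' hc')), dif_pos hex,
        hD.idx_inj (hV _ hex.choose_spec.1) (hV c' hc') hex.choose_spec.2]
    refine ⟨j, hj, s, hs, fun a ha b hb hab => hσ ha hb ?_, fun c' hc' => ?_⟩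
    · rwa [hslot a ha, hslot b hb] at hab
    · rw [hslot c' hc', (h c' hc').2]
  choose! jj hjj ss hss hinj hval using hp'
  -- The hyperedge opposite to another core vertex contains `c` and bounds its label.
  have hpC : ∀ c ∈ D.C, p c < m * D.Q := fun c hc => by
    obtain ⟨c', hc', hne⟩ := Set.exists_ne_of_one_lt_ncard
      (by rw [hD.card_core]; omega : 1 < D.C.ncard) c
    rw [hval c' hc' c ⟨hc, hne.symm⟩]
    exact hl.lt _ (hjj c' hc') _ (hD.slot_lt _ _)
  obtain ⟨q, hq0, hq1, hq2⟩ : ∃ q : α → ℕ, (∀ v ∉ D.S, q v = 0) ∧ (∀ v ∈ D.C, q v = p v) ∧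
      ∀ v ∈ D.S \ D.C, q v = jj (D.miss v) * D.Q + ss (D.miss v) := by
    refine ⟨fun v => if v ∈ D.S then if v ∈ D.C then p v else
      jj (D.miss v) * D.Q + ss (D.miss v) else 0, fun v hv => if_neg hv, fun v hv => ?_,
      fun v hv => ?_⟩
    · simp [hv, hD.core_subset hv]
    · simp [hv.1, hv.2]
  refine ⟨q, fun v => ?_, fun e he => ?_⟩
  · by_cases h1 : v ∈ D.S
    · by_cases h2 : v ∈ D.C
      · rw [hq1 v h2]
        exact (hpC v h2).trans (Nat.lt_succ_self _)
      · have hm := hD.miss_mem v ⟨h1, h2⟩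
        rw [hq2 v ⟨h1, h2⟩]
        exact (index_lt (hjj _ hm) (hss _ hm)).trans (Nat.lt_succ_self _)
    · rw [hq0 v h1]
      omega
  · by_cases h0 : e ∩ D.S = ∅
    · refine Or.inl ⟨h0, Set.image_congr fun v hv => ?_⟩
      have : v ∉ D.S := fun h => (h0 ▸ (⟨hv, h⟩ : v ∈ e ∩ D.S) : v ∈ (∅ : Set α))
      simp only [place_of_notMem this, hq0 v this]
    have hne : (e ∩ D.S).Nonempty := Set.nonempty_iff_ne_empty.mpr h0
    by_cases hC : e ∩ D.S ⊆ D.C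
    · obtain ⟨c, hce, hcS⟩ := hne
      have hcC := hC ⟨hce, hcS⟩
      have hQ := hD.Q_pos
      -- With no vertex in `S \ C` the bound `l` is met trivially, so `e` contains at most one core
      -- vertex `c`. Its label is below `m * Q`, so quotient and remainder modulo `Q` are admissible
      -- parameters.
      have hone := hD.core_small e he (by rw [Set.sdiff_eq_empty.mpr hC]; simp)
      refine Or.inr ⟨p c / D.Q, (Nat.div_lt_iff_lt_mul hQ).mpr (hpC c hcC), p c % D.Q,
        Nat.mod_lt _ hQ, ⟨⟨c, hce, hcS⟩, fun d hd => absurd (hC ⟨hd.1, hd.2.1⟩) hd.2.2⟩,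
        Set.image_congr fun v hv => ?_⟩
      by_cases hvS : v ∈ D.S
      · obtain rfl := Set.encard_le_one_iff.mp hone v c ⟨⟨hv, hvS⟩, hC ⟨hv, hvS⟩⟩
          ⟨⟨hce, hcS⟩, hcC⟩
        simp only [place_of_subset hvS hC, hq1 v hcC, Nat.div_add_mod']
      · simp only [place_of_notMem hvS, hq0 v hvS]
    · obtain ⟨d, hd, hdC⟩ := Set.not_subset.mp hC
      have hd' : d ∈ e ∩ (D.S \ D.C) := ⟨hd.1, hd.2, hdC⟩
      have hm := hD.miss_mem d hd'.2
      refine Or.inr ⟨jj (D.miss d), hjj _ hm, ss (D.miss d), hss _ hm, ⟨hne, fun d₁ hd₁ => ?_⟩,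
        Set.image_congr fun v hv => ?_⟩
      · rw [hD.miss_eq e he d₁ hd₁ d hd']
        exact hinj _ hm
      · by_cases hvS : v ∈ D.S
        · by_cases hvC : v ∈ D.C
          · rw [hq1 v hvC, hD.place_of_mem_core hvC hd', hval _ hm v ⟨hvC, ?_⟩]
            rintro rfl
            exact hD.miss_notMem e he d hd' hv
          · rw [hq2 v ⟨hvS, hvC⟩, place_of_notMem_core ⟨hvS, hvC⟩,
              hD.miss_eq e he v ⟨hv, hvS, hvC⟩ d hd']
        · rw [place_of_notMem hvS, hq0 v hvS]

/-- A map under which the images of the hyperedges are copies of all hyperedges can be permuted to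
one under which the image of every hyperedge is a copy of it. -/
theorem Valid.labelSimplex_of_map (hD : D.Valid l H) {φ : α → ℕ}
    (h1 : ∀ e ∈ H.edgeSet, ∃ e' ∈ H.edgeSet, D.IsCopy m lb e' (φ '' e))
    (h2 : ∀ e' ∈ H.edgeSet, ∃ e ∈ H.edgeSet, D.IsCopy m lb e' (φ '' e)) :
    D.LabelSimplex m lb := by
  classical
  set M := ⋃₀ H.edgeSet with hM
  have hMV : M ⊆ H.vertexSet := Set.sUnion_subset fun e he => H.subset_vertexSet_of_mem_edgeSet' he
  have hMfin : M.Finite := hD.finite.subset hMV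
  obtain ⟨c₀, -⟩ : D.C.Nonempty := by
    rw [← Set.ncard_pos hD.finite_core, hD.card_core]; omega
  have : Nonempty α := ⟨c₀⟩
  -- `ψ v` is the vertex of `H` whose colour `φ v` carries. It is meaningful only for vertices in
  -- the set `M` of those covered by hyperedges; the others impose no constraint.
  set ψ : α → α := fun v => Function.invFunOn D.idx H.vertexSet (φ v % D.N) with hψ
  have himg : ∀ e ∈ H.edgeSet, ∀ e' ∈ H.edgeSet, D.IsCopy m lb e' (φ '' e) →
      (∀ v ∈ e, D.idx (ψ v) = φ v % D.N) ∧ ψ '' e = e' := by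
    intro e he e' he' hcop
    have hcol := hD.color_image he' hcop
    have hidx : ∀ v ∈ e, D.idx (ψ v) = φ v % D.N ∧ ψ v ∈ H.vertexSet := fun v hv => by
      have : φ v % D.N ∈ D.idx '' H.vertexSet := by
        refine Set.image_mono (H.subset_vertexSet_of_mem_edgeSet' he') ?_
        rw [← hcol]
        exact ⟨φ v, ⟨v, hv, rfl⟩, rfl⟩
      exact ⟨Function.invFunOn_eq this, Function.invFunOn_mem this⟩
    refine ⟨fun v hv => (hidx v hv).1, ?_⟩
    refine (hD.idx_inj.image_eq_image_iff ?_ (H.subset_vertexSet_of_mem_edgeSet' he')).mp ?_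
    · rintro _ ⟨v, hv, rfl⟩
      exact (hidx v hv).2
    · rw [← hcol, Set.image_image, Set.image_image]
      exact Set.image_congr fun v hv => (hidx v hv).1
  have hmaps : Set.MapsTo ψ M M := by
    rintro v ⟨e, he, hv⟩
    obtain ⟨e', he', hcop⟩ := h1 e he
    exact ⟨e', he', (himg e he e' he' hcop).2 ▸ ⟨v, hv, rfl⟩⟩
  have hsurj : Set.SurjOn ψ M M := by
    rintro v ⟨e', he', hv⟩
    obtain ⟨e, he, hcop⟩ := h2 e' he'
    rw [← (himg e he e' he' hcop).2] at hv
    obtain ⟨w, hw, rfl⟩ := hv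
    exact ⟨w, ⟨e, he, hw⟩, rfl⟩
  -- Copies of all hyperedges are hit, so `ψ` maps the finite set `M` onto itself and permutes it.
  -- Precomposing `φ` with the inverse `g` restores the colours.
  have hbij := (hMfin.surjOn_iff_bijOn_of_mapsTo hmaps).mp hsurj
  set g := Function.invFunOn ψ M with hg
  have hgψ : ∀ v ∈ M, g (ψ v) = v := fun v hv => hbij.injOn.leftInvOn_invFunOn hv
  have hψg : ∀ v ∈ M, ψ (g v) = v := fun v hv => hsurj.rightInvOn_invFunOn hv
  have hcopy : ∀ e' ∈ H.edgeSet, D.IsCopy m lb e' ((fun v => φ (g v)) '' e') ∧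
      ∀ v ∈ e', φ (g v) % D.N = D.idx v := by
    intro e' he'
    obtain ⟨e, he, hcop⟩ := h2 e' he'
    obtain ⟨hidx, heq⟩ := himg e he e' he' hcop
    have hge : g '' e' = e := by
      rw [← heq, Set.image_image]
      exact (Set.image_congr fun v hv => hgψ v ⟨e, he, hv⟩).trans (Set.image_id' e)
    refine ⟨?_, fun v hv => ?_⟩
    · rw [← Set.image_image, hge]
      exact hcop
    · rw [← hidx (g v) (hge ▸ ⟨v, hv, rfl⟩), hψg v ⟨e', he', hv⟩]
  refine hD.labelSimplex_of_places (p := fun v => φ (g v) / D.N) fun e he hne => ?_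
  obtain ⟨hcop, hcol⟩ := hcopy e he
  rcases hcop with ⟨h0, -⟩ | ⟨j, hj, s, hs, hall, hcop⟩
  · exact absurd h0 hne.ne_empty
  · refine ⟨j, hj, s, hs, hall, fun v hv => ?_⟩
    have hvV := hD.mem_vertexSet he hv
    have hmem : φ (g v) ∈ D.copy lb e s j := hcop ▸ ⟨v, hv, rfl⟩
    rw [(hD.mem_copy he hvV hmem (hcol v hv)).2, hD.div_eq hvV]

end

end Gadget

end Hypergraph

/-! ### Detecting simplices by inclusion-exclusion over homomorphism counts -/

namespace Hypergraph

variable {α : Type*}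

namespace Gadget

section

variable {D : Gadget α} {l : ℕ∞} {H : Hypergraph α} {m : ℕ} {lb : ℕ → ℕ → ℕ}

theorem setOf_apply_eq_image {V : Set α} {W : Set ℕ} (φ : V → W) {e : Set α} (he : e ⊆ V)
    {Φ : α → ℕ} (hΦ : ∀ a : V, Φ a = φ a) :
    {b | ∃ a : V, (a : α) ∈ e ∧ (φ a : ℕ) = b} = Φ '' e := by
  ext b
  constructor
  · rintro ⟨a, ha, rfl⟩
    exact ⟨a, ha, hΦ a⟩
  · rintro ⟨v, hv, rfl⟩
    exact ⟨⟨v, he hv⟩, hv, (hΦ ⟨v, he hv⟩).symm⟩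

/-- The alternating sum counts the homomorphisms to the full target whose hyperedge images include a
copy of every hyperedge of `H`. Being a cardinality, it is positive exactly when such a map exists.
-/
theorem Valid.sum_homCount_pos_iff (hD : D.Valid l H) (hl : D.GoodLabels m lb)
    {E : Finset (Set α)} (hE : (E : Set (Set α)) = H.edgeSet) :
    0 < ∑ F ∈ E.powerset, (-1 : ℤ) ^ (E.card - F.card) *
      (homCount H (D.target m lb (F : Set (Set α))) : ℤ) ↔ D.LabelSimplex m lb := by
  classical
  have hfin := hD.finite
  have : Fintype H.vertexSet := hfin.fintype
  set V' := Set.Iio (D.N * (m * D.Q + 1)) with hV'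
  have hmemE : ∀ e, e ∈ E ↔ e ∈ H.edgeSet := fun e => by rw [← hE]; rfl
  set img : (H.vertexSet → V') → Set α → Set ℕ :=
    fun φ e => {b | ∃ a : H.vertexSet, (a : α) ∈ e ∧ (φ a : ℕ) = b} with himg
  set X : Finset (H.vertexSet → V') :=
    Finset.univ.filter fun φ => IsHom H (D.target m lb H.edgeSet) φ with hX
  set J : (H.vertexSet → V') → Finset (Set α) :=
    fun φ => E.filter fun e' => ∃ e ∈ H.edgeSet, D.IsCopy m lb e' (img φ e) with hJ
  -- A copy belongs to a unique hyperedge, so a homomorphism to the full target is one to the target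
  -- of `F` exactly when the set `J φ` of hyperedges whose copies it hits lies in `F`.
  have hcount : ∀ F ∈ E.powerset, homCount H (D.target m lb (F : Set (Set α))) =
      (X.filter fun φ => J φ ⊆ F).card := by
    intro F hF
    have hFE : (F : Set (Set α)) ⊆ H.edgeSet := fun e he =>
      (hmemE e).mp (Finset.mem_powerset.mp hF he)
    have h1 : homCount H (D.target m lb (F : Set (Set α))) =
        (Finset.univ.filter fun φ : H.vertexSet → V' =>
          IsHom H (D.target m lb (F : Set (Set α))) φ).card :=
      Nat.subtype_card _ fun φ =>
        Finset.mem_filter.trans (and_iff_right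
          (Finset.mem_univ (α := H.vertexSet → V') φ))
    rw [h1]
    congr 1
    ext φ
    simp only [hX, Finset.mem_filter, Finset.mem_univ, true_and]
    constructor
    · intro h
      refine ⟨fun e he => ?_, fun e' he' => ?_⟩
      · obtain ⟨e', he', hcop⟩ := (hD.mem_target hl hFE).mp (h e he)
        exact (hD.mem_target hl subset_rfl).mpr ⟨e', hFE he', hcop⟩
      · obtain ⟨he'E, e, he, hcop⟩ := Finset.mem_filter.mp he'
        obtain ⟨e'', he'', hcop'⟩ := (hD.mem_target hl hFE).mp (h e he)
        rwa [hD.isCopy_unique ((hmemE _).mp he'E) (hFE he'') hcop hcop']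
    · rintro ⟨h, hJF⟩ e he
      obtain ⟨e', he', hcop⟩ := (hD.mem_target hl subset_rfl).mp (h e he)
      exact (hD.mem_target hl hFE).mpr
        ⟨e', hJF (Finset.mem_filter.mpr ⟨(hmemE _).mpr he', e, he, hcop⟩), hcop⟩
  have hsum : ∑ F ∈ E.powerset, (-1 : ℤ) ^ (E.card - F.card) *
      (homCount H (D.target m lb (F : Set (Set α))) : ℤ) =
      ((X.filter fun φ => J φ = E).card : ℤ) := by
    rw [← Finset.sum_neg_one_pow_mul_card_filter_subset X E J
      fun φ _ => Finset.filter_subset _ _]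
    refine Finset.sum_congr rfl fun F hF => ?_
    rw [hcount F hF, Finset.card_sdiff_of_subset (Finset.mem_powerset.mp hF)]
  rw [hsum, Nat.cast_pos, Finset.card_pos]
  constructor
  · rintro ⟨φ, hφ⟩
    obtain ⟨hφX, hφJ⟩ := Finset.mem_filter.mp hφ
    have hφh := (Finset.mem_filter.mp hφX).2
    set Φ : α → ℕ := fun v => if h : v ∈ H.vertexSet then (φ ⟨v, h⟩ : ℕ) else 0 with hΦ
    have himgΦ : ∀ e ∈ H.edgeSet, img φ e = Φ '' e := fun e he =>
      setOf_apply_eq_image φ (H.subset_vertexSet_of_mem_edgeSet' he) fun a => by simp [hΦ]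
    refine hD.labelSimplex_of_map (φ := Φ) (fun e he => ?_) fun e' he' => ?_
    · obtain ⟨e', he', hcop⟩ := (hD.mem_target hl subset_rfl).mp (hφh e he)
      exact ⟨e', he', himgΦ e he ▸ hcop⟩
    · have : e' ∈ J φ := hφJ ▸ (hmemE e').mpr he'
      obtain ⟨-, e, he, hcop⟩ := Finset.mem_filter.mp this
      exact ⟨e, he, himgΦ e he ▸ hcop⟩
  · intro h
    obtain ⟨p, hp, hcop⟩ := hD.exists_places hl h
    set φ : H.vertexSet → V' := fun v =>
      ⟨D.N * p v + D.idx v, vertex_lt (hD.idx_lt v v.2) (hp v)⟩ with hφ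
    have himgφ : ∀ e ∈ H.edgeSet, D.IsCopy m lb e (img φ e) := fun e he => by
      have : img φ e = (fun v => D.N * p v + D.idx v) '' e :=
        setOf_apply_eq_image φ (H.subset_vertexSet_of_mem_edgeSet' he) fun a => rfl
      rw [this]
      exact hcop e he
    refine ⟨φ, Finset.mem_filter.mpr ⟨Finset.mem_filter.mpr ⟨Finset.mem_univ _, fun e he => ?_⟩,
      ?_⟩⟩
    · exact (hD.mem_target hl subset_rfl).mpr ⟨e, he, himgφ e he⟩
    · refine Finset.filter_true_of_mem fun e he => ?_
      exact ⟨e, (hmemE e).mp he, himgφ e ((hmemE e).mp he)⟩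

/-! ### Encodings -/

open Classical in
/-- The vertices of a finite set in some order. -/
noncomputable def vlist (e : Set α) : List α := if h : e.Finite then h.toFinset.toList else []

theorem mem_vlist {e : Set α} (he : e.Finite) {v : α} : v ∈ vlist e ↔ v ∈ e := by
  simp [vlist, he]

theorem nodup_vlist (e : Set α) : (vlist e).Nodup := by
  unfold vlist
  split_ifs
  · exact Finset.nodup_toList _
  · exact List.nodup_nil

open Classical in
/-- The term for the copy of the vertex `v` in the copies of `e` with parameter `s`. -/
noncomputable def term (D : Gadget α) (e : Set α) (s : ℕ) (v : α) : RAM.Term :=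
  if v ∈ D.S then
    if v ∈ D.C ∧ ¬ e ∩ D.S ⊆ D.C then .lab (D.slot s v) D.N (D.idx v)
    else .lin (D.N * D.Q) (D.N * s + D.idx v)
  else .lin 0 (D.idx v)

theorem eval_term (D : Gadget α) (e : Set α) (s j : ℕ) (v : α) :
    (D.term e s v).eval j (lb j) = D.N * D.place lb e s j v + D.idx v := by
  unfold term place
  split_ifs
  · rfl
  · simp only [RAM.Term.eval]; ring
  · simp only [RAM.Term.eval]; ring

open Classical in
/-- The hyperedges in `F` that do not meet `S`. -/
noncomputable def once (D : Gadget α) (F : Finset (Set α)) : List (Set α) :=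
  F.toList.filter fun e => e ∩ D.S = ∅

open Classical in
/-- The hyperedges in `F` that meet `S`, with the parameters of their copies. -/
noncomputable def each (D : Gadget α) (F : Finset (Set α)) : List (Set α × ℕ) :=
  (F.toList ×ˢ List.range D.Q).filter fun p => D.Allowed p.1 p.2

theorem mem_once {F : Finset (Set α)} {e : Set α} : e ∈ D.once F ↔ e ∈ F ∧ e ∩ D.S = ∅ := by
  simp [once]

theorem mem_each {F : Finset (Set α)} {p : Set α × ℕ} :
    p ∈ D.each F ↔ p.1 ∈ F ∧ p.2 < D.Q ∧ D.Allowed p.1 p.2 := by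
  rcases p with ⟨e, s⟩
  simp [each, and_assoc]

/-- The run that counts the homomorphisms to the copies of the hyperedges in `F`. -/
noncomputable def run (D : Gadget α) (E F : Finset (Set α)) : RAM.Run where
  positive := decide (Even (E.card - F.card))
  pre := (D.N * D.Q, D.N) :: ((D.each F).length, (D.once F).length) ::
    (D.once F).flatMap fun e => (0, (vlist e).length) :: (vlist e).map fun v => (0, D.idx v)
  body := (D.each F).flatMap fun p =>
    .lin 0 (vlist p.1).length :: (vlist p.1).map (D.term p.1 p.2)

/-- The hyperedges of the target with their parameters. -/
noncomputable def copies (D : Gadget α) (m : ℕ) (F : Finset (Set α)) : List (Set α × ℕ × ℕ) :=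
  (D.once F).map (fun e => (e, 0, 0)) ++
    (List.range m).flatMap fun j => (D.each F).map fun p => (p.1, p.2, j)

/-- A copy of a hyperedge as a list. -/
noncomputable def copyList (D : Gadget α) (lb : ℕ → ℕ → ℕ) (t : Set α × ℕ × ℕ) : List ℕ :=
  (vlist t.1).map fun v => D.N * D.place lb t.1 t.2.1 t.2.2 v + D.idx v

theorem mem_copies {F : Finset (Set α)} {e : Set α} {s j : ℕ} :
    (e, s, j) ∈ D.copies m F ↔ (e ∈ F ∧ e ∩ D.S = ∅ ∧ s = 0 ∧ j = 0) ∨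
      (e ∈ F ∧ j < m ∧ s < D.Q ∧ D.Allowed e s) := by
  simp only [copies, List.mem_append, List.mem_map, List.mem_flatMap, List.mem_range, mem_once,
    mem_each, Prod.mk.injEq]
  constructor
  · rintro (⟨e', h, rfl, rfl, rfl⟩ | ⟨j', hj, ⟨e', s'⟩, h, rfl, rfl, rfl⟩)
    · exact Or.inl ⟨h.1, h.2, rfl, rfl⟩
    · exact Or.inr ⟨h.1, hj, h.2⟩
  · rintro (⟨h1, h2, rfl, rfl⟩ | ⟨h1, hj, h2⟩)
    · exact Or.inl ⟨e, ⟨h1, h2⟩, rfl, rfl, rfl⟩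
    · exact Or.inr ⟨j, hj, (e, s), ⟨h1, h2⟩, rfl, rfl, rfl⟩

theorem nodup_copies (F : Finset (Set α)) : (D.copies m F).Nodup := by
  have honce : (D.once F).Nodup := (Finset.nodup_toList F).filter _
  have heach : (D.each F).Nodup :=
    ((Finset.nodup_toList F).product List.nodup_range).filter _
  refine List.nodup_append.mpr ⟨?_, ?_, ?_⟩
  · exact honce.map fun a b h => congrArg Prod.fst h
  · refine List.nodup_flatMap.mpr ⟨fun j _ => ?_, ?_⟩
    · refine heach.map fun a b h => ?_
      simp only [Prod.mk.injEq] at h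
      exact Prod.ext h.1 h.2.1
    · refine List.nodup_range.imp fun {j j'} hne => ?_
      intro t ht ht'
      obtain ⟨p, -, rfl⟩ := List.mem_map.mp ht
      obtain ⟨p', -, hp'⟩ := List.mem_map.mp ht'
      simp only [Prod.mk.injEq] at hp'
      exact hne hp'.2.2.symm
  · intro t ht t' ht' htt
    subst htt
    obtain ⟨e, he, rfl⟩ := List.mem_map.mp ht
    obtain ⟨j, -, ht'⟩ := List.mem_flatMap.mp ht'
    obtain ⟨p, hp, hp'⟩ := List.mem_map.mp ht'
    simp only [Prod.mk.injEq] at hp'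
    have h1 := (mem_each.mp hp).2.2.1
    rw [hp'.1, (mem_once.mp he).2] at h1
    exact Set.not_nonempty_empty h1

theorem Valid.finite_edge (hD : D.Valid l H) {e : Set α} (he : e ∈ H.edgeSet) : e.Finite :=
  hD.finite.subset (H.subset_vertexSet_of_mem_edgeSet' he)

theorem Valid.setOf_mem_copyList (hD : D.Valid l H) {e : Set α} (he : e ∈ H.edgeSet) (s j : ℕ) :
    {u | u ∈ D.copyList lb (e, s, j)} = D.copy lb e s j := by
  ext u
  simp [copyList, copy, mem_vlist (hD.finite_edge he)]

/-- Every hyperedge that meets `S` has a vertex with place `j * Q + s`: one in `S \ C` if there is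
one, otherwise a core vertex. The parameters are read off there. -/
theorem Valid.copy_inj (hD : D.Valid l H) {e : Set α} (he : e ∈ H.edgeSet) {s s' j j' : ℕ}
    (hs : s < D.Q) (hs' : s' < D.Q) (hne : (e ∩ D.S).Nonempty)
    (h : D.copy lb e s j = D.copy lb e s' j') : s = s' ∧ j = j' := by
  have key : ∃ v ∈ e, ∀ s j, D.place lb e s j v = j * D.Q + s := by
    by_cases hC : e ∩ D.S ⊆ D.C
    · obtain ⟨c, hc⟩ := hne
      exact ⟨c, hc.1, fun s j => place_of_subset hc.2 hC⟩
    · obtain ⟨d, hd, hdC⟩ := Set.not_subset.mp hC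
      exact ⟨d, hd.1, fun s j => place_of_notMem_core ⟨hd.2, hdC⟩⟩
  obtain ⟨v, hv, hpl⟩ := key
  have hvV := hD.mem_vertexSet he hv
  have hmem : D.N * D.place lb e s j v + D.idx v ∈ D.copy lb e s' j' := h ▸ ⟨v, hv, rfl⟩
  have h1 := (hD.mem_copy he hvV hmem (hD.mod_eq hvV _)).2
  have h2 := congrArg (· / D.N) h1
  simp only [hD.div_eq hvV, hpl] at h2
  exact (index_inj hs hs' h2).symm

theorem ncard_setOf_mem_list {L : List (List ℕ)} (h : (L.map List.toFinset).Nodup) :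
    {f : Set ℕ | ∃ a ∈ L, f = {u | u ∈ a}}.ncard = L.length := by
  have : {f : Set ℕ | ∃ a ∈ L, f = {u | u ∈ a}} =
      (L.map List.toFinset).toFinset.image (fun s : Finset ℕ => (s : Set ℕ)) := by
    ext f
    simp only [Set.mem_ofPred_eq, Finset.coe_image, Set.mem_image, Finset.mem_coe,
      List.mem_toFinset, List.mem_map]
    constructor
    · rintro ⟨a, ha, rfl⟩
      exact ⟨a.toFinset, ⟨a, ha, rfl⟩, by ext; simp⟩
    · rintro ⟨_, ⟨a, ha, rfl⟩, rfl⟩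
      exact ⟨a, ha, by ext; simp⟩
  rw [this, Set.ncard_coe_finset, Finset.card_image_of_injective _ Finset.coe_injective,
    List.toFinset_card_of_nodup h, List.length_map]

/-- Distinct triples in `copies` give distinct sets, so the list written by the run has no
repetitions. The number of hyperedges of the target is then an affine function of `m`, which allows
it to be written before they are enumerated. -/
theorem Valid.encodes_run (hD : D.Valid l H) (hl : D.GoodLabels m lb) (h0 : ∅ ∉ H.edgeSet)
    (E : Finset (Set α)) {F : Finset (Set α)} (hF : (F : Set (Set α)) ⊆ H.edgeSet) :
    Encodes ((D.run E F).input m lb) (D.target m lb (F : Set (Set α))) ∧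
      (D.target m lb (F : Set (Set α))).edgeSet.ncard =
        (D.once F).length + m * (D.each F).length := by
  have hmem : ∀ t ∈ D.copies m F, t.1 ∈ H.edgeSet := by
    rintro ⟨e, s, j⟩ ht
    rcases mem_copies.mp ht with h | h
    · exact hF h.1
    · exact hF h.1
  have hlen : (D.copies m F).length = (D.once F).length + m * (D.each F).length := by
    simp [copies, List.length_flatMap]
  have hset : ∀ t ∈ D.copies m F, {u | u ∈ D.copyList lb t} = D.copy lb t.1 t.2.1 t.2.2 :=
    fun t ht => hD.setOf_mem_copyList (hmem t ht) _ _
  have hcop : ∀ t ∈ D.copies m F, D.IsCopy m lb t.1 (D.copy lb t.1 t.2.1 t.2.2) := by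
    rintro ⟨e, s, j⟩ ht
    rcases mem_copies.mp ht with ⟨-, h, rfl, rfl⟩ | ⟨-, hj, hs, hall⟩
    · exact Or.inl ⟨h, rfl⟩
    · exact Or.inr ⟨j, hj, s, hs, hall, rfl⟩
  have hedge : (D.target m lb (F : Set (Set α))).edgeSet =
      {f | ∃ a ∈ (D.copies m F).map (D.copyList lb), f = {u | u ∈ a}} := by
    ext f
    rw [hD.mem_target hl hF]
    constructor
    · rintro ⟨e, he, ⟨h, rfl⟩ | ⟨j, hj, s, hs, hall, rfl⟩⟩
      · have ht := (mem_copies (m := m)).mpr (Or.inl ⟨he, h, rfl, rfl⟩)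
        exact ⟨_, List.mem_map_of_mem ht, (hset _ ht).symm⟩
      · have ht := mem_copies.mpr (Or.inr ⟨he, hj, hs, hall⟩)
        exact ⟨_, List.mem_map_of_mem ht, (hset _ ht).symm⟩
    · rintro ⟨a, ha, rfl⟩
      obtain ⟨⟨e, s, j⟩, ht, rfl⟩ := List.mem_map.mp ha
      rw [hset _ ht]
      refine ⟨e, ?_, hcop _ ht⟩
      rcases mem_copies.mp ht with h | h
      · exact h.1
      · exact h.1
  have hinj : ∀ t ∈ D.copies m F, ∀ t' ∈ D.copies m F,
      D.copy lb t.1 t.2.1 t.2.2 = D.copy lb t'.1 t'.2.1 t'.2.2 → t = t' := by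
    rintro ⟨e, s, j⟩ ht ⟨e', s', j'⟩ ht' h
    have hee : e = e' := hD.isCopy_unique (hmem _ ht) (hmem _ ht') (hcop _ ht)
      (h ▸ hcop _ ht')
    subst hee
    rcases mem_copies.mp ht with ⟨-, h1, rfl, rfl⟩ | ⟨-, -, hs, hall⟩
    · rcases mem_copies.mp ht' with ⟨-, -, rfl, rfl⟩ | ⟨-, -, -, hall'⟩
      · rfl
      · exact absurd h1 hall'.1.ne_empty
    · rcases mem_copies.mp ht' with ⟨-, h1, -, -⟩ | ⟨-, -, hs', -⟩
      · exact absurd h1 hall.1.ne_empty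
      · obtain ⟨rfl, rfl⟩ := hD.copy_inj (hmem _ ht) hs hs' hall.1 h
        rfl
  have hnodup : (((D.copies m F).map (D.copyList lb)).map List.toFinset).Nodup := by
    rw [List.map_map]
    refine (nodup_copies F).map_on fun t ht t' ht' h => hinj t ht t' ht' ?_
    rw [← hset t ht, ← hset t' ht']
    ext u
    have := Finset.ext_iff.mp h u
    simpa using this
  refine ⟨⟨D.N * (m * D.Q + 1), (D.copies m F).map (D.copyList lb), rfl, ?_, hnodup, hedge, ?_⟩, ?_⟩
  · intro a ha
    obtain ⟨⟨e, s, j⟩, ht, rfl⟩ := List.mem_map.mp ha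
    have he := hmem _ ht
    constructor
    · intro hnil
      have : vlist e = [] := by simpa [copyList] using hnil
      refine h0 (?_ : ∅ ∈ H.edgeSet)
      have he0 : e = ∅ := Set.eq_empty_of_forall_notMem fun v hv => by
        have := (mem_vlist (hD.finite_edge he)).mpr hv
        simp_all
      rwa [he0] at he
    · refine (nodup_vlist e).map_on fun v hv w hw h => ?_
      have hv' := hD.mem_vertexSet he ((mem_vlist (hD.finite_edge he)).mp hv)
      have hw' := hD.mem_vertexSet he ((mem_vlist (hD.finite_edge he)).mp hw)
      have h' := congrArg (· % D.N) h
      simp only [hD.mod_eq hv', hD.mod_eq hw'] at h'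
      exact hD.idx_inj hv' hw' h'
  · rw [List.length_map, hlen]
    have honce : ∀ e ∈ D.once F, (vlist e).map D.idx = D.copyList lb (e, 0, 0) := by
      intro e he
      refine List.map_congr_left fun v hv => ?_
      obtain ⟨heF, he0⟩ := mem_once.mp he
      have : v ∉ D.S := fun h => by
        have := (mem_vlist (hD.finite_edge (hF heF))).mp hv
        exact (he0 ▸ (⟨this, h⟩ : v ∈ e ∩ D.S) : v ∈ (∅ : Set α))
      simp [place_of_notMem this]
    have h1 : ((D.once F).flatMap fun e =>
        (0, (vlist e).length) :: (vlist e).map fun v => (0, D.idx v)).map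
          (fun p : ℕ × ℕ => p.1 * m + p.2) =
        ((D.once F).map fun e => D.copyList lb (e, 0, 0)).flatMap fun a => a.length :: a := by
      rw [List.map_flatMap, List.flatMap_map]
      refine List.flatMap_congr fun e he => ?_
      rw [← honce e he]
      simp [Function.comp_def]
    have h2 : ∀ j, ((D.each F).flatMap fun p =>
        RAM.Term.lin 0 (vlist p.1).length :: (vlist p.1).map (D.term p.1 p.2)).map
          (RAM.Term.eval j (lb j)) =
        ((D.each F).map fun p => D.copyList lb (p.1, p.2, j)).flatMap fun a => a.length :: a := by
      intro j
      rw [List.map_flatMap, List.flatMap_map]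
      refine List.flatMap_congr fun p _ => ?_
      have hlin : ∀ n, RAM.Term.eval j (lb j) (.lin 0 n) = n := fun n => by simp [RAM.Term.eval]
      simp [copyList, Function.comp_def, eval_term, hlin]
    simp only [RAM.Run.input, run, List.map_cons, h1, h2, copies, List.map_append, List.map_flatMap,
      List.flatMap_append, List.flatMap_assoc, List.cons_append, List.map_map, Function.comp_def]
    congr 1
    · ring
    · congr 1
      ring
  · rw [hedge, ncard_setOf_mem_list hnodup, List.length_map, hlen]

theorem Valid.rank_target (hD : D.Valid l H) {F : Set (Set α)} (hF : F ⊆ H.edgeSet) :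
    ∀ f ∈ (D.target m lb F).edgeSet, f.encard ≤ D.N := by
  rintro f ⟨⟨e, he, hcop⟩, -⟩
  obtain ⟨s, j, rfl⟩ := hcop.eq_copy
  refine (Set.encard_image_le _ _).trans ?_
  have hsub := H.subset_vertexSet_of_mem_edgeSet' (hF he)
  calc e.encard ≤ (Set.Iio D.N).encard :=
        Set.encard_le_encard_of_injOn (fun v hv => hD.idx_lt v (hsub hv)) (hD.idx_inj.mono hsub)
    _ = D.N := by
        rw [← (Set.finite_Iio D.N).cast_ncard_eq]
        simp [Set.ncard_eq_toFinset_card']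

end

end Gadget

end Hypergraph

namespace Hypergraph

variable {α : Type*}

/-! ### The gadget of an obstruction -/

theorem setOf_reflTransGen_eq {G : Hypergraph α} {u v : α} (h : Relation.ReflTransGen G.Adj u v) :
    {w | Relation.ReflTransGen G.Adj u w} = {w | Relation.ReflTransGen G.Adj v w} := by
  have hsymm : Relation.ReflTransGen G.Adj v u := by
    induction h with
    | refl => exact .refl
    | tail _ h ih => exact Relation.ReflTransGen.head h.symm ih
  ext w
  exact ⟨fun hw => hsymm.trans hw, fun hw => h.trans hw⟩

/-- Each field of `Valid` translates a clause of the definition of a core from the trimmed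
hypergraph on `S` to the hyperedges of `H`; `not_cover` supplies `miss`, and `cover_erase` the
components. -/
theorem exists_gadget {l : ℕ∞} {H : Hypergraph α} (hfin : H.IsFiniteProper)
    (hH : ContainsObstruction l H) : ∃ D : Gadget α, D.Valid l H := by
  classical
  obtain ⟨S, hSV, C, hcore⟩ := hH
  have hfinV := hfin.1
  have hCS : C ⊆ S := fun c hc => (hcore.subset hc).2
  have hCfin : C.Finite := hfinV.subset (hCS.trans hSV)
  have hVS : (H.trim S ⊤).vertexSet = S := Set.inter_eq_right.mpr hSV
  have hC3 : 3 ≤ C.ncard := by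
    have := hcore.three_le
    rw [← hCfin.cast_ncard_eq] at this
    exact_mod_cast this
  have hedge : ∀ e ∈ H.edgeSet, (e ∩ S).Nonempty → e ∩ S ∈ (H.trim S ⊤).edgeSet :=
    fun e he hne => ⟨hne, e, he, le_top, rfl⟩
  set G := (H.trim S ⊤).trim ((H.trim S ⊤).vertexSet \ C) ⊤ with hG
  have hGV : G.vertexSet = S \ C := by
    change (H.trim S ⊤).vertexSet ∩ ((H.trim S ⊤).vertexSet \ C) = S \ C
    rw [hVS]
    exact Set.inter_eq_right.mpr Set.sdiff_subset
  have hadj : ∀ e ∈ H.edgeSet, ∀ d ∈ e ∩ (S \ C), ∀ d' ∈ e ∩ (S \ C), G.Adj d d' := by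
    intro e he d hd d' hd'
    refine ⟨(e ∩ S) ∩ ((H.trim S ⊤).vertexSet \ C),
      ⟨⟨d, ?_⟩, e ∩ S, hedge e he ⟨d, hd.1, hd.2.1⟩, le_top, rfl⟩, ?_, ?_⟩
    · rw [hVS]; exact ⟨⟨hd.1, hd.2.1⟩, hd.2⟩
    · rw [hVS]; exact ⟨⟨hd.1, hd.2.1⟩, hd.2⟩
    · rw [hVS]; exact ⟨⟨hd'.1, hd'.2.1⟩, hd'.2⟩
  have hadj' : ∀ d d', G.Adj d d' → ∃ e ∈ H.edgeSet, d ∈ e ∩ (S \ C) ∧ d' ∈ e ∩ (S \ C) := by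
    rintro d d' ⟨f, ⟨-, f', ⟨-, e, he, -, rfl⟩, -, rfl⟩, hd, hd'⟩
    rw [hVS] at hd hd'
    exact ⟨e, he, ⟨hd.1.1, hd.2⟩, ⟨hd'.1.1, hd'.2⟩⟩
  set comp : α → Set α := fun d => {w | Relation.ReflTransGen G.Adj d w} with hcomp
  -- The missed vertex is chosen for the set `K` rather than for its elements, so that a whole
  -- component shares it.
  have hex : ∀ K, ∃ c, G.IsComponent K → c ∈ C ∧ c ∉ ⋃₀ (H.trim S ⊤).connector C K := by
    intro K
    by_cases hK : G.IsComponent K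
    · obtain ⟨c, hc, hc'⟩ := Set.not_subset.mp (hcore.not_cover K hK)
      exact ⟨c, fun _ => ⟨hc, hc'⟩⟩
    · obtain ⟨c, -⟩ : C.Nonempty := by rw [← Set.ncard_pos hCfin]; omega
      exact ⟨c, fun h => absurd h hK⟩
  choose mo hmo using hex
  have hisComp : ∀ d ∈ S \ C, G.IsComponent (comp d) := fun d hd => ⟨d, hGV ▸ hd, rfl⟩
  have hsmall : ∀ e ∈ H.edgeSet, ((e ∩ S) \ C).encard ≤ l → ((e ∩ S) ∩ C).encard ≤ 1 := by
    intro e he hle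
    by_cases hne : ((e ∩ S) ∩ C).Nonempty
    · exact hcore.empty_core _ ⟨hne, e ∩ S, hedge e he (hne.mono Set.inter_subset_left), hle, rfl⟩
    · rw [Set.not_nonempty_iff_eq_empty.mp hne]; simp
  have hfinT : Finite H.vertexSet := hfinV
  obtain ⟨N, ⟨eqv⟩⟩ := Finite.exists_equiv_fin H.vertexSet
  refine ⟨{ S := S, C := C, N := N, k := C.ncard - 1,
            idx := fun v => if h : v ∈ H.vertexSet then (eqv ⟨v, h⟩ : ℕ) else 0,
            miss := fun d => mo (comp d) }, ?_⟩
  constructor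
  · intro v hv w hw h
    simp only [dif_pos hv, dif_pos hw] at h
    exact congrArg Subtype.val (eqv.injective (Fin.ext h))
  · intro v hv
    simp only [dif_pos hv]
    exact Fin.is_lt _
  · exact hCS
  · exact hSV
  · change 2 ≤ C.ncard - 1
    omega
  · change C.ncard = C.ncard - 1 + 1
    omega
  · exact hsmall
  · exact fun d hd => (hmo _ (hisComp d hd)).1
  · intro e he d hd hmem
    obtain ⟨hmC, hm⟩ := hmo _ (hisComp d hd.2)
    -- If `e` contained the missed vertex, `e ∩ S` would be a connector hyperedge of the component
    -- of `d`: it lies in the core and that component, and has two distinct vertices.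
    refine hm ⟨e ∩ S, ⟨hedge e he ⟨d, hd.1, hd.2.1⟩, fun v hv => ?_, ?_⟩, hmem, hCS hmC⟩
    · by_cases hvC : v ∈ C
      · exact Or.inl hvC
      · exact Or.inr (Relation.ReflTransGen.single (hadj e he d hd v ⟨hv.1, hv.2, hvC⟩))
    · rw [Set.one_lt_encard_iff]
      exact ⟨d, mo (comp d), ⟨hd.1, hd.2.1⟩, ⟨hmem, hCS hmC⟩, fun h => hd.2.2 (h ▸ hmC)⟩
  · intro e he d hd d' hd'
    exact congrArg mo (setOf_reflTransGen_eq (.single (hadj e he d hd d' hd')))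
  · intro c hc
    obtain ⟨K, hK, hcov, hcK⟩ := hcore.cover_erase c hc
    obtain ⟨u, hu, rfl⟩ := hK
    have hsub : {v | Relation.ReflTransGen G.Adj u v} ⊆ S \ C := by
      intro v hv
      rcases Relation.ReflTransGen.cases_tail hv with rfl | ⟨w, -, hw⟩
      · exact hGV ▸ hu
      · obtain ⟨e, he, -, h⟩ := hadj' w v hw
        exact h.2
    refine ⟨_, hsub, fun d hd => ?_, fun p hp => ?_, fun c' hc' => ?_⟩
    · change mo (comp d) = c
      have heq : comp d = {v | Relation.ReflTransGen G.Adj u v} := (setOf_reflTransGen_eq hd).symm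
      obtain ⟨h1, h2⟩ := hmo _ (hisComp d (hsub hd))
      -- A missed vertex other than `c` would lie in `C \ {c}`, all of which this connector covers.
      by_contra hne
      refine h2 ?_
      have h3 := hcov ⟨h1, hne⟩
      rwa [← heq] at h3
    · have hconst : ∀ d, Relation.ReflTransGen G.Adj u d → p d = p u := by
        intro d hd
        induction hd with
        | refl => rfl
        | tail _ h ih =>
          obtain ⟨e, he, h1, h2⟩ := hadj' _ _ h
          rw [← ih]
          exact hp e he _ h2 _ h1
      exact fun d hd d' hd' => (hconst d hd).trans (hconst d' hd').symm
    · obtain ⟨_, ⟨⟨-, e, he, -, rfl⟩, hsubf, hone⟩, hcf⟩ := hcov hc'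
      refine ⟨e, he, hcf.1, ?_⟩
      -- A hyperedge inside the core would have at most one vertex, whereas connector hyperedges
      -- have more. So it meets the component.
      have hnot : ¬ e ∩ S ⊆ C := fun hsubC => by
        have h1 := hsmall e he (by rw [Set.sdiff_eq_empty.mpr hsubC]; simp)
        rw [Set.inter_eq_left.mpr hsubC] at h1
        exact absurd hone (not_lt.mpr h1)
      obtain ⟨v, hv, hvC⟩ := Set.not_subset.mp hnot
      exact ⟨v, hv.1, (hsubf hv).resolve_left hvC⟩

/-! ### Labels and simplices -/

namespace Gadget

variable {D : Gadget α} {l : ℕ∞} {H : Hypergraph α} {e : RAM.Params}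

theorem Valid.k_le_Q (hD : D.Valid l H) : D.k ≤ D.Q :=
  Nat.le_self_pow hD.N_pos.ne' _

/-- A label codes an occurrence, and an occurrence determines the vertex. -/
theorem labelling_inj (hkQ : e.k ≤ e.Q) {lab : ℕ → ℕ} (h : e.IsLabelling lab) {j i j' i' : ℕ}
    (hj : j < e.m) (hi : i < e.k) (hj' : j' < e.m) (hi' : i' < e.k)
    (heq : lab (e.vtx j i) = lab (e.vtx j' i')) : e.vtx j i = e.vtx j' i' := by
  obtain ⟨j₁, -, i₁, hi₁, h1, h1'⟩ := h j hj i hi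
  obtain ⟨j₂, -, i₂, hi₂, h2, h2'⟩ := h j' hj' i' hi'
  rw [h1', h2'] at heq
  obtain ⟨rfl, rfl⟩ := index_inj (by omega) (by omega) heq
  rw [← h1, ← h2]

theorem goodLabels_of_isLabelling (hf : e.Fits) (hk : e.k = D.k) (hQ : e.Q = D.Q) {lab : ℕ → ℕ}
    (h : e.IsLabelling lab) (hinj : ∀ j < e.m, Set.InjOn (e.vtx j) (Set.Iio e.k)) :
    D.GoodLabels e.m fun j i => lab (e.vtx j i) where
  lt j hj i hi := hQ ▸ h.lt hf hj (hk ▸ hi)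
  inj j hj i hi i' hi' heq := by
    rw [← hk] at hi hi'
    exact hinj j hj hi hi' (labelling_inj hf.k_le_Q h hj hi hj hi' heq)

/-- Labels correspond injectively to input vertices, so a system of labels pulls back to a map `w`
from the core to the input, and the simplex is the image of the core. -/
theorem Valid.labelSimplex_iff (hD : D.Valid l H) (hf : e.Fits) (hk : e.k = D.k)
    {lab : ℕ → ℕ} (h : e.IsLabelling lab)
    (hinj : ∀ j < e.m, Set.InjOn (e.vtx j) (Set.Iio e.k)) {G : Hypergraph ℕ}
    (hG : ∀ f, f ∈ G.edgeSet ↔ ∃ j < e.m, f = e.vtx j '' Set.Iio e.k) :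
    D.LabelSimplex e.m (fun j i => lab (e.vtx j i)) ↔ ContainsSimplex D.k G := by
  classical
  have h2k := hD.two_le
  have hCfin := hD.finite_core
  have hcardE : ∀ j < e.m, (e.vtx j '' Set.Iio e.k).ncard = D.k := fun j hj => by
    rw [(hinj j hj).ncard_image, hk]
    simp [Set.ncard_eq_toFinset_card']
  constructor
  · rintro ⟨p, hp⟩
    have hw : ∀ c ∈ D.C, ∃ w, lab w = p c ∧ ∃ j < e.m, ∃ i < e.k, e.vtx j i = w := by
      intro c hc
      obtain ⟨c', hc', hne⟩ := Set.exists_ne_of_one_lt_ncard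
        (by rw [hD.card_core]; omega : 1 < D.C.ncard) c
      obtain ⟨j, hj, σ, -, hσ⟩ := hp c' hc'
      obtain ⟨h1, h2⟩ := hσ c ⟨hc, hne.symm⟩
      exact ⟨_, h2.symm, j, hj, σ c, hk ▸ h1, rfl⟩
    choose! w hlab hocc using hw
    have key : ∀ c ∈ D.C, ∃ j < e.m, ∃ σ : α → ℕ, Set.InjOn σ (D.C \ {c}) ∧
        ∀ c' ∈ D.C \ {c}, σ c' < e.k ∧ w c' = e.vtx j (σ c') := by
      intro c hc
      obtain ⟨j, hj, σ, hσ, hσ'⟩ := hp c hc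
      refine ⟨j, hj, σ, hσ, fun c' hc' => ?_⟩
      obtain ⟨h1, h2⟩ := hσ' c' hc'
      rw [← hk] at h1
      refine ⟨h1, ?_⟩
      obtain ⟨j', hj', i', hi', h3⟩ := hocc c' hc'.1
      rw [← h3]
      refine labelling_inj hf.k_le_Q h hj' hi' hj h1 ?_
      rw [h3, hlab c' hc'.1, h2]
    have hwinj : Set.InjOn w D.C := by
      intro c₁ hc₁ c₂ hc₂ heq
      by_contra hne
      -- The core has at least three vertices. The hyperedge opposite to a third one contains the
      -- images of both `c₁` and `c₂`, in different places.
      have hex : (D.C \ {c₁, c₂}).Nonempty := by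
        rw [Set.nonempty_iff_ne_empty]
        intro hemp
        have h1 := Set.ncard_le_ncard (Set.sdiff_eq_empty.mp hemp) (Set.toFinite _)
        have h2 := Set.ncard_pair hne
        rw [hD.card_core] at h1
        omega
      obtain ⟨c₃, hc₃, hc₃'⟩ := hex
      simp only [Set.mem_insert_iff, Set.mem_singleton_iff, not_or] at hc₃'
      obtain ⟨j, hj, σ, hσ, hσ'⟩ := key c₃ hc₃
      have m₁ : c₁ ∈ D.C \ {c₃} := ⟨hc₁, fun h => hc₃'.1 h.symm⟩
      have m₂ : c₂ ∈ D.C \ {c₃} := ⟨hc₂, fun h => hc₃'.2 h.symm⟩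
      rw [(hσ' c₁ m₁).2, (hσ' c₂ m₂).2] at heq
      exact hne (hσ m₁ m₂ (hinj j hj (hσ' c₁ m₁).1 (hσ' c₂ m₂).1 heq))
    refine ⟨w '' D.C, ?_, ?_, ?_⟩
    · rintro _ ⟨c, hc, rfl⟩
      obtain ⟨j, hj, i, hi, h3⟩ := hocc c hc
      exact G.subset_vertexSet_of_mem_edgeSet' ((hG _).mpr ⟨j, hj, rfl⟩) ⟨i, hi, h3⟩
    · rw [hwinj.ncard_image, hD.card_core]
    · intro f hf' hcard
      -- A `k`-subset omits some `w c`, so it is contained in the hyperedge opposite to `c` and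
      -- equals it by cardinality.
      obtain ⟨t, ⟨c, hc, rfl⟩, ht⟩ : ∃ t ∈ w '' D.C, t ∉ f := by
        by_contra hcon
        push Not at hcon
        have h1 := Set.ncard_le_ncard (s := w '' D.C) (t := f) hcon
          ((hCfin.image w).subset hf')
        rw [hwinj.ncard_image, hD.card_core, hcard] at h1
        omega
      obtain ⟨j, hj, σ, -, hσ'⟩ := key c hc
      refine (hG f).mpr ⟨j, hj, Set.eq_of_subset_of_ncard_le ?_ ?_ ?_⟩
      · intro v hv
        obtain ⟨c', hc', rfl⟩ := hf' hv
        have hne : c' ≠ c := fun h => ht (h ▸ hv)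
        obtain ⟨h1, h2⟩ := hσ' c' ⟨hc', hne⟩
        exact ⟨σ c', h1, h2.symm⟩
      · rw [hcardE j hj, hcard]
      · exact (Set.finite_Iio _).image _
  · rintro ⟨T, hTV, hTcard, hT⟩
    have hTfin : T.Finite := Set.finite_of_ncard_pos (by omega)
    obtain ⟨w, hw⟩ : ∃ w : α → ℕ, Set.BijOn w D.C T := by
      refine hCfin.exists_bijOn_of_encard_eq ?_
      rw [← hCfin.cast_ncard_eq, ← hTfin.cast_ncard_eq, hD.card_core, hTcard]
    refine ⟨fun c => lab (w c), fun c hc => ?_⟩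
    have hedge := hT (T \ {w c}) Set.sdiff_subset (by
      rw [Set.ncard_sdiff_singleton_of_mem (hw.mapsTo hc), hTcard, Nat.add_sub_cancel])
    obtain ⟨j, hj, hje⟩ := (hG _).mp hedge
    have hσ : ∀ c' ∈ D.C \ {c}, ∃ i < e.k, e.vtx j i = w c' := fun c' hc' => by
      have : w c' ∈ T \ {w c} := ⟨hw.mapsTo hc'.1, fun h => hc'.2 (hw.injOn hc'.1 hc h)⟩
      rw [hje] at this
      exact this
    choose! σ hσk hσw using hσ
    refine ⟨j, hj, σ, fun a ha b hb hab => ?_, fun c' hc' => ⟨hk ▸ hσk c' hc', ?_⟩⟩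
    · refine hw.injOn ha.1 hb.1 ?_
      rw [← hσw a ha, ← hσw b hb, hab]
    · simp only [hσw c' hc']

end Gadget

end Hypergraph

/-! ## The reduction -/

namespace RAM

theorem ComputesWithin.mono {P : Program} {x : List ℕ} {B B' y : ℕ} {T T' : ℝ}
    (h : ComputesWithin P x B T y) (hB : B ≤ B') (hT : T ≤ T') : ComputesWithin P x B' T' y := by
  obtain ⟨t, ht, hpc, hy, hb⟩ := h
  exact ⟨t, ht.trans hT, hpc, hy, fun i hi a =>
    ⟨(hb i hi a).1.trans_le hB, (hb i hi a).2.trans_le hB⟩⟩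

theorem ComputesWithin.floor {P : Program} {x : List ℕ} {B y : ℕ} {T : ℝ}
    (h : ComputesWithin P x B T y) : ComputesWithin P x B (⌊T⌋₊ : ℕ) y := by
  obtain ⟨t, ht, hpc, hy, hb⟩ := h
  exact ⟨t, Nat.cast_le.mpr (Nat.le_floor ht), hpc, hy, hb⟩

theorem run_eq_of_le {P : Program} {x : List ℕ} {t u : ℕ} (h : P.length ≤ (run P x t).pc)
    (htu : t ≤ u) : run P x u = run P x t := by
  obtain ⟨d, rfl⟩ := Nat.exists_eq_add_of_le htu
  have hfix : step P (run P x t) = run P x t := by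
    simp [step, List.getElem?_eq_none h]
  rw [run, Nat.add_comm, Function.iterate_add_apply]
  exact Function.iterate_fixed hfix d

theorem ComputesWithin.unique {P : Program} {x : List ℕ} {B B' y y' : ℕ} {T T' : ℝ}
    (h : ComputesWithin P x B T y) (h' : ComputesWithin P x B' T' y') : y = y' := by
  obtain ⟨t, -, hpc, rfl, -⟩ := h
  obtain ⟨t', -, hpc', rfl, -⟩ := h'
  rcases le_total t t' with htt | htt
  · rw [run_eq_of_le hpc htt]
  · rw [run_eq_of_le hpc' htt]

theorem Params.signedSum_eq (b : Bool) (y : Run → ℕ) (us : List Run) :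
    Params.signedSum b y us = (us.map fun u => if u.positive = b then y u else 0).sum := by
  induction us with
  | nil => rfl
  | cons u us ih =>
    rw [List.map_cons, List.sum_cons, ← ih]
    by_cases h : u.positive = b <;> simp [Params.signedSum, h]

end RAM

theorem List.length_flatMap_length_cons {k : ℕ} {L : List (List ℕ)}
    (hL : ∀ a ∈ L, a.length = k) :
    (L.flatMap fun a => a.length :: a).length = L.length * (k + 1) := by
  induction L with
  | nil => simp
  | cons a L ih =>
    rw [List.flatMap_cons, List.length_append, ih fun b hb => hL b (by simp [hb]),
      List.length_cons, List.length_cons, hL a (by simp)]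
    ring

theorem List.getD_flatMap_length_cons {k : ℕ} : ∀ (L : List (List ℕ)) (j i : ℕ),
    (∀ a ∈ L, a.length = k) → j < L.length → i < k →
    (L.flatMap fun a => a.length :: a).getD (j * (k + 1) + (i + 1)) 0 = (L.getD j []).getD i 0
  | [], _, _, _, hj, _ => absurd hj (Nat.not_lt_zero _)
  | a :: L, 0, i, hL, _, hi => by
    have ha := hL a (by simp)
    rw [List.flatMap_cons, List.getD_append _ _ _ _ (by simp; omega)]
    simp
  | a :: L, j + 1, i, hL, hj, hi => by
    have ha := hL a (by simp)
    rw [List.flatMap_cons, List.getD_append_right _ _ _ _ (by simp [ha, Nat.add_mul]; omega),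
      List.length_cons, ha, List.getD_cons_succ,
      ← List.getD_flatMap_length_cons L j i (fun b hb => hL b (by simp [hb])) (by simpa using hj)
        hi]
    congr 1
    rw [Nat.add_mul]
    omega

/-! ### Reading the input, and the choice of constants -/

namespace Hypergraph

/-- The vertices of the hyperedges in an encoding of a hypergraph of regular arity. -/
theorem Encodes.exists_vtx {k : ℕ} {x : List ℕ} {G : Hypergraph ℕ} (h : Encodes x G)
    (hk : HasRegularArity k G) : ∃ vtx : ℕ → ℕ → ℕ,
      (∀ j < G.edgeSet.ncard, ∀ i < k, vtx j i < G.vertexSet.ncard) ∧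
      (∀ j < G.edgeSet.ncard, Set.InjOn (vtx j) (Set.Iio k)) ∧
      (∀ f, f ∈ G.edgeSet ↔ ∃ j < G.edgeSet.ncard, f = vtx j '' Set.Iio k) ∧
      x.getD 1 0 = G.edgeSet.ncard ∧
      (∀ j < G.edgeSet.ncard, ∀ i < k, x.getD (3 + j * (k + 1) + i) 0 = vtx j i) ∧
      (∀ a, G.edgeSet.ncard * (k + 1) + 2 ≤ a → x.getD a 0 = 0) ∧
      ∀ v ∈ x, v ≤ G.vertexSet.ncard + G.edgeSet.ncard + k := by
  obtain ⟨n, L, hV, hL, hnd, hE, rfl⟩ := h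
  have hm : G.edgeSet.ncard = L.length := by rw [hE, Gadget.ncard_setOf_mem_list hnd]
  have hn : G.vertexSet.ncard = n := by rw [hV]; simp [Set.ncard_eq_toFinset_card']
  have hlen : ∀ a ∈ L, a.length = k := fun a ha => by
    have h1 := hk {v | v ∈ a} (hE ▸ ⟨a, ha, rfl⟩)
    have h2 : {v | v ∈ a} = (a.toFinset : Set ℕ) := by ext; simp
    rw [h2, Set.encard_coe_eq_coe_finsetCard, List.toFinset_card_of_nodup (hL a ha).2] at h1
    exact_mod_cast h1
  have hvlt : ∀ a ∈ L, ∀ v ∈ a, v < n := fun a ha v hv => by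
    have := G.subset_vertexSet_of_mem_edgeSet' (hE ▸ ⟨a, ha, rfl⟩ : {v | v ∈ a} ∈ G.edgeSet) hv
    rwa [hV] at this
  rw [hm, hn]
  have hget : ∀ j (hj : j < L.length) i (hi : i < k), ∃ h : i < L[j].length,
      (L.getD j []).getD i 0 = L[j][i] := fun j hj i hi => by
    have h1 : i < L[j].length := by rw [hlen _ (List.getElem_mem hj)]; exact hi
    exact ⟨h1, by rw [List.getD_eq_getElem _ _ hj, List.getD_eq_getElem _ _ h1]⟩
  refine ⟨fun j i => (L.getD j []).getD i 0, fun j hj i hi => ?_, fun j hj i hi i' hi' heq => ?_,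
    fun f => ?_, by simp, fun j hj i hi => ?_, fun a ha => ?_, fun v hv => ?_⟩
  · obtain ⟨h1, h2⟩ := hget j hj i hi
    change (L.getD j []).getD i 0 < n
    rw [h2]
    exact hvlt _ (List.getElem_mem hj) _ (List.getElem_mem h1)
  · obtain ⟨h1, h2⟩ := hget j hj i hi
    obtain ⟨h1', h2'⟩ := hget j hj i' hi'
    simp only [h2, h2'] at heq
    exact (hL _ (List.getElem_mem hj)).2.getElem_inj_iff.mp heq
  · have himg : ∀ j (hj : j < L.length),
        (fun i => (L.getD j []).getD i 0) '' Set.Iio k = {v | v ∈ L[j]} := by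
      intro j hj
      ext v
      constructor
      · rintro ⟨i, hi, rfl⟩
        obtain ⟨h1, h2⟩ := hget j hj i hi
        simp only [h2]
        exact List.getElem_mem h1
      · intro hv
        obtain ⟨i, hi, rfl⟩ := List.mem_iff_getElem.mp hv
        have hi' : i < k := by rwa [hlen _ (List.getElem_mem hj)] at hi
        exact ⟨i, hi', (hget j hj i hi').2⟩
    rw [hE]
    constructor
    · rintro ⟨a, ha, rfl⟩
      obtain ⟨j, hj, rfl⟩ := List.mem_iff_getElem.mp ha
      exact ⟨j, hj, (himg j hj).symm⟩
    · rintro ⟨j, hj, rfl⟩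
      exact ⟨L[j], List.getElem_mem hj, himg j hj⟩
  · change _ = (L.getD j []).getD i 0
    rw [← List.getD_flatMap_length_cons L j i hlen hj hi,
      show 3 + j * (k + 1) + i = j * (k + 1) + (i + 1) + 1 + 1 by ring]
    rw [List.getD_cons_succ, List.getD_cons_succ]
  · refine List.getD_eq_default _ _ ?_
    rw [List.length_cons, List.length_cons, List.length_flatMap_length_cons hlen]
    exact ha
  · rw [List.mem_cons, List.mem_cons, List.mem_flatMap] at hv
    rcases hv with rfl | rfl | ⟨a, ha, hv⟩
    · omega
    · omega
    · rcases List.mem_cons.mp hv with rfl | hv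
      · rw [hlen a ha]; omega
      · have := hvlt a ha v hv
        omega

namespace Gadget

variable {α : Type*} {D : Gadget α} {l : ℕ∞} {H : Hypergraph α}

/-- The constant `A` bounds all constants that occur in the reduction. -/
structure BoundedBy (D : Gadget α) (E : Finset (Set α)) (A : ℕ) : Prop where
  three_le : 3 ≤ A
  k_le : D.k + 1 ≤ A
  Q_le : D.Q ≤ A
  runs_le : E.powerset.card + 1 ≤ A
  N_le : D.N ≤ A
  NQ_le : D.N * D.Q ≤ A
  once_le : ∀ F ∈ E.powerset, (D.once F).length ≤ A
  each_le : ∀ F ∈ E.powerset, (D.each F).length ≤ A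
  length_pre : ∀ F ∈ E.powerset, (D.run E F).pre.length ≤ A
  length_body : ∀ F ∈ E.powerset, (D.run E F).body.length ≤ A
  pre_le : ∀ F ∈ E.powerset, ∀ p ∈ (D.run E F).pre, p.1 ≤ A ∧ p.2 ≤ A
  small : ∀ F ∈ E.powerset, ∀ t ∈ (D.run E F).body, t.Small A D.k

/-- Every requirement holds for all large `A`, and there are finitely many of them. -/
theorem Valid.exists_boundedBy (hD : D.Valid l H) (E : Finset (Set α)) :
    ∃ A, D.BoundedBy E A := by
  classical
  have hge := fun n : ℕ => Filter.eventually_ge_atTop n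
  have hall : ∀ {p : Finset (Set α) → ℕ → Prop},
      (∀ F ∈ E.powerset, ∀ᶠ A in Filter.atTop, p F A) →
        ∀ᶠ A in Filter.atTop, ∀ F ∈ E.powerset, p F A :=
    fun h => (Filter.eventually_all_finset E.powerset).mpr h
  have hpre : ∀ᶠ A in Filter.atTop, ∀ F ∈ E.powerset, ∀ p ∈ (D.run E F).pre,
      p.1 ≤ A ∧ p.2 ≤ A := hall fun F _ =>
    (Filter.eventually_all_finite (List.finite_toSet _)).mpr fun p _ =>
      (hge p.1).and (hge p.2)
  have hbody : ∀ᶠ A in Filter.atTop, ∀ F ∈ E.powerset, ∀ t ∈ (D.run E F).body,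
      t.Small A D.k := hall fun F _ =>
    (Filter.eventually_all_finite (List.finite_toSet _)).mpr fun t ht => by
      have ht : t ∈ (D.run E F).body := ht
      obtain ⟨q, -, ht⟩ := List.mem_flatMap.mp ht
      rcases List.mem_cons.mp ht with rfl | ht
      · exact (hge 0).and (hge _)
      · obtain ⟨v, -, rfl⟩ := List.mem_map.mp ht
        unfold term
        split_ifs
        · filter_upwards [hge D.N, hge (D.idx v)] with A h1 h2
          exact ⟨hD.slot_lt _ _, h1, h2⟩
        · exact (hge _).and (hge _)
        · exact (hge _).and (hge _)
  obtain ⟨A, h⟩ := ((hge 3).and <| (hge (D.k + 1)).and <| (hge D.Q).and <|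
    (hge (E.powerset.card + 1)).and <| (hge D.N).and <| (hge (D.N * D.Q)).and <|
    (hall fun F _ => hge (D.once F).length).and <| (hall fun F _ => hge (D.each F).length).and <|
    (hall fun F _ => hge (D.run E F).pre.length).and <|
    (hall fun F _ => hge (D.run E F).body.length).and <| hpre.and hbody).exists
  obtain ⟨h1, h2, h3, h4, h5, h6, h7, h8, h9, h10, h11, h12⟩ := h
  exact ⟨A, h1, h2, h3, h4, h5, h6, h7, h8, h9, h10, h11, h12⟩

/-- The parameters of the reduction on an input with `n` vertices and `m` hyperedges. -/
def params (D : Gadget α) (E : Finset (Set α)) (A c B n m : ℕ) (vtx : ℕ → ℕ → ℕ) : RAM.Params where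
  n := n
  m := m
  k := D.k
  Q := D.Q
  R := E.powerset.card
  A := A
  B := B
  B' := (3 * A * (n + m + 2)) ^ c
  L := A * (m + 1)
  vtx := vtx

theorem Valid.fits_params (hD : D.Valid l H) {E : Finset (Set α)} {A c B n m : ℕ}
    {vtx : ℕ → ℕ → ℕ} (hA : D.BoundedBy E A) (hB : (3 * A * (n + m + 2)) ^ (c + 3) ≤ B)
    (hvtx : ∀ j < m, ∀ i < D.k, vtx j i < n) : (D.params E A c B n m vtx).Fits := by
  have h3 := hA.three_le
  -- `U` dominates every linear quantity involved. The memory needed is at most `U + U * (U + U ^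
  -- c)`, hence at most `3 * U ^ (c + 2)`, hence at most `U ^ (c + 3)`.
  obtain ⟨U, hU⟩ : ∃ U, U = 3 * A * (n + m + 2) := ⟨_, rfl⟩
  rw [← hU] at hB
  have hUA : 3 * (A * n) + 3 * (A * m) + 6 * A = U := by rw [hU]; ring
  have hAn : 3 * n ≤ A * n := Nat.mul_le_mul_right _ h3
  have hAm : 3 * m ≤ A * m := Nat.mul_le_mul_right _ h3
  have hU2 : U * U ≤ U ^ (c + 3) := by
    rw [← pow_two]; exact Nat.pow_le_pow_right (by omega) (by omega)
  refine ⟨hvtx, hA.k_le, hD.k_le_Q, hA.Q_le, hA.runs_le, h3, ?_, ?_⟩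
  · change m * (D.k + 1) + 2 + (E.powerset.card + 1) *
      (n + (3 * A * (n + m + 2)) ^ c + A * (m + 1) + 2) ≤ B
    rw [← hU]
    have h1 : m * (D.k + 1) ≤ m * A := Nat.mul_le_mul_left _ hA.k_le
    have h2 : (E.powerset.card + 1) * (n + U ^ c + A * (m + 1) + 2) ≤ U * (U + U ^ c) :=
      Nat.mul_le_mul (hA.runs_le.trans (by omega)) (by rw [Nat.mul_add]; omega)
    have h4 : m * (D.k + 1) + 2 ≤ U := by rw [Nat.mul_comm m A] at h1; omega
    have hU3 : 3 ≤ U := by omega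
    have e1 : U ^ 1 ≤ U ^ (c + 2) := Nat.pow_le_pow_right (by omega) (by omega)
    have e2 : U ^ 2 ≤ U ^ (c + 2) := Nat.pow_le_pow_right (by omega) (by omega)
    have e3 : U ^ (c + 1) ≤ U ^ (c + 2) := Nat.pow_le_pow_right (by omega) (by omega)
    have e4 : 3 * U ^ (c + 2) ≤ U ^ (c + 3) := by
      rw [pow_succ U (c + 2), Nat.mul_comm]; exact Nat.mul_le_mul_left _ hU3
    have e5 : U * (U + U ^ c) = U ^ 2 + U ^ (c + 1) := by ring
    rw [pow_one] at e1
    omega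
  · change A * (m * D.Q + m + 2) < B
    have h1 : m * D.Q ≤ m * A := Nat.mul_le_mul_left _ hA.Q_le
    have h2 : A * (m * D.Q + m + 2) ≤ A * U := Nat.mul_le_mul_left _ (by
      rw [Nat.mul_comm m A] at h1; omega)
    have h4 : A * U < U * U := Nat.mul_lt_mul_of_pos_right (by omega) (by omega)
    omega

/-- The word bound must be a pure power of `n + m + 2`. As this base is at least `2`, constant
factors are absorbed into the exponent. -/
theorem exists_pow_le (A c : ℕ) : ∃ C, ∀ n m : ℕ, (3 * A * (n + m + 2)) ^ c ≤ (n + m + 2) ^ C := by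
  refine ⟨(3 * A + 1) * c, fun n m => ?_⟩
  rw [pow_mul]
  refine Nat.pow_le_pow_left ?_ c
  rw [pow_succ]
  refine Nat.mul_le_mul_right _ ?_
  calc 3 * A ≤ 2 ^ (3 * A) := Nat.lt_two_pow_self.le
    _ ≤ (n + m + 2) ^ (3 * A) := Nat.pow_le_pow_left (by omega) _

theorem Valid.sum_lt_iff (hD : D.Valid l H) {m : ℕ} {lb : ℕ → ℕ → ℕ} (hl : D.GoodLabels m lb)
    {E : Finset (Set α)} (hE : (E : Set (Set α)) = H.edgeSet) {y : RAM.Run → ℕ}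
    (hy : ∀ F ∈ E.powerset, y (D.run E F) = homCount H (D.target m lb (F : Set (Set α)))) :
    RAM.Params.signedSum false y (E.powerset.toList.map (D.run E)) <
      RAM.Params.signedSum true y (E.powerset.toList.map (D.run E)) ↔ D.LabelSimplex m lb := by
  rw [← hD.sum_homCount_pos_iff hl hE]
  have hsum : ∀ b, RAM.Params.signedSum b y (E.powerset.toList.map (D.run E)) =
      ∑ F ∈ E.powerset, if decide (Even (E.card - F.card)) = b then
        homCount H (D.target m lb (F : Set (Set α))) else 0 := fun b => by
    rw [RAM.Params.signedSum_eq, List.map_map, Finset.sum_map_toList]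
    exact Finset.sum_congr rfl fun F hF => by
      simp only [Function.comp, hy F hF]
      rfl
  rw [hsum, hsum, ← Nat.cast_lt (α := ℤ), ← sub_pos, Nat.cast_sum, Nat.cast_sum,
    ← Finset.sum_sub_distrib]
  refine Iff.of_eq (congrArg _ (Finset.sum_congr rfl fun F _ => ?_))
  by_cases h : Even (E.card - F.card)
  · simp [h, h.neg_one_pow]
  · simp [h, (Nat.not_even_iff_odd.mp h).neg_one_pow]

end Gadget

end Hypergraph

-- The pattern is fixed, so the number of runs, the rank of the targets and their degeneracy are
-- bounded independently of the input, and each run takes time `O(m ^ γ)`.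
open Hypergraph in
theorem simplexDetectableInTime_of_valid {α : Type*} {l : ℕ∞} {H : Hypergraph α}
    (hfin : H.IsFiniteProper) {D : Gadget α} (hD : D.Valid l H) {γ : ℝ} (hγ : 1 < γ)
    (h : HomComputableInTime l H γ) : SimplexDetectableInTime D.k γ := by
  classical
  obtain ⟨P, c, f, hP⟩ := h
  -- Copies are images of hyperedges of `H`, so all targets have rank at most `N`, and one constant
  -- `K` serves every input.
  obtain ⟨K, hK⟩ := hP D.N
  have hEfin : H.edgeSet.Finite :=
    hfin.1.powerset.subset fun e he => H.subset_vertexSet_of_mem_edgeSet' he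
  obtain ⟨E, hE⟩ : ∃ E : Finset (Set α), (E : Set (Set α)) = H.edgeSet :=
    ⟨hEfin.toFinset, hEfin.coe_toFinset⟩
  obtain ⟨A, hA⟩ := hD.exists_boundedBy E
  obtain ⟨C, hC⟩ := Gadget.exists_pow_le A (c + 3)
  set us := E.powerset.toList.map (D.run E) with hus
  have huslen : us.length = E.powerset.card := by simp [hus]
  -- Nothing is known about `f`, not even its sign or monotonicity. The sum of `|f κ|` over the
  -- finitely many possible degeneracies bounds it.
  set fmax : ℝ := ∑ κ ∈ Finset.range (2 ^ D.N + 1), |f κ| with hfmax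
  set K₁ : ℝ := fmax * (|K| * (2 * A : ℝ) ^ γ) with hK₁
  have hfmax0 : 0 ≤ fmax := Finset.sum_nonneg fun _ _ => abs_nonneg _
  have hK₁0 : 0 ≤ K₁ := by positivity
  -- The exponent of the logarithm is `0`: this reduction loses only a constant factor.
  refine ⟨(RAM.reduction P D.k D.Q us).gen 0, C, 0,
    RAM.Params.cost D.k D.Q us + 3 * K₁ * us.length, fun G x hx hG => ?_⟩
  obtain ⟨vtx, hvlt, hvinj, hGE, hx1, hxin, hxblank, hxle⟩ := hx.exists_vtx hG
  set n := G.vertexSet.ncard with hn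
  set m := G.edgeSet.ncard with hm
  set e := D.params E A c ((n + m + 2) ^ C) n m vtx with he
  have hf : e.Fits := hD.fits_params hA (hC n m) hvlt
  have hA3 := hA.three_le
  have hload : e.Loaded (RAM.init x).reg (RAM.init x).mem :=
    ⟨fun _ => rfl, hx1, hxin, hxblank⟩
  have hxB : ∀ v ∈ x, v < e.B := fun v hv => by
    refine (hxle v hv).trans_lt (lt_of_lt_of_le ?_ (hC n m))
    have h1 : n + m + 2 ≤ A * (n + m + 2) := Nat.le_mul_of_pos_left _ (by omega)
    have h2 := hA.k_le
    have h3 : A * 2 ≤ A * (n + m + 2) := Nat.mul_le_mul_left _ (by omega)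
    calc n + m + D.k < 3 * A * (n + m + 2) := by rw [Nat.mul_assoc]; omega
      _ ≤ (3 * A * (n + m + 2)) ^ (c + 3) := Nat.le_self_pow (by omega) _
  have hsuits : ∀ u ∈ us, e.Suits u := by
    intro u hu
    obtain ⟨F, hF, rfl⟩ := List.mem_map.mp hu
    rw [Finset.mem_toList] at hF
    refine ⟨hA.pre_le F hF, hA.small F hF, ?_⟩
    have h1 := hA.length_pre F hF
    have h2 : m * (D.run E F).body.length ≤ m * A := Nat.mul_le_mul_left _ (hA.length_body F hF)
    change _ + m * _ ≤ A * (m + 1)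
    rw [Nat.mul_add, Nat.mul_comm A m]
    omega
  set T : ℝ := K₁ * ((m : ℝ) + 1) ^ γ with hT
  have hT0 : 0 ≤ T := by positivity
  have hrun : ∀ lab, e.IsLabelling lab → ∀ F ∈ E.powerset,
      RAM.ComputesWithin P ((D.run E F).input e.m fun j i => lab (e.vtx j i)) e.B' (⌊T⌋₊ : ℕ)
        (homCount H (D.target m (fun j i => lab (e.vtx j i)) (F : Set (Set α)))) := by
    intro lab hlab F hF
    have hFE : (F : Set (Set α)) ⊆ H.edgeSet :=
      hE ▸ Finset.coe_subset.mpr (Finset.mem_powerset.mp hF)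
    have hl := Gadget.goodLabels_of_isLabelling (D := D) hf rfl rfl hlab hvinj
    obtain ⟨henc, hcard⟩ := hD.encodes_run hl hfin.2 E hFE
    have hn' : (D.target m (fun j i => lab (e.vtx j i)) (F : Set (Set α))).vertexSet.ncard =
        D.N * (m * D.Q + 1) := by
      change (Set.Iio (D.N * (m * D.Q + 1))).ncard = _
      simp [Set.ncard_eq_toFinset_card']
    -- The number of target vertices is linear in `m` and does not involve `n`; labelling by
    -- occurrences serves this purpose.
    have hn'A : D.N * (m * D.Q + 1) ≤ A * m + A := by
      have h1 : D.N * D.Q * m ≤ A * m := Nat.mul_le_mul_right _ hA.NQ_le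
      have h2 := hA.N_le
      rw [show D.N * (m * D.Q + 1) = D.N * D.Q * m + D.N by ring]
      omega
    refine (RAM.ComputesWithin.mono (hK _ _ henc (hD.rank_target hFE)) ?_ ?_).floor
    · refine Nat.pow_le_pow_left ?_ c
      erw [hn', hcard]
      have h1 := hA.once_le F hF
      have h2 : m * (D.each F).length ≤ m * A := Nat.mul_le_mul_left _ (hA.each_le F hF)
      change _ + (_ + m * _) + 2 ≤ 3 * A * (n + m + 2)
      rw [show 3 * A * (n + m + 2) = 3 * (A * n) + 3 * (A * m) + 6 * A by ring]
      rw [Nat.mul_comm m A] at h2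
      omega
    · change f (degeneracy l (D.target m (fun j i => lab (e.vtx j i)) (F : Set (Set α)))) *
        (K * (((D.target m (fun j i => lab (e.vtx j i)) (F : Set (Set α))).vertexSet.ncard : ℝ) +
          1) ^ γ) ≤ T
      rw [hn', hT, hK₁]
      have hdeg := hD.degeneracy_target_le (m := m) (lb := fun j i => lab (e.vtx j i))
        (F : Set (Set α)) hFE
      have h1 : |f (degeneracy l (D.target m (fun j i => lab (e.vtx j i)) (F : Set (Set α))))| ≤
          fmax :=
        Finset.single_le_sum (f := fun κ => |f κ|) (fun _ _ => abs_nonneg _)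
          (Finset.mem_range.mpr (Nat.lt_succ_of_le hdeg))
      have h2 : ((D.N * (m * D.Q + 1) : ℕ) : ℝ) + 1 ≤ 2 * A * ((m : ℝ) + 1) := by
        have : D.N * (m * D.Q + 1) + 1 ≤ 2 * A * (m + 1) := by
          rw [show 2 * A * (m + 1) = 2 * (A * m) + 2 * A by ring]
          omega
        exact_mod_cast this
      have h3 : (((D.N * (m * D.Q + 1) : ℕ) : ℝ) + 1) ^ γ ≤
          (2 * A : ℝ) ^ γ * ((m : ℝ) + 1) ^ γ := by
        rw [← Real.mul_rpow (by positivity) (by positivity)]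
        exact Real.rpow_le_rpow (by positivity) h2 (by linarith)
      have h4 : |K| * (((D.N * (m * D.Q + 1) : ℕ) : ℝ) + 1) ^ γ ≤
          |K| * ((2 * A : ℝ) ^ γ * ((m : ℝ) + 1) ^ γ) :=
        mul_le_mul_of_nonneg_left h3 (abs_nonneg K)
      refine (le_abs_self _).trans ?_
      rw [abs_mul, abs_mul, abs_of_nonneg (Real.rpow_nonneg (by positivity : (0 : ℝ) ≤
        ((D.N * (m * D.Q + 1) : ℕ) : ℝ) + 1) γ)]
      refine (mul_le_mul h1 h4 (by positivity) hfmax0).trans_eq ?_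
      ring
  -- Outputs have to be a function of the run, which need not determine `F`. Some output is chosen
  -- here and identified later, since a program has at most one output on an input.
  set y : (ℕ → ℕ) → RAM.Run → ℕ := fun lab u => Classical.epsilon fun y =>
    RAM.ComputesWithin P (u.input e.m fun j i => lab (e.vtx j i)) e.B' (⌊T⌋₊ : ℕ) y with hy
  obtain ⟨lab, hlab, hcomp⟩ := RAM.Params.computesWithin_reduction hf (us := us) huslen.symm hload
    hxB hsuits (P := P) (T := ⌊T⌋₊) (y := y) (by
      intro lab hlab u hu
      obtain ⟨F, hF, rfl⟩ := List.mem_map.mp hu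
      rw [Finset.mem_toList] at hF
      exact Classical.epsilon_spec ⟨_, hrun lab hlab F hF⟩)
  have hl := Gadget.goodLabels_of_isLabelling (D := D) hf rfl rfl hlab hvinj
  have hiff : RAM.Params.signedSum false (y lab) us < RAM.Params.signedSum true (y lab) us ↔
      ContainsSimplex D.k G := by
    rw [← hD.labelSimplex_iff hf rfl hlab hvinj hGE]
    refine hD.sum_lt_iff hl hE fun F hF => ?_
    exact (Classical.epsilon_spec
      (p := fun y => RAM.ComputesWithin P ((D.run E F).input e.m fun j i => lab (e.vtx j i)) e.B'
        (⌊T⌋₊ : ℕ) y) ⟨_, hrun lab hlab F hF⟩).unique (hrun lab hlab F hF)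
  have hdec : (if RAM.Params.signedSum false (y lab) us < RAM.Params.signedSum true (y lab) us
      then 1 else 0) = if ContainsSimplex D.k G then 1 else 0 := by
    simp only [hiff]
  rw [← hdec]
  refine hcomp.mono le_rfl ?_
  -- Since `γ > 1`, the linear cost of labelling and writing is absorbed into `m ^ γ`.
  have hm1 : ((m : ℝ) + 1) ≤ ((m : ℝ) + 1) ^ γ :=
    Real.self_le_rpow_of_one_le (by linarith [(Nat.cast_nonneg m : (0 : ℝ) ≤ m)]) hγ.le
  have hfl : ((⌊T⌋₊ : ℕ) : ℝ) ≤ K₁ * ((m : ℝ) + 1) ^ γ := Nat.floor_le hT0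
  rw [pow_zero, mul_one]
  push_cast
  have h1 := mul_le_mul_of_nonneg_left hm1
    (Nat.cast_nonneg (RAM.Params.cost D.k D.Q us) : (0 : ℝ) ≤ _)
  have h2 := mul_le_mul_of_nonneg_right hfl (Nat.cast_nonneg us.length : (0 : ℝ) ≤ _)
  change (RAM.Params.cost D.k D.Q us : ℝ) * ((m : ℝ) + 1) + 3 * (⌊T⌋₊ : ℝ) * (us.length : ℝ) ≤ _
  linarith

theorem mainTheorem5 {α : Type*} (l : ℕ∞) (H : Hypergraph α) (hfin : H.IsFiniteProper)
    (hH : Hypergraph.ContainsObstruction l H) :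
    ∃ k : ℕ, 2 ≤ k ∧ ∀ γ : ℝ, 1 < γ →
      HomComputableInTime l H γ → SimplexDetectableInTime k γ := by
  obtain ⟨D, hD⟩ := Hypergraph.exists_gadget hfin hH
  exact ⟨D.k, hD.two_le, fun γ hγ h => simplexDetectableInTime_of_valid hfin hD hγ h⟩
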